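/- **Conventions.** 2-categories, 2-functors, 2-natural transformations, 2-monads, their algebras, and (co)limits are all strict. A 2-category $K$ is *infinitely distributive* if it has finite products and small coproducts, in the strict 2-dimensional sense (the universal property is an isomorphism of hom-categories), and the products distribute over the coproducts, i.e. $A\times-$ preserves small coproducts for every $A$. An *operad* $P$ in $K$ is a non-symmetric operad, with respect to finite products, in the underlying 1-category of $K$. A *$K$-graph* $X$ is a (small) set of objects $X_0$ with an object $X(a,b)$ of $K$ for all $a,b\in X_0$; a morphism $F\colon X\to Y$ is a function $F\colon X_0\to Y_0$ with 1-cells $F_{ab}\colon X(a,b)\to Y(Fa,Fb)$; a 2-cell $\alpha\colon F\Rightarrow G$ exists only if $F$ and $G$ agree on objects, and is then a family of 2-cells $\alpha_{ab}\colon F_{ab}\Rightarrow G_{ab}$ of $K$. These form a 2-category $K\text{-}\mathbf{Gph}$. A *$(K,P)$-category* is a $K$-graph $X$ with composition 1-cells $m\colon P(k)\times X(x_{k-1},x_k)\times\cdots\times X(x_0,x_1)\to X(x_0,x_k)$ for all $k\ge 0$ and $x_0,\dots,x_k\in X_0$, compatible with the unit and composition of $P$. A *strict $(K,P)$-functor*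 is a graph morphism commuting with these 1-cells. A *$(K,P)$-icon* $\alpha\colon F\Rightarrow G$ between strict functors $X\to Y$ is a 2-cell of $K$-graphs such that $\alpha_{x_0x_k}$ whiskered with the composition $m$ of $X$ equals $1\times\alpha_{x_{k-1}x_k}\times\cdots\times\alpha_{x_0x_1}$ whiskered with the composition $m'$ of $Y$, for all $k\ge 0$ and $x_0,\dots,x_k\in X_0$. These form a 2-category $K\text{-}\mathbf{Cat}_P$ with a forgetful 2-functor $U\colon K\text{-}\mathbf{Cat}_P\to K\text{-}\mathbf{Gph}$. **Proposition.** Let $K$ be an infinitely distributive 2-category and $P$ an operad in $K$. Then $K\text{-}\mathbf{Cat}_P$ is 2-monadic over $K\text{-}\mathbf{Gph}$ via a 2-monad $\mathsf{fc}_P$: the 2-functor $U$ has a left 2-adjoint inducing the 2-monad $\mathsf{fc}_P$ on $K\text{-}\mathbf{Gph}$, and the canonical comparison 2-functor from $K\text{-}\mathbf{Cat}_P$ to the 2-category of strict $\mathsf{fc}_P$-algebras, strict algebra maps and algebra 2-cells is an isomorphism of 2-categories. The underlying 1-monad of $\mathsf{fc}_P$ is the free $(K,P)$-category monad: it is induced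 by the left adjoint of the underlying 1-functor of $U$, and, up to identifying objects along the unit, $\mathsf{fc}_P(X)$ has the same objects as $X$ and $$\mathsf{fc}_P(X)(a,b)=\coprod_{k\ge 0,\ a=x_0,x_1,\dots,x_k=b}P(k)\times X(x_{k-1},x_k)\times\cdots\times X(x_0,x_1),$$ where the coproduct injections are the unit on each factor $X(x_{i-1},x_i)$ followed by composition in the free $(K,P)$-category on $X$. Furthermore, the 2-category $K\text{-}\mathbf{Cat}_P$ is itself infinitely distributive. -/

import Mathlib

open CategoryTheory CategoryTheory.Limits CategoryTheory.Bicategory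

-- Avoids a second, definitionally equal, route from a category to its quiver of 1-cells.
attribute [-instance] CategoryTheory.catToReflQuiver

universe w w₂ v u w' w₂' v' u'

/-! ### Universal properties in a strict 2-category -/

section Universal

variable {B : Type u} [Bicategory.{w₂, v} B]

/-- `π` exhibits `p` as the strict 2-product of the family `X`: for every `Z` the functor
`B(Z, p) → ∏ i, B(Z, X i)` is an isomorphism of categories, that is, it is bijective on objects
(1-cells) and on morphisms (2-cells). -/
structure IsTwoProduct {ι : Type*} (X : ι → B) (p : B) (π : ∀ i, p ⟶ X i) : Prop where
  existsUnique_lift : ∀ (Z : B) (f : ∀ i, Z ⟶ X i), ∃! g : Z ⟶ p, ∀ i, g ≫ π i = f i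
  existsUnique_lift₂ : ∀ (Z : B) (g h : Z ⟶ p) (α : ∀ i, g ≫ π i ⟶ h ≫ π i),
    ∃! β : g ⟶ h, ∀ i, β ▷ π i = α i

/-- `j` exhibits `c` as the strict 2-coproduct of the family `X`: for every `Z` the functor
`B(c, Z) → ∏ i, B(X i, Z)` is an isomorphism of categories. -/
structure IsTwoCoproduct {ι : Type*} (X : ι → B) (c : B) (j : ∀ i, X i ⟶ c) : Prop where
  existsUnique_desc : ∀ (Z : B) (f : ∀ i, X i ⟶ Z), ∃! g : c ⟶ Z, ∀ i, j i ≫ g = f i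
  existsUnique_desc₂ : ∀ (Z : B) (g h : c ⟶ Z) (α : ∀ i, j i ≫ g ⟶ j i ≫ h),
    ∃! β : g ⟶ h, ∀ i, j i ◁ β = α i

end Universal

/-- A strict 2-category has finite products, in the strict 2-dimensional sense. -/
class HasFiniteTwoProducts (K : Type u) [Bicategory.{w₂, v} K] [Bicategory.Strict K] : Prop where
  exists_isTwoProduct : ∀ (n : ℕ) (X : Fin n → K), ∃ (p : K) (π : ∀ i, p ⟶ X i),
    IsTwoProduct X p π

instance HasFiniteTwoProducts.hasFiniteProducts (K : Type u) [Bicategory.{w₂, v} K]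
    [Bicategory.Strict K] [HasFiniteTwoProducts K] : HasFiniteProducts K where
  out n := by
    have key (X : Fin n → K) : HasProduct X := by
      obtain ⟨p, π, h⟩ := HasFiniteTwoProducts.exists_isTwoProduct n X
      exact ⟨⟨{
        cone := Fan.mk p π
        isLimit := Fan.IsLimit.mk _
          (fun s => (h.existsUnique_lift s.pt s.proj).choose)
          (fun s => (h.existsUnique_lift s.pt s.proj).choose_spec.1)
          (fun s _ hm => (h.existsUnique_lift s.pt s.proj).choose_spec.2 _ hm) }⟩⟩
    exact ⟨fun F => hasLimit_of_iso (Discrete.natIsoFunctor (F := F)).symm⟩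

/-- A strict 2-category is infinitely distributive if it has finite products and small coproducts
(both in the strict 2-dimensional sense) and the products distribute over the coproducts. -/
structure InfinitelyDistributive (K : Type u) [Bicategory.{w₂, v} K] [Bicategory.Strict K] : Prop
    extends HasFiniteTwoProducts K where
  exists_isTwoCoproduct : ∀ (ι : Type w) (X : ι → K), ∃ (c : K) (j : ∀ i, X i ⟶ c),
    IsTwoCoproduct X c j
  distrib : ∀ (A : K) (ι : Type w) (X : ι → K) (c : K) (j : ∀ i, X i ⟶ c),
    IsTwoCoproduct X c j →
      IsTwoCoproduct (fun i => A ⨯ X i) (A ⨯ c) (fun i => prod.map (𝟙 A) (j i))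

/-! ### Calculus of 2-cells in strict 2-categories, up to heterogeneous equality -/

namespace TwoCat

variable {B : Type u} [Bicategory.{w₂, v} B]

theorem whiskerLeft_heq {a b c : B} {f f' : a ⟶ b} {g g' h h' : b ⟶ c} {η : g ⟶ h} {η' : g' ⟶ h'}
    (hf : f = f') (hg : g = g') (hh : h = h') (e : HEq η η') : HEq (f ◁ η) (f' ◁ η') := by
  subst hf hg hh; cases e; rfl

theorem whiskerRight_heq {a b c : B} {f f' : b ⟶ c} {g g' h h' : a ⟶ b} {η : g ⟶ h} {η' : g' ⟶ h'}
    (hf : f = f') (hg : g = g') (hh : h = h') (e : HEq η η') : HEq (η ▷ f) (η' ▷ f') := by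
  subst hf hg hh; cases e; rfl

theorem comp_heq {a b : B} {f f' g g' h h' : a ⟶ b} {η : f ⟶ g} {η' : f' ⟶ g'}
    {θ : g ⟶ h} {θ' : g' ⟶ h'} (hf : f = f') (hg : g = g') (hh : h = h')
    (e : HEq η η') (e' : HEq θ θ') : HEq (η ≫ θ) (η' ≫ θ') := by
  subst hf hg hh; cases e; cases e'; rfl

theorem id_heq {a b : B} {f g : a ⟶ b} (h : f = g) : HEq (𝟙 f) (𝟙 g) := by
  subst h; rfl

theorem eqToHom_heq_id {a b : B} {f g : a ⟶ b} (h : f = g) : HEq (eqToHom h) (𝟙 f) := by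
  subst h; rfl

variable [Strict B]

theorem eqToHom_conj_heq {a b : B} {f f' g g' : a ⟶ b} (hf : f = f') (η : f' ⟶ g') (hg : g' = g) :
    HEq (eqToHom hf ≫ η ≫ eqToHom hg) η := by
  subst hf hg; simp

theorem id_whiskerLeft_heq {a b : B} {f g : a ⟶ b} (η : f ⟶ g) : HEq (𝟙 a ◁ η) η := by
  rw [id_whiskerLeft, Strict.leftUnitor_eqToIso, Strict.leftUnitor_eqToIso]
  exact eqToHom_conj_heq (Strict.id_comp f) η (Strict.id_comp g).symm

theorem whiskerRight_id_heq {a b : B} {f g : a ⟶ b} (η : f ⟶ g) : HEq (η ▷ 𝟙 b) η := by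
  rw [whiskerRight_id, Strict.rightUnitor_eqToIso, Strict.rightUnitor_eqToIso]
  exact eqToHom_conj_heq (Strict.comp_id f) η (Strict.comp_id g).symm

theorem comp_whiskerLeft_heq {a b c d : B} (f : a ⟶ b) (g : b ⟶ c) {h h' : c ⟶ d} (η : h ⟶ h') :
    HEq ((f ≫ g) ◁ η) (f ◁ g ◁ η) := by
  rw [comp_whiskerLeft, Strict.associator_eqToIso, Strict.associator_eqToIso]
  exact eqToHom_conj_heq (Strict.assoc f g h) _ (Strict.assoc f g h').symm

theorem whiskerRight_comp_heq {a b c d : B} {f f' : a ⟶ b} (η : f ⟶ f') (g : b ⟶ c) (h : c ⟶ d) :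
    HEq (η ▷ (g ≫ h)) (η ▷ g ▷ h) := by
  rw [whiskerRight_comp, Strict.associator_eqToIso, Strict.associator_eqToIso]
  exact eqToHom_conj_heq (Strict.assoc f g h).symm _ (Strict.assoc f' g h)

theorem whisker_assoc_heq {a b c d : B} (f : a ⟶ b) {g g' : b ⟶ c} (η : g ⟶ g') (h : c ⟶ d) :
    HEq ((f ◁ η) ▷ h) (f ◁ η ▷ h) := by
  rw [whisker_assoc, Strict.associator_eqToIso, Strict.associator_eqToIso]
  exact eqToHom_conj_heq (Strict.assoc f g h) _ (Strict.assoc f g' h).symm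

end TwoCat

/-! ### Locally defined sub-2-categories -/

/-- Data describing a strict 2-category with type of objects `C`, whose 1-cells and 2-cells are
those 1-cells and 2-cells between underlying objects in a strict 2-category `B` which have given
properties, closed under all operations of `B`. -/
structure StructureOver (B : Type u) [Bicategory.{w₂, v} B] (C : Type u') where
  obj : C → B
  IsHom : ∀ {X Y : C}, (obj X ⟶ obj Y) → Prop
  IsHom₂ : ∀ (X Y : C) {f g : obj X ⟶ obj Y}, (f ⟶ g) → Prop
  isHom_id : ∀ X : C, IsHom (X := X) (Y := X) (𝟙 (obj X))
  isHom_comp : ∀ {X Y Z : C} {f : obj X ⟶ obj Y} {g : obj Y ⟶ obj Z},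
    IsHom f → IsHom g → IsHom (X := X) (Y := Z) (f ≫ g)
  isHom₂_id : ∀ {X Y : C} {f : obj X ⟶ obj Y}, IsHom f → IsHom₂ X Y (𝟙 f)
  isHom₂_comp : ∀ {X Y : C} {f g h : obj X ⟶ obj Y} {η : f ⟶ g} {θ : g ⟶ h},
    IsHom f → IsHom g → IsHom h → IsHom₂ X Y η → IsHom₂ X Y θ → IsHom₂ X Y (η ≫ θ)
  isHom₂_whiskerLeft : ∀ {X Y Z : C} {f : obj X ⟶ obj Y} {g h : obj Y ⟶ obj Z} {η : g ⟶ h},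
    IsHom f → IsHom g → IsHom h → IsHom₂ Y Z η → IsHom₂ X Z (f ◁ η)
  isHom₂_whiskerRight : ∀ {X Y Z : C} {f g : obj X ⟶ obj Y} {h : obj Y ⟶ obj Z} {η : f ⟶ g},
    IsHom f → IsHom g → IsHom h → IsHom₂ X Y η → IsHom₂ X Z (η ▷ h)

namespace StructureOver

variable {B : Type u} [Bicategory.{w₂, v} B] {C : Type u'} (S : StructureOver B C)

/-- The 1-cells of `C`. -/
@[ext]
structure Hom (X Y : C) where
  hom : S.obj X ⟶ S.obj Y
  isHom : S.IsHom hom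

/-- The 2-cells of `C`. -/
@[ext]
structure Hom₂ {X Y : C} (f g : S.Hom X Y) where
  hom : f.hom ⟶ g.hom
  isHom₂ : S.IsHom₂ X Y hom

variable {S} in
theorem Hom₂.heq {X Y : C} {f f' g g' : S.Hom X Y} (hf : f.hom = f'.hom) (hg : g.hom = g'.hom)
    {η : S.Hom₂ f g} {θ : S.Hom₂ f' g'} (e : HEq η.hom θ.hom) : HEq η θ := by
  obtain rfl := Hom.ext hf
  obtain rfl := Hom.ext hg
  exact heq_of_eq (Hom₂.ext (eq_of_heq e))

theorem isHom₂_eqToHom {X Y : C} {f g : S.obj X ⟶ S.obj Y} (hf : S.IsHom f) (e : f = g) :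
    S.IsHom₂ X Y (eqToHom e) := by
  subst e; exact S.isHom₂_id hf

/-- Identities and composition of 1-cells, as in `B`. -/
@[reducible]
def categoryStruct : CategoryStruct C where
  Hom X Y := S.Hom X Y
  id X := ⟨𝟙 (S.obj X), S.isHom_id X⟩
  comp f g := ⟨f.hom ≫ g.hom, S.isHom_comp f.isHom g.isHom⟩

/-- Identities and vertical composition of 2-cells, as in `B`. -/
@[reducible]
def homCategory (X Y : C) : Category (S.Hom X Y) where
  Hom f g := S.Hom₂ f g
  id f := ⟨𝟙 f.hom, S.isHom₂_id f.isHom⟩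
  comp {f g h} η θ := ⟨η.hom ≫ θ.hom, S.isHom₂_comp f.isHom g.isHom h.isHom η.isHom₂ θ.isHom₂⟩
  id_comp _ := Hom₂.ext (Category.id_comp _)
  comp_id _ := Hom₂.ext (Category.comp_id _)
  assoc _ _ _ := Hom₂.ext (Category.assoc _ _ _)

/-- The structural isomorphisms of `B`, which are equalities of 1-cells, as 2-cells of `C`. -/
def isoOfEq {X Y : C} (f g : S.Hom X Y) (φ : f.hom ≅ g.hom) (e : f.hom = g.hom)
    (h : φ = eqToIso e) :
    letI := S.homCategory X Y; f ≅ g :=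
  letI := S.homCategory X Y
  { hom := ⟨φ.hom, by subst h; exact S.isHom₂_eqToHom f.isHom e⟩
    inv := ⟨φ.inv, by subst h; exact S.isHom₂_eqToHom g.isHom e.symm⟩
    hom_inv_id := Hom₂.ext φ.hom_inv_id
    inv_hom_id := Hom₂.ext φ.inv_hom_id }

theorem isoOfEq_eq {X Y : C} (f g : S.Hom X Y) (φ : f.hom ≅ g.hom) (e : f.hom = g.hom)
    (h : φ = eqToIso e) :
    letI := S.homCategory X Y
    S.isoOfEq f g φ e h = eqToIso (Hom.ext e) := by
  cases f; cases g; cases e; cases h; rfl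

variable [Strict B]

/-- The 2-category structure on `C`; all operations are those of `B`. -/
@[reducible]
def bicategory : Bicategory C where
  toCategoryStruct := S.categoryStruct
  homCategory := S.homCategory
  whiskerLeft {_ _ _} f {g h} η :=
    ⟨f.hom ◁ η.hom, S.isHom₂_whiskerLeft f.isHom g.isHom h.isHom η.isHom₂⟩
  whiskerRight {_ _ _ f g} η h :=
    ⟨η.hom ▷ h.hom, S.isHom₂_whiskerRight f.isHom g.isHom h.isHom η.isHom₂⟩
  associator f g h := S.isoOfEq _ _ (α_ f.hom g.hom h.hom) (Strict.assoc _ _ _)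
    (Strict.associator_eqToIso _ _ _)
  leftUnitor f := S.isoOfEq _ _ (λ_ f.hom) (Strict.id_comp _) (Strict.leftUnitor_eqToIso _)
  rightUnitor f := S.isoOfEq _ _ (ρ_ f.hom) (Strict.comp_id _) (Strict.rightUnitor_eqToIso _)
  whiskerLeft_id _ _ := Hom₂.ext (whiskerLeft_id _ _)
  whiskerLeft_comp _ _ _ _ _ _ := Hom₂.ext (whiskerLeft_comp _ _ _)
  id_whiskerLeft _ := Hom₂.ext (id_whiskerLeft _)
  comp_whiskerLeft _ _ _ _ _ := Hom₂.ext (comp_whiskerLeft _ _ _)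
  id_whiskerRight _ _ := Hom₂.ext (id_whiskerRight _ _)
  comp_whiskerRight _ _ _ := Hom₂.ext (comp_whiskerRight _ _ _)
  whiskerRight_id _ := Hom₂.ext (whiskerRight_id _)
  whiskerRight_comp _ _ _ := Hom₂.ext (whiskerRight_comp _ _ _)
  whisker_assoc _ _ _ _ _ := Hom₂.ext (whisker_assoc _ _ _)
  whisker_exchange _ _ := Hom₂.ext (whisker_exchange _ _)
  pentagon _ _ _ _ := Hom₂.ext (pentagon _ _ _ _)
  triangle _ _ := Hom₂.ext (triangle _ _)

theorem strict : @Bicategory.Strict C S.bicategory :=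
  letI := S.bicategory
  { id_comp f := Hom.ext (Strict.id_comp _)
    comp_id f := Hom.ext (Strict.comp_id _)
    assoc f g h := Hom.ext (Strict.assoc _ _ _)
    leftUnitor_eqToIso _ := S.isoOfEq_eq _ _ _ _ _
    rightUnitor_eqToIso _ := S.isoOfEq_eq _ _ _ _ _
    associator_eqToIso _ _ _ := S.isoOfEq_eq _ _ _ _ _ }

/-- The forgetful 2-functor `C → B`. -/
def forget : letI := S.bicategory; StrictPseudofunctor C B :=
  letI := S.bicategory
  haveI := S.strict
  StrictPseudofunctor.mk''
    { obj := S.obj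
      map := fun f => f.hom
      map₂ := fun η => η.hom
      map₂_id := fun _ => rfl
      map₂_comp := fun _ _ => rfl
      map_id := fun _ => rfl
      map_comp := fun _ _ => rfl
      map₂_whisker_left := fun f _ _ η => by simp; rfl
      map₂_whisker_right := fun η f => by simp; rfl }

end StructureOver

/-! ### 2-natural transformations, 2-monads, algebras, 2-adjunctions -/

section TwoMonads

variable {B : Type u} [Bicategory.{w₂, v} B] [Strict B]
  {C : Type u'} [Bicategory.{w₂', v'} C] [Strict C]

theorem CategoryTheory.StrictPseudofunctor.map₂_whiskerLeft_heq (F : StrictPseudofunctor B C)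
    {a b c : B} (f : a ⟶ b) {g h : b ⟶ c} (η : g ⟶ h) :
    HEq (F.map₂ (f ◁ η)) (F.map f ◁ F.map₂ η) := by
  rw [F.map₂_whisker_left, F.mapComp_eq_eqToIso, F.mapComp_eq_eqToIso]
  exact TwoCat.eqToHom_conj_heq (F.map_comp f g) _ (F.map_comp f h).symm

theorem CategoryTheory.StrictPseudofunctor.map₂_whiskerRight_heq (F : StrictPseudofunctor B C)
    {a b c : B} {f g : a ⟶ b} (η : f ⟶ g) (h : b ⟶ c) :
    HEq (F.map₂ (η ▷ h)) (F.map₂ η ▷ F.map h) := by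
  rw [F.map₂_whisker_right, F.mapComp_eq_eqToIso, F.mapComp_eq_eqToIso]
  exact TwoCat.eqToHom_conj_heq (F.map_comp f h) _ (F.map_comp g h).symm

theorem CategoryTheory.StrictPseudofunctor.map₂_heq (F : StrictPseudofunctor B C)
    {a b : B} {f f' g g' : a ⟶ b} (hf : f = f') (hg : g = g') {η : f ⟶ g} {η' : f' ⟶ g'}
    (e : HEq η η') : HEq (F.map₂ η) (F.map₂ η') := by
  subst hf hg; cases e; rfl

/-- A (strict) 2-natural transformation between 2-functors. The two sides of `naturality₂` have
types that agree by `naturality`. -/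
structure TwoNatTrans (F G : StrictPseudofunctor B C) where
  app : ∀ X : B, F.obj X ⟶ G.obj X
  naturality : ∀ {X Y : B} (f : X ⟶ Y), F.map f ≫ app Y = app X ≫ G.map f
  naturality₂ : ∀ {X Y : B} {f g : X ⟶ Y} (η : f ⟶ g),
    HEq (F.map₂ η ▷ app Y) (app X ◁ G.map₂ η)

variable (B) in
/-- A (strict) 2-monad on a 2-category. -/
structure TwoMonad where
  T : StrictPseudofunctor B B
  η : TwoNatTrans (StrictPseudofunctor.id B) T
  μ : TwoNatTrans (T.comp T) T
  left_unit : ∀ X : B, η.app (T.obj X) ≫ μ.app X = 𝟙 (T.obj X)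
  right_unit : ∀ X : B, T.map (η.app X) ≫ μ.app X = 𝟙 (T.obj X)
  assoc : ∀ X : B, T.map (μ.app X) ≫ μ.app X = μ.app (T.obj X) ≫ μ.app X

namespace TwoMonad

/-- The underlying 1-monad of a 2-monad, on the underlying 1-category. -/
def toMonad (M : TwoMonad B) : Monad B where
  toFunctor := M.T.toFunctor
  η := { app := M.η.app, naturality := fun _ _ f => M.η.naturality f }
  μ := { app := M.μ.app, naturality := fun _ _ f => M.μ.naturality f }
  assoc := M.assoc
  left_unit := M.left_unit
  right_unit := M.right_unit

/-- A strict algebra for a 2-monad. -/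
structure Algebra (M : TwoMonad B) where
  A : B
  a : M.T.obj A ⟶ A
  unit : M.η.app A ≫ a = 𝟙 A
  assoc : M.μ.app A ≫ a = M.T.map a ≫ a

/-- Strict algebra maps are the 1-cells `f` with `a ≫ f = T f ≫ b`, and algebra 2-cells are the
2-cells `α` whose whiskerings satisfy `a ◁ α = T α ▷ b` (the cylinder condition). -/
def algebraStructure (M : TwoMonad B) : StructureOver B M.Algebra where
  obj X := X.A
  IsHom {X Y} f := X.a ≫ f = M.T.map f ≫ Y.a
  IsHom₂ X Y _ _ α := HEq (X.a ◁ α) (M.T.map₂ α ▷ Y.a)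
  isHom_id X := by rw [M.T.map_id, Strict.comp_id, Strict.id_comp]
  isHom_comp {X Y Z f g} hf hg := by
    rw [M.T.map_comp, ← Strict.assoc, hf, Strict.assoc, hg, ← Strict.assoc]
  isHom₂_id {X Y f} hf := by
    rw [M.T.map₂_id, whiskerLeft_id, id_whiskerRight]
    exact TwoCat.id_heq hf
  isHom₂_comp {X Y f g h η θ} hf hg hh hη hθ := by
    rw [M.T.map₂_comp, whiskerLeft_comp, comp_whiskerRight]
    exact TwoCat.comp_heq hf hg hh hη hθ
  isHom₂_whiskerLeft {X Y Z f g h η} hf hg hh hη :=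
    (TwoCat.comp_whiskerLeft_heq X.a f η).symm.trans <|
    (TwoCat.whiskerLeft_heq hf rfl rfl HEq.rfl).trans <|
    (TwoCat.comp_whiskerLeft_heq _ _ η).trans <|
    (TwoCat.whiskerLeft_heq rfl hg hh hη).trans <|
    (TwoCat.whisker_assoc_heq _ _ _).symm.trans <|
    TwoCat.whiskerRight_heq rfl (M.T.map_comp f g).symm (M.T.map_comp f h).symm
      (M.T.map₂_whiskerLeft_heq f η).symm
  isHom₂_whiskerRight {X Y Z f g h η} hf hg hh hη :=
    (TwoCat.whisker_assoc_heq X.a η h).symm.trans <|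
    (TwoCat.whiskerRight_heq rfl hf hg hη).trans <|
    (TwoCat.whiskerRight_comp_heq _ _ _).symm.trans <|
    (TwoCat.whiskerRight_heq hh rfl rfl HEq.rfl).trans <|
    (TwoCat.whiskerRight_comp_heq _ _ _).trans <|
    TwoCat.whiskerRight_heq rfl (M.T.map_comp f h).symm (M.T.map_comp g h).symm
      (M.T.map₂_whiskerRight_heq η h).symm

/-- The 2-category `T-Alg` of strict algebras, strict algebra maps and algebra 2-cells. -/
instance (M : TwoMonad B) : Bicategory M.Algebra := M.algebraStructure.bicategory

instance (M : TwoMonad B) : Strict M.Algebra := M.algebraStructure.strict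

end TwoMonad

/-- A (strict) 2-adjunction `F ⊣ U`. -/
structure TwoAdjunction (F : StrictPseudofunctor B C) (U : StrictPseudofunctor C B) where
  unit : TwoNatTrans (StrictPseudofunctor.id B) (F.comp U)
  counit : TwoNatTrans (U.comp F) (StrictPseudofunctor.id C)
  left_triangle : ∀ X : B, F.map (unit.app X) ≫ counit.app (F.obj X) = 𝟙 (F.obj X)
  right_triangle : ∀ Y : C, unit.app (U.obj Y) ≫ U.map (counit.app Y) = 𝟙 (U.obj Y)

namespace TwoAdjunction

variable {F : StrictPseudofunctor B C} {U : StrictPseudofunctor C B} (adj : TwoAdjunction F U)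

/-- The 2-monad `U F` induced by a 2-adjunction `F ⊣ U`. -/
def twoMonad : TwoMonad B where
  T := F.comp U
  η := adj.unit
  μ :=
    { app := fun X => U.map (adj.counit.app (F.obj X))
      naturality := fun f =>
        (U.map_comp _ _).symm.trans <|
        (congrArg U.map (adj.counit.naturality (F.map f))).trans (U.map_comp _ _)
      naturality₂ := fun {X Y f g} η =>
        (U.map₂_whiskerRight_heq _ _).symm.trans <|
        (U.map₂_heq (adj.counit.naturality (F.map f)) (adj.counit.naturality (F.map g))
          (adj.counit.naturality₂ (F.map₂ η))).trans (U.map₂_whiskerLeft_heq _ _) }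
  left_unit X := adj.right_triangle (F.obj X)
  right_unit X :=
    (U.map_comp _ _).symm.trans <|
    (congrArg U.map (adj.left_triangle X)).trans (U.map_id _)
  assoc X :=
    (U.map_comp _ _).symm.trans <|
    (congrArg U.map (adj.counit.naturality (adj.counit.app (F.obj X)))).trans (U.map_comp _ _)

/-- The canonical comparison 2-functor `C → T-Alg` for the 2-monad `T` induced by `F ⊣ U`, sending
`X` to the algebra `U X` with structure map `U ε_X`. -/
def comparison : StrictPseudofunctor C adj.twoMonad.Algebra :=
  StrictPseudofunctor.mk''
    { obj := fun X =>
        { A := U.obj X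
          a := U.map (adj.counit.app X)
          unit := adj.right_triangle X
          assoc := (U.map_comp _ _).symm.trans <|
            (congrArg U.map (adj.counit.naturality (adj.counit.app X)).symm).trans
              (U.map_comp _ _) }
      map := fun {X Y} f =>
        { hom := U.map f
          isHom := (U.map_comp _ _).symm.trans <|
            (congrArg U.map (adj.counit.naturality f).symm).trans (U.map_comp _ _) }
      map₂ := fun {X Y f g} η =>
        { hom := U.map₂ η
          isHom₂ := (U.map₂_whiskerLeft_heq _ _).symm.trans <|
            (U.map₂_heq (adj.counit.naturality f).symm (adj.counit.naturality g).symm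
              (adj.counit.naturality₂ η).symm).trans (U.map₂_whiskerRight_heq _ _) }
      map₂_id := fun _ => StructureOver.Hom₂.ext (U.map₂_id _)
      map₂_comp := fun _ _ => StructureOver.Hom₂.ext (U.map₂_comp _ _)
      map_id := fun _ => StructureOver.Hom.ext (U.map_id _)
      map_comp := fun _ _ => StructureOver.Hom.ext (U.map_comp _ _)
      map₂_whisker_left := fun f _ _ η => by
        refine eq_of_heq (HEq.trans ?_ (TwoCat.eqToHom_conj_heq (B := adj.twoMonad.Algebra) _ _ _).symm)
        exact StructureOver.Hom₂.heq (U.map_comp _ _) (U.map_comp _ _)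
          (U.map₂_whiskerLeft_heq f η)
      map₂_whisker_right := fun η f => by
        refine eq_of_heq (HEq.trans ?_ (TwoCat.eqToHom_conj_heq (B := adj.twoMonad.Algebra) _ _ _).symm)
        exact StructureOver.Hom₂.heq (U.map_comp _ _) (U.map_comp _ _)
          (U.map₂_whiskerRight_heq η f) }

end TwoAdjunction

/-- `Φ` is an isomorphism of 2-categories: it is bijective on objects, 1-cells and 2-cells (so it
has a strict inverse 2-functor). -/
structure IsTwoIso (Φ : StrictPseudofunctor B C) : Prop where
  bijective_obj : Function.Bijective Φ.obj
  bijective_map : ∀ X Y : B, Function.Bijective (Φ.map : (X ⟶ Y) → _)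
  bijective_map₂ : ∀ {X Y : B} (f g : X ⟶ Y), Function.Bijective (Φ.map₂ : (f ⟶ g) → _)

/-- The 2-functor `U : C → B` exhibits `C` as (strictly) 2-monadic over `B` via the 2-monad `M`:
it has a left 2-adjoint inducing `M`, and the canonical comparison 2-functor from `C` to the
2-category of `M`-algebras is an isomorphism of 2-categories. -/
def IsTwoMonadicVia (U : StrictPseudofunctor C B) (M : TwoMonad B) : Prop :=
  ∃ (F : StrictPseudofunctor B C) (adj : TwoAdjunction F U),
    adj.twoMonad = M ∧ IsTwoIso adj.comparison

end TwoMonads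

/-! ### Graphs enriched in a 2-category -/

/-- A (small) graph enriched in `K`. -/
structure KGraph (K : Type u) where
  Obj : Type w
  hom : Obj → Obj → K

namespace KGraph

/-- A morphism of enriched graphs. -/
structure Hom {K : Type u} [Quiver.{v} K] (X Y : KGraph.{w} K) where
  obj : X.Obj → Y.Obj
  map : ∀ a b, X.hom a b ⟶ Y.hom (obj a) (obj b)

variable {K : Type u} [Bicategory.{w₂, v} K]

/-- A 2-cell between morphisms of enriched graphs. It exists only between morphisms with the same
action on objects, and then consists of a 2-cell of `K` for every pair of objects. -/
inductive Hom₂ {X Y : KGraph.{w} K} : Hom X Y → Hom X Y → Type (max w v w₂)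
  | mk (f : X.Obj → Y.Obj) {F G : ∀ a b, X.hom a b ⟶ Y.hom (f a) (f b)}
      (α : ∀ a b, F a b ⟶ G a b) : Hom₂ ⟨f, F⟩ ⟨f, G⟩

/-- Identities and composition of graph morphisms, inherited from `K`. -/
@[reducible]
def categoryStruct : CategoryStruct (KGraph.{w} K) where
  Hom X Y := Hom X Y
  id X := ⟨fun a => a, fun a b => 𝟙 (X.hom a b)⟩
  comp F G := ⟨fun a => G.obj (F.obj a), fun a b => F.map a b ≫ G.map (F.obj a) (F.obj b)⟩

namespace Hom₂

variable {X Y Z : KGraph.{w} K}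

/-- The identity 2-cell. -/
def id : ∀ F : Hom X Y, Hom₂ F F
  | ⟨f, F⟩ => mk f fun a b => 𝟙 (F a b)

/-- Vertical composition of 2-cells. -/
def comp : ∀ {F G H : Hom X Y}, Hom₂ F G → Hom₂ G H → Hom₂ F H
  | _, _, _, mk f α, mk _ β => mk f fun a b => α a b ≫ β a b

/-- Whiskering on the left. -/
def whiskerLeft (F : Hom X Y) : ∀ {G H : Hom Y Z}, Hom₂ G H →
    Hom₂ (categoryStruct.comp F G) (categoryStruct.comp F H)
  | _, _, mk g β => mk (fun a => g (F.obj a)) fun a b => F.map a b ◁ β (F.obj a) (F.obj b)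

/-- Whiskering on the right. -/
def whiskerRight : ∀ {F G : Hom X Y}, Hom₂ F G → ∀ H : Hom Y Z,
    Hom₂ (categoryStruct.comp F H) (categoryStruct.comp G H)
  | _, _, mk f α, H => mk (fun a => H.obj (f a)) fun a b => α a b ▷ H.map (f a) (f b)

end Hom₂

/-- Vertical composition of 2-cells of graphs, inherited from `K`. -/
@[reducible]
def homCategory (X Y : KGraph.{w} K) : Category (Hom X Y) where
  Hom F G := Hom₂ F G
  id F := Hom₂.id F
  comp α β := Hom₂.comp α β
  id_comp := by rintro _ _ ⟨f, α⟩; simp [Hom₂.id, Hom₂.comp]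
  comp_id := by rintro _ _ ⟨f, α⟩; simp [Hom₂.id, Hom₂.comp]
  assoc := by rintro _ _ _ _ ⟨f, α⟩ ⟨_, β⟩ ⟨_, γ⟩; simp [Hom₂.comp]

/-- Invertible 2-cells from componentwise invertible 2-cells. -/
def isoMk {X Y : KGraph.{w} K} (f : X.Obj → Y.Obj) {F G : ∀ a b, X.hom a b ⟶ Y.hom (f a) (f b)}
    (α : ∀ a b, F a b ≅ G a b) :
    letI := homCategory X Y; (⟨f, F⟩ : Hom X Y) ≅ ⟨f, G⟩ :=
  letI := homCategory X Y
  { hom := Hom₂.mk f fun a b => (α a b).hom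
    inv := Hom₂.mk f fun a b => (α a b).inv
    hom_inv_id := by simp [Hom₂.id, Hom₂.comp, CategoryStruct.id, CategoryStruct.comp]
    inv_hom_id := by simp [Hom₂.id, Hom₂.comp, CategoryStruct.id, CategoryStruct.comp] }

/-- The 2-category of `K`-graphs. -/
instance : Bicategory (KGraph.{w} K) where
  toCategoryStruct := categoryStruct
  homCategory := homCategory
  whiskerLeft F _ _ β := Hom₂.whiskerLeft F β
  whiskerRight α H := Hom₂.whiskerRight α H
  associator F G H := isoMk _ fun a b => α_ _ _ _
  leftUnitor F := isoMk _ fun a b => λ_ _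
  rightUnitor F := isoMk _ fun a b => ρ_ _
  whiskerLeft_id F := by
    rintro ⟨g, G⟩
    exact congrArg (Hom₂.mk _) (funext fun a => funext fun b => whiskerLeft_id _ _)
  whiskerLeft_comp F := by
    rintro _ _ _ ⟨g, β⟩ ⟨_, γ⟩
    exact congrArg (Hom₂.mk _) (funext fun a => funext fun b => whiskerLeft_comp _ _ _)
  id_whiskerLeft := by
    rintro _ _ _ _ ⟨g, β⟩
    exact congrArg (Hom₂.mk g) (funext fun a => funext fun b => id_whiskerLeft (β a b))
  comp_whiskerLeft F G := by
    rintro _ _ ⟨g, β⟩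
    exact congrArg (Hom₂.mk _) (funext fun a => funext fun b => comp_whiskerLeft _ _ _)
  id_whiskerRight := by
    rintro _ _ _ ⟨f, F⟩ G
    exact congrArg (Hom₂.mk _) (funext fun a => funext fun b => id_whiskerRight _ _)
  comp_whiskerRight := by
    rintro _ _ _ _ _ _ ⟨f, α⟩ ⟨_, β⟩ G
    exact congrArg (Hom₂.mk _) (funext fun a => funext fun b => comp_whiskerRight _ _ _)
  whiskerRight_id := by
    rintro _ _ _ _ ⟨f, α⟩
    exact congrArg (Hom₂.mk f) (funext fun a => funext fun b => Bicategory.whiskerRight_id (α a b))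
  whiskerRight_comp := by
    rintro _ _ _ _ _ _ ⟨f, α⟩ G H
    exact congrArg (Hom₂.mk _) (funext fun a => funext fun b => whiskerRight_comp _ _ _)
  whisker_assoc := by
    rintro _ _ _ _ F _ _ ⟨g, β⟩ H
    exact congrArg (Hom₂.mk _) (funext fun a => funext fun b => whisker_assoc _ _ _)
  whisker_exchange := by
    rintro _ _ _ _ _ _ _ ⟨f, α⟩ ⟨g, β⟩
    exact congrArg (Hom₂.mk _) (funext fun a => funext fun b => whisker_exchange _ _)
  pentagon _ _ _ _ :=
    congrArg (Hom₂.mk _) (funext fun a => funext fun b => pentagon _ _ _ _)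
  triangle _ _ :=
    congrArg (Hom₂.mk _) (funext fun a => funext fun b => triangle _ _)

theorem isoMk_eq {X Y : KGraph.{w} K} (f : X.Obj → Y.Obj)
    {F G : ∀ a b, X.hom a b ⟶ Y.hom (f a) (f b)} (h : ∀ a b, F a b = G a b) :
    letI := homCategory X Y
    isoMk f (fun a b => eqToIso (h a b)) =
      eqToIso (congrArg (Hom.mk f) (funext fun a => funext fun b => h a b)) := by
  obtain rfl : F = G := funext fun a => funext fun b => h a b
  rfl

instance [Strict K] : Strict (KGraph.{w} K) where
  id_comp F := congrArg (Hom.mk F.obj) (funext fun a => funext fun b => Strict.id_comp _)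
  comp_id F := congrArg (Hom.mk F.obj) (funext fun a => funext fun b => Strict.comp_id _)
  assoc _ _ _ := congrArg (Hom.mk _) (funext fun a => funext fun b => Strict.assoc _ _ _)
  leftUnitor_eqToIso F := (congrArg (isoMk F.obj) (funext fun a => funext fun b =>
    Strict.leftUnitor_eqToIso (F.map a b))).trans (isoMk_eq _ _)
  rightUnitor_eqToIso F := (congrArg (isoMk F.obj) (funext fun a => funext fun b =>
    Strict.rightUnitor_eqToIso (F.map a b))).trans (isoMk_eq _ _)
  associator_eqToIso F G H := (congrArg (isoMk _) (funext fun a => funext fun b =>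
    Strict.associator_eqToIso _ _ _)).trans (isoMk_eq _ _)

end KGraph

/-! ### Operads and categories with operadically parametrised composition -/

/-- A (non-symmetric) operad in a category with finite products. The axioms are stated on
generalised elements; `mul n N h` is composition `P(k) × ∏ i, P(n i) ⟶ P(N)` for `N = ∑ i, n i`. -/
structure Operad (V : Type u) [Category.{v} V] [HasFiniteProducts V] where
  obj : ℕ → V
  unit : ⊤_ V ⟶ obj 1
  mul : ∀ {k : ℕ} (n : Fin k → ℕ) (N : ℕ), ∑ i, n i = N →
    ((obj k ⨯ ∏ᶜ fun i => obj (n i)) ⟶ obj N)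
  unit_mul : ∀ (n : ℕ) (h : ∑ _i : Fin 1, n = n) (Z : V) (p : Z ⟶ obj n),
    prod.lift (terminal.from Z ≫ unit) (Pi.lift fun _ : Fin 1 => p) ≫ mul (fun _ => n) n h = p
  mul_unit : ∀ (k : ℕ) (h : ∑ _i : Fin k, 1 = k) (Z : V) (p : Z ⟶ obj k),
    prod.lift p (Pi.lift fun _ : Fin k => terminal.from Z ≫ unit) ≫ mul (fun _ => 1) k h = p
  assoc : ∀ {k : ℕ} (n : Fin k → ℕ) (m : Fin (∑ i, n i) → ℕ) (N : ℕ)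
    (h : ∑ l, m l = N) (h' : ∑ i, ∑ j, m (finSigmaFinEquiv ⟨i, j⟩) = N)
    (Z : V) (p : Z ⟶ obj k) (q : ∀ i, Z ⟶ obj (n i)) (r : ∀ l, Z ⟶ obj (m l)),
    prod.lift (prod.lift p (Pi.lift q) ≫ mul n _ rfl) (Pi.lift r) ≫ mul m N h =
      prod.lift p (Pi.lift fun i =>
        prod.lift (q i) (Pi.lift fun j => r (finSigmaFinEquiv ⟨i, j⟩)) ≫
          mul (fun j => m (finSigmaFinEquiv ⟨i, j⟩)) _ rfl) ≫
        mul (fun i => ∑ j, m (finSigmaFinEquiv ⟨i, j⟩)) N h'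

/-- The pairs `(s i, t i)`, for `i < k`, are the consecutive edges of a path of length `k` from `a`
to `b` with vertices `a = x k, …, x 1, x 0 = b`. As in a composite of maps, the last edge of the
path is listed first. -/
def IsPath {O : Type w} (a b : O) {k : ℕ} (s t : Fin k → O) : Prop :=
  ∃ x : Fin (k + 1) → O, x 0 = b ∧ x (Fin.last k) = a ∧
    ∀ i : Fin k, s i = x i.succ ∧ t i = x i.castSucc

theorem IsPath.map {O : Type w} {O' : Type w'} (f : O → O') {a b : O} {k : ℕ} {s t : Fin k → O}
    (h : IsPath a b s t) : IsPath (f a) (f b) (fun i => f (s i)) (fun i => f (t i)) := by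
  obtain ⟨x, hb, ha, hx⟩ := h
  exact ⟨fun i => f (x i), congrArg f hb, congrArg f ha,
    fun i => ⟨congrArg f (hx i).1, congrArg f (hx i).2⟩⟩

/-- The type of paths of any length from `a` to `b`. -/
structure PathIn {O : Type w} (a b : O) where
  len : ℕ
  src : Fin len → O
  tgt : Fin len → O
  isPath : IsPath a b src tgt

/-- A `(K, P)`-category: a `K`-graph with, for every path of length `k`, a composition map
parametrised by `P(k)`, compatible with the unit and the composition of the operad (stated on
generalised elements). -/
structure KPCat {V : Type u} [Category.{v} V] [HasFiniteProducts V] (P : Operad V) where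
  graph : KGraph.{w} V
  act : ∀ {k : ℕ} {s t : Fin k → graph.Obj} {a b : graph.Obj}, IsPath a b s t →
    ((P.obj k ⨯ ∏ᶜ fun i => graph.hom (s i) (t i)) ⟶ graph.hom a b)
  act_unit : ∀ (a b : graph.Obj) (h : IsPath a b (fun _ : Fin 1 => a) (fun _ : Fin 1 => b))
    (Z : V) (f : Z ⟶ graph.hom a b),
    prod.lift (terminal.from Z ≫ P.unit) (Pi.lift fun _ : Fin 1 => f) ≫ act h = f
  act_mul : ∀ {k : ℕ} (n : Fin k → ℕ) (S T : Fin k → graph.Obj)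
    (s t : Fin (∑ i, n i) → graph.Obj) (a b : graph.Obj)
    (H : IsPath a b S T)
    (h : ∀ i, IsPath (S i) (T i) (fun j => s (finSigmaFinEquiv ⟨i, j⟩))
      (fun j => t (finSigmaFinEquiv ⟨i, j⟩)))
    (h' : IsPath a b s t)
    (Z : V) (p : Z ⟶ P.obj k) (q : ∀ i, Z ⟶ P.obj (n i))
    (f : ∀ l, Z ⟶ graph.hom (s l) (t l)),
    prod.lift (prod.lift p (Pi.lift q) ≫ P.mul n _ rfl) (Pi.lift f) ≫ act h' =
      prod.lift p (Pi.lift fun i =>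
        prod.lift (q i) (Pi.lift fun j => f (finSigmaFinEquiv ⟨i, j⟩)) ≫ act (h i)) ≫ act H

/-! ### The 2-cells `1 × α^k` -/

section ParamProduct

variable {K : Type u} [Bicategory.{w₂, v} K] [Strict K] [HasFiniteTwoProducts K]

/-- The 1-cell `1 × F₁ × ⋯ × F_k`. -/
noncomputable abbrev paramMap (A : K) {k : ℕ} {X Y : Fin k → K} (F : ∀ i, X i ⟶ Y i) :
    (A ⨯ ∏ᶜ X) ⟶ (A ⨯ ∏ᶜ Y) :=
  prod.map (𝟙 A) (Limits.Pi.map F)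

/-- `β` is the 2-cell `1 × α₁ × ⋯ × α_k`: its projection to the parameter is an identity and its
other projections are the `α i`. -/
structure IsParamMap₂ (A : K) {k : ℕ} {X Y : Fin k → K} {F G : ∀ i, X i ⟶ Y i}
    (α : ∀ i, F i ⟶ G i) (β : paramMap A F ⟶ paramMap A G) : Prop where
  fst : HEq (β ▷ (prod.fst : (A ⨯ ∏ᶜ Y) ⟶ A)) (𝟙 (prod.fst : (A ⨯ ∏ᶜ X) ⟶ A))
  snd : ∀ i, HEq (β ▷ ((prod.snd : (A ⨯ ∏ᶜ Y) ⟶ _) ≫ Pi.π Y i))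
    (((prod.snd : (A ⨯ ∏ᶜ X) ⟶ _) ≫ Pi.π X i) ◁ α i)

/-- An ordinary product is a 2-product as soon as a 2-product of the same family exists. -/
theorem IsTwoProduct.of_isProduct {ι : Type*} {X : ι → K} {p : K} {π : ∀ i, p ⟶ X i}
    (hp : IsTwoProduct X p π) {q : K} {ρ : ∀ i, q ⟶ X i}
    (hq : ∀ (Z : K) (f : ∀ i, Z ⟶ X i), ∃! g : Z ⟶ q, ∀ i, g ≫ ρ i = f i) :
    IsTwoProduct X q ρ := by
  refine ⟨hq, fun Z g h α => ?_⟩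
  obtain ⟨e, he, -⟩ := hp.existsUnique_lift q ρ
  obtain ⟨e', he', -⟩ := hq p π
  have hee : e ≫ e' = 𝟙 q := (hq q ρ).unique
    (fun i => by rw [Strict.assoc, he', he]) (fun i => Strict.id_comp _)
  have hg (g : Z ⟶ q) : (g ≫ e) ≫ e' = g := by rw [Strict.assoc, hee, Strict.comp_id]
  have hge (g : Z ⟶ q) (i : ι) : (g ≫ e) ≫ π i = g ≫ ρ i := by rw [Strict.assoc, he]
  obtain ⟨γ, hγ, -⟩ := hp.existsUnique_lift₂ Z (g ≫ e) (h ≫ e)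
    (fun i => eqToHom (hge g i) ≫ α i ≫ eqToHom (hge h i).symm)
  refine ⟨eqToHom (hg g).symm ≫ γ ▷ e' ≫ eqToHom (hg h), fun i => eq_of_heq ?_, fun β hβ => ?_⟩
  · refine (TwoCat.whiskerRight_heq rfl (hg g).symm (hg h).symm
      (TwoCat.eqToHom_conj_heq (hg g).symm (γ ▷ e') (hg h))).trans ?_
    refine (TwoCat.whiskerRight_comp_heq γ e' (ρ i)).symm.trans ?_
    refine (TwoCat.whiskerRight_heq (he' i) rfl rfl HEq.rfl).trans ?_
    rw [hγ i]
    exact TwoCat.eqToHom_conj_heq _ _ _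
  · have hβγ : β ▷ e = γ := by
      refine (hp.existsUnique_lift₂ Z (g ≫ e) (h ≫ e) _).unique (fun i => eq_of_heq ?_) hγ
      refine (TwoCat.whiskerRight_comp_heq β e (π i)).symm.trans ?_
      refine (TwoCat.whiskerRight_heq (he i) rfl rfl HEq.rfl).trans ?_
      rw [hβ i]
      exact (TwoCat.eqToHom_conj_heq _ _ _).symm
    refine eq_of_heq (HEq.trans ?_ (TwoCat.eqToHom_conj_heq (hg g).symm (γ ▷ e') (hg h)).symm)
    rw [← hβγ]
    exact ((TwoCat.whiskerRight_id_heq β).symm.trans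
      (TwoCat.whiskerRight_heq hee.symm rfl rfl HEq.rfl)).trans
      (TwoCat.whiskerRight_comp_heq β e e')

/-- The projections of `A × X₁ × ⋯ × X_k`. -/
noncomputable def paramProj (A : K) {k : ℕ} (X : Fin k → K) (i : Fin (k + 1)) :
    (A ⨯ ∏ᶜ X) ⟶ (Fin.cons A X : Fin (k + 1) → K) i :=
  Fin.cases (motive := fun i => (A ⨯ ∏ᶜ X) ⟶ (Fin.cons A X : Fin (k + 1) → K) i)
    prod.fst (fun i => prod.snd ≫ Pi.π X i) i

theorem isTwoProduct_paramProj (A : K) {k : ℕ} (X : Fin k → K) :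
    IsTwoProduct (Fin.cons A X : Fin (k + 1) → K) (A ⨯ ∏ᶜ X) (paramProj A X) := by
  obtain ⟨p, π, hp⟩ := HasFiniteTwoProducts.exists_isTwoProduct (k + 1)
    (Fin.cons A X : Fin (k + 1) → K)
  refine hp.of_isProduct fun Z f => ?_
  have key (f₀ : Z ⟶ A) (f₁ : ∀ i, Z ⟶ X i) : ∃! g : Z ⟶ A ⨯ ∏ᶜ X,
      g ≫ prod.fst = f₀ ∧ ∀ i, g ≫ prod.snd ≫ Pi.π X i = f₁ i := by
    refine ⟨prod.lift f₀ (Pi.lift f₁), ⟨prod.lift_fst _ _, fun i => ?_⟩, fun g hg => ?_⟩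
    · exact (prod.lift_snd_assoc _ _ _).trans (Pi.lift_π _ _)
    apply prod.hom_ext
    · rw [prod.lift_fst]; exact hg.1
    · rw [prod.lift_snd]
      refine Pi.hom_ext _ _ fun i => ?_
      rw [Pi.lift_π, Category.assoc]
      exact hg.2 i
  obtain ⟨g, hg, hu⟩ := key (f 0) (fun i => f i.succ)
  exact ⟨g, fun i => Fin.cases hg.1 hg.2 i, fun g' hg' => hu g' ⟨hg' 0, fun i => hg' i.succ⟩⟩

theorem paramProduct_ext {A Z : K} {k : ℕ} {X : Fin k → K} {g h : Z ⟶ A ⨯ ∏ᶜ X} {β β' : g ⟶ h}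
    (h₁ : β ▷ (prod.fst : (A ⨯ ∏ᶜ X) ⟶ A) = β' ▷ (prod.fst : (A ⨯ ∏ᶜ X) ⟶ A))
    (h₂ : ∀ i, β ▷ ((prod.snd : (A ⨯ ∏ᶜ X) ⟶ _) ≫ Pi.π X i) =
      β' ▷ ((prod.snd : (A ⨯ ∏ᶜ X) ⟶ _) ≫ Pi.π X i)) : β = β' :=
  ((isTwoProduct_paramProj A X).existsUnique_lift₂ Z g h (fun i => β' ▷ paramProj A X i)).unique
    (Fin.cases h₁ h₂) (fun _ => rfl)

theorem paramMap_fst (A : K) {k : ℕ} {X Y : Fin k → K} (F : ∀ i, X i ⟶ Y i) :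
    paramMap A F ≫ (prod.fst : (A ⨯ ∏ᶜ Y) ⟶ A) = prod.fst := by
  simp

theorem paramMap_snd (A : K) {k : ℕ} {X Y : Fin k → K} (F : ∀ i, X i ⟶ Y i) (i : Fin k) :
    paramMap A F ≫ (prod.snd : (A ⨯ ∏ᶜ Y) ⟶ _) ≫ Pi.π Y i = (prod.snd ≫ Pi.π X i) ≫ F i := by
  simp

theorem existsUnique_isParamMap₂ (A : K) {k : ℕ} {X Y : Fin k → K} {F G : ∀ i, X i ⟶ Y i}
    (α : ∀ i, F i ⟶ G i) : ∃! β : paramMap A F ⟶ paramMap A G, IsParamMap₂ A α β := by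
  obtain ⟨β, hβ, -⟩ := (isTwoProduct_paramProj A Y).existsUnique_lift₂ _ (paramMap A F)
    (paramMap A G) (fun i => Fin.cases
      (motive := fun i => paramMap A F ≫ paramProj A Y i ⟶ paramMap A G ≫ paramProj A Y i)
      (eqToHom ((paramMap_fst A F).trans (paramMap_fst A G).symm))
      (fun i => eqToHom (paramMap_snd A F i) ≫ ((prod.snd : (A ⨯ ∏ᶜ X) ⟶ _) ≫ Pi.π X i) ◁ α i ≫
        eqToHom (paramMap_snd A G i).symm) i)
  have h₀ : β ▷ (prod.fst : (A ⨯ ∏ᶜ Y) ⟶ A) =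
    eqToHom ((paramMap_fst A F).trans (paramMap_fst A G).symm) := hβ 0
  have hs : ∀ i, β ▷ ((prod.snd : (A ⨯ ∏ᶜ Y) ⟶ _) ≫ Pi.π Y i) = eqToHom (paramMap_snd A F i) ≫
    ((prod.snd : (A ⨯ ∏ᶜ X) ⟶ _) ≫ Pi.π X i) ◁ α i ≫ eqToHom (paramMap_snd A G i).symm :=
    fun i => hβ i.succ
  have hp : IsParamMap₂ A α β := by
    refine ⟨?_, fun i => ?_⟩
    · rw [h₀]
      refine HEq.trans ?_ (TwoCat.id_heq (paramMap_fst A F))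
      exact TwoCat.eqToHom_heq_id _
    · rw [hs]
      exact TwoCat.eqToHom_conj_heq _ _ _
  refine ⟨β, hp, fun β' hβ' => paramProduct_ext ?_ fun i => ?_⟩
  · exact eq_of_heq (hβ'.fst.trans hp.fst.symm)
  · exact eq_of_heq ((hβ'.snd i).trans (hp.snd i).symm)

/-- The 2-cell `1 × α₁ × ⋯ × α_k`. -/
noncomputable def paramMap₂ (A : K) {k : ℕ} {X Y : Fin k → K} {F G : ∀ i, X i ⟶ Y i}
    (α : ∀ i, F i ⟶ G i) : paramMap A F ⟶ paramMap A G :=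
  (existsUnique_isParamMap₂ A α).choose

theorem isParamMap₂ (A : K) {k : ℕ} {X Y : Fin k → K} {F G : ∀ i, X i ⟶ Y i}
    (α : ∀ i, F i ⟶ G i) : IsParamMap₂ A α (paramMap₂ A α) :=
  (existsUnique_isParamMap₂ A α).choose_spec.1

theorem IsParamMap₂.eq {A : K} {k : ℕ} {X Y : Fin k → K} {F G : ∀ i, X i ⟶ Y i}
    {α : ∀ i, F i ⟶ G i} {β : paramMap A F ⟶ paramMap A G} (h : IsParamMap₂ A α β) :
    β = paramMap₂ A α :=
  (existsUnique_isParamMap₂ A α).choose_spec.2 β h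

theorem paramMap_comp (A : K) {k : ℕ} {X Y Z : Fin k → K} (F : ∀ i, X i ⟶ Y i)
    (G : ∀ i, Y i ⟶ Z i) : paramMap A F ≫ paramMap A G = paramMap A (fun i => F i ≫ G i) := by
  apply prod.hom_ext
  · simp
  · refine Pi.hom_ext _ _ fun i => ?_
    simp

theorem paramMap_id (A : K) {k : ℕ} (X : Fin k → K) :
    paramMap A (fun i => 𝟙 (X i)) = 𝟙 (A ⨯ ∏ᶜ X) := by
  apply prod.hom_ext
  · simp
  · refine Pi.hom_ext _ _ fun i => ?_
    simp

theorem paramMap₂_id (A : K) {k : ℕ} {X Y : Fin k → K} (F : ∀ i, X i ⟶ Y i) :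
    paramMap₂ A (fun i => 𝟙 (F i)) = 𝟙 (paramMap A F) := by
  refine (IsParamMap₂.eq ⟨?_, fun i => ?_⟩).symm
  · rw [id_whiskerRight]
    exact TwoCat.id_heq (paramMap_fst A F)
  · rw [id_whiskerRight, whiskerLeft_id]
    exact TwoCat.id_heq (paramMap_snd A F i)

theorem paramMap₂_comp (A : K) {k : ℕ} {X Y : Fin k → K} {F G H : ∀ i, X i ⟶ Y i}
    (α : ∀ i, F i ⟶ G i) (β : ∀ i, G i ⟶ H i) :
    paramMap₂ A (fun i => α i ≫ β i) = paramMap₂ A α ≫ paramMap₂ A β := by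
  refine (IsParamMap₂.eq ⟨?_, fun i => ?_⟩).symm
  · rw [comp_whiskerRight]
    refine (TwoCat.comp_heq (paramMap_fst A F) (paramMap_fst A G) (paramMap_fst A H)
      (isParamMap₂ A α).fst (isParamMap₂ A β).fst).trans ?_
    rw [Category.comp_id]
  · rw [comp_whiskerRight, whiskerLeft_comp]
    exact TwoCat.comp_heq (paramMap_snd A F i) (paramMap_snd A G i) (paramMap_snd A H i)
      ((isParamMap₂ A α).snd i) ((isParamMap₂ A β).snd i)

/-- Recognition of `1 × α^k` up to equality of the source and target. -/
theorem paramMap₂_heq (A : K) {k : ℕ} {X Y : Fin k → K} {F G : ∀ i, X i ⟶ Y i}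
    (α : ∀ i, F i ⟶ G i) {f g : (A ⨯ ∏ᶜ X) ⟶ (A ⨯ ∏ᶜ Y)} (hf : f = paramMap A F)
    (hg : g = paramMap A G) {β : f ⟶ g}
    (h₁ : HEq (β ▷ (prod.fst : (A ⨯ ∏ᶜ Y) ⟶ A)) (𝟙 (prod.fst : (A ⨯ ∏ᶜ X) ⟶ A)))
    (h₂ : ∀ i, HEq (β ▷ ((prod.snd : (A ⨯ ∏ᶜ Y) ⟶ _) ≫ Pi.π Y i))
      (((prod.snd : (A ⨯ ∏ᶜ X) ⟶ _) ≫ Pi.π X i) ◁ α i)) :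
    HEq (paramMap₂ A α) β := by
  subst hf hg
  exact heq_of_eq (IsParamMap₂.eq ⟨h₁, h₂⟩).symm

theorem paramMap₂_whiskerLeft (A : K) {k : ℕ} {X Y Z : Fin k → K} (F : ∀ i, X i ⟶ Y i)
    {G H : ∀ i, Y i ⟶ Z i} (β : ∀ i, G i ⟶ H i) :
    HEq (paramMap₂ A (fun i => F i ◁ β i)) (paramMap A F ◁ paramMap₂ A β) := by
  refine paramMap₂_heq A _ (paramMap_comp A F G) (paramMap_comp A F H) ?_ fun i => ?_
  · refine (TwoCat.whisker_assoc_heq _ _ _).trans ?_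
    refine (TwoCat.whiskerLeft_heq rfl (paramMap_fst A G) (paramMap_fst A H)
      (isParamMap₂ A β).fst).trans ?_
    rw [whiskerLeft_id]
    exact TwoCat.id_heq (paramMap_fst A F)
  · refine (TwoCat.whisker_assoc_heq _ _ _).trans ?_
    refine (TwoCat.whiskerLeft_heq rfl (paramMap_snd A G i) (paramMap_snd A H i)
      ((isParamMap₂ A β).snd i)).trans ?_
    refine (TwoCat.comp_whiskerLeft_heq _ _ _).symm.trans ?_
    refine (TwoCat.whiskerLeft_heq (paramMap_snd A F i) rfl rfl HEq.rfl).trans ?_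
    exact TwoCat.comp_whiskerLeft_heq _ _ _

theorem paramMap₂_whiskerRight (A : K) {k : ℕ} {X Y Z : Fin k → K} {F G : ∀ i, X i ⟶ Y i}
    (α : ∀ i, F i ⟶ G i) (H : ∀ i, Y i ⟶ Z i) :
    HEq (paramMap₂ A (fun i => α i ▷ H i)) (paramMap₂ A α ▷ paramMap A H) := by
  refine paramMap₂_heq A _ (paramMap_comp A F H) (paramMap_comp A G H) ?_ fun i => ?_
  · refine (TwoCat.whiskerRight_comp_heq _ _ _).symm.trans ?_
    refine (TwoCat.whiskerRight_heq (paramMap_fst A H) rfl rfl HEq.rfl).trans ?_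
    exact (isParamMap₂ A α).fst
  · refine (TwoCat.whiskerRight_comp_heq _ _ _).symm.trans ?_
    refine (TwoCat.whiskerRight_heq (paramMap_snd A H i) rfl rfl HEq.rfl).trans ?_
    refine (TwoCat.whiskerRight_comp_heq _ _ _).trans ?_
    refine (TwoCat.whiskerRight_heq rfl (paramMap_snd A F i) (paramMap_snd A G i)
      ((isParamMap₂ A α).snd i)).trans ?_
    exact TwoCat.whisker_assoc_heq _ _ _

end ParamProduct

/-! ### The 2-category of `(K, P)`-categories, strict functors and icons -/

namespace KPCat

variable {K : Type u} [Bicategory.{w₂, v} K] [Strict K] [HasFiniteTwoProducts K] {P : Operad K}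

/-- A graph morphism is a strict `(K, P)`-functor if it commutes with composition. -/
def IsFunctor (X Y : KPCat.{w} P) (F : X.graph ⟶ Y.graph) : Prop :=
  ∀ ⦃k : ℕ⦄ ⦃s t : Fin k → X.graph.Obj⦄ ⦃a b : X.graph.Obj⦄ (h : IsPath a b s t),
    X.act h ≫ F.map a b =
      paramMap (P.obj k) (fun i => F.map (s i) (t i)) ≫ Y.act (h.map F.obj)

/-- A 2-cell of graphs `α : F ⟶ G` (so `F` and `G` agree on objects) is a `(K, P)`-icon if
`m ◁ α = (1 × α^k) ▷ m'` for all composition maps `m` of `X` and `m'` of `Y`; for functors `F` and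
`G` the types of the two sides agree. -/
def IsIcon (X Y : KPCat.{w} P) : ∀ {F G : X.graph ⟶ Y.graph}, (F ⟶ G) → Prop
  | _, _, KGraph.Hom₂.mk f α =>
    ∀ ⦃k : ℕ⦄ ⦃s t : Fin k → X.graph.Obj⦄ ⦃a b : X.graph.Obj⦄ (h : IsPath a b s t),
      HEq (X.act h ◁ α a b)
        (paramMap₂ (P.obj k) (fun i => α (s i) (t i)) ▷ Y.act (h.map f))

variable (P) in
/-- `(K, P)`-categories, with strict functors and icons among the cells of the 2-category of
`K`-graphs. -/
def iconStructure : StructureOver (KGraph.{w} K) (KPCat.{w} P) where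
  obj X := X.graph
  IsHom {X Y} F := IsFunctor X Y F
  IsHom₂ X Y _ _ α := IsIcon X Y α
  isHom_id X := by
    intro k s t a b h
    refine (Strict.comp_id _).trans ?_
    exact (Strict.id_comp _).symm.trans
      (congrArg (· ≫ X.act h) (paramMap_id (P.obj k) fun i => X.graph.hom (s i) (t i)).symm)
  isHom_comp {X Y Z F G} hF hG := by
    intro k s t a b h
    refine (Strict.assoc _ _ _).symm.trans ?_
    rw [hF h, Strict.assoc, hG (h.map F.obj), ← Strict.assoc, paramMap_comp]
    rfl
  isHom₂_id {X Y F} hF := by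
    obtain ⟨f, F⟩ := F
    intro k s t a b h
    rw [whiskerLeft_id, paramMap₂_id, id_whiskerRight]
    exact TwoCat.id_heq (hF h)
  isHom₂_comp {X Y F G H α β} hF hG hH hα hβ := by
    obtain ⟨f, α⟩ := α
    obtain ⟨_, β⟩ := β
    intro k s t a b h
    rw [whiskerLeft_comp, paramMap₂_comp, comp_whiskerRight]
    exact TwoCat.comp_heq (hF h) (hG h) (hH h) (hα h) (hβ h)
  isHom₂_whiskerLeft {X Y Z F G H β} hF hG hH hβ := by
    obtain ⟨g, β⟩ := β
    intro k s t a b h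
    refine (TwoCat.comp_whiskerLeft_heq _ _ _).symm.trans ?_
    refine (TwoCat.whiskerLeft_heq (hF h) rfl rfl HEq.rfl).trans ?_
    refine (TwoCat.comp_whiskerLeft_heq _ _ _).trans ?_
    refine (TwoCat.whiskerLeft_heq rfl (hG _) (hH _) (hβ _)).trans ?_
    refine (TwoCat.whisker_assoc_heq _ _ _).symm.trans ?_
    exact TwoCat.whiskerRight_heq rfl (paramMap_comp _ _ _) (paramMap_comp _ _ _)
      (paramMap₂_whiskerLeft _ _ _).symm
  isHom₂_whiskerRight {X Y Z F G H α} hF hG hH hα := by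
    obtain ⟨f, α⟩ := α
    intro k s t a b h
    refine (TwoCat.whisker_assoc_heq _ _ _).symm.trans ?_
    refine (TwoCat.whiskerRight_heq rfl (hF h) (hG h) (hα h)).trans ?_
    refine (TwoCat.whiskerRight_comp_heq _ _ _).symm.trans ?_
    refine (TwoCat.whiskerRight_heq (hH _) rfl rfl HEq.rfl).trans ?_
    refine (TwoCat.whiskerRight_comp_heq _ _ _).trans ?_
    exact TwoCat.whiskerRight_heq rfl (paramMap_comp _ _ _) (paramMap_comp _ _ _)
      (paramMap₂_whiskerRight _ _ _).symm

/-- The 2-category of `(K, P)`-categories, strict `(K, P)`-functors and `(K, P)`-icons. -/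
noncomputable instance : Bicategory (KPCat.{w} P) := (iconStructure P).bicategory

instance : Strict (KPCat.{w} P) := (iconStructure P).strict

variable (P) in
/-- The forgetful 2-functor to `K`-graphs. -/
noncomputable def forget : StrictPseudofunctor (KPCat.{w} P) (KGraph.{w} K) :=
  (iconStructure P).forget

/-- `M` is the free `(K, P)`-category monad on the 1-category of `K`-graphs: it is induced by an
adjunction `F ⊣ U`, where `U` is the forgetful functor from `(K, P)`-categories, the unit `η` of
which identifies the objects of `X` with those of `F X` and for which
`F X (a, b) = ∐ P(k) × X(x_{k-1}, x_k) × ⋯ × X(x_0, x_1)`, the coproduct taken over all paths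
`a = x_0, …, x_k = b` in `X`, with injections given by mapping the edges of the path along `η` and
composing in `F X`. -/
def IsFreeMonad (P : Operad K) (M : Monad (KGraph.{w} K)) : Prop :=
  ∃ (F : KGraph.{w} K ⥤ KPCat.{w} P) (adj : F ⊣ (forget P).toFunctor),
    adj.toMonad = M ∧
    ∀ (X : KGraph.{w} K) (η : X ⟶ (F.obj X).graph), η = adj.unit.app X →
      Function.Bijective η.obj ∧
      ∀ a b : X.Obj, IsTwoCoproduct
        (fun p : PathIn a b => P.obj p.len ⨯ ∏ᶜ fun i => X.hom (p.src i) (p.tgt i))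
        ((F.obj X).graph.hom (η.obj a) (η.obj b))
        (fun p => paramMap (P.obj p.len) (fun i => η.map (p.src i) (p.tgt i)) ≫
          (F.obj X).act (p.isPath.map η.obj))

end KPCat

/-!
Equations between 1-cells, and between 2-cells, out of `P(k) × X(x_{k-1}, x_k) × ⋯ × X(x₀, x₁)`
amount to equations between composites of generalised elements `Z ⟶ X(a, b)` of the hom-objects and
of 2-cells between these.

*2-monadicity.* A finite product of coproducts over paths is, by distributivity, a coproduct over
families of paths. Hence the composition of the free `(K, P)`-category can be defined on summands,
where it concatenates paths and multiplies in `P`, and the unit axioms and associativity can be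
checked there. The universal property of the coproducts holds for 2-cells as well, so the inclusion
of a graph in the free `(K, P)`-category on it is a 2-universal arrow, and these arrows assemble to
a left 2-adjoint. For an algebra `a` of the induced 2-monad, composites in the underlying graph are
obtained by applying `a` to composites in the free `(K, P)`-category. The comparison is fully
faithful on 1-cells and 2-cells because the counit is a functor that is split on graphs by the unit.

*Distributivity.* Products of `(K, P)`-categories are formed homwise. A coproduct is the disjoint
sum of the graphs, with initial hom-objects between different summands. In a distributive 2-category
initial objects are strict, so an element at a stage that is not initial lies in a single summand,
and so does a path of such elements; this defines the composition. The product of a graph with a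
disjoint sum is again a disjoint sum, since `A × 0` is initial.
-/

/-! ### 2-cells and universal properties -/

namespace TwoCat

section Arrow

variable {C : Type u} [Category.{v} C]

theorem arrowMk_eq_of_heq {X Y X' Y' : C} {f : X ⟶ Y} {f' : X' ⟶ Y'} (hX : X = X') (hY : Y = Y')
    (h : HEq f f') : Arrow.mk f = Arrow.mk f' := by
  subst hX hY; cases h; rfl

theorem heq_of_arrowMk_eq {X Y X' Y' : C} {f : X ⟶ Y} {f' : X' ⟶ Y'}
    (h : Arrow.mk f = Arrow.mk f') : HEq f f' := by
  cases h; rfl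

theorem exists_arrowMk_eq {X Y : C} (α : Arrow C) (hX : α.left = X) (hY : α.right = Y) :
    ∃ f : X ⟶ Y, Arrow.mk f = α := by
  subst hX hY; exact ⟨α.hom, α.mk_eq⟩

theorem existsUnique_arrow_iff {ι : Type*} {D : ι → Type u'} [∀ i, Category.{v'} (D i)]
    (Φ : ∀ i, C ⥤ D i) :
    ((∀ Y : ∀ i, D i, ∃! X : C, ∀ i, (Φ i).obj X = Y i) ∧
      ∀ (X X' : C) (φ : ∀ i, (Φ i).obj X ⟶ (Φ i).obj X'),
        ∃! ψ : X ⟶ X', ∀ i, (Φ i).map ψ = φ i) ↔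
    ∀ α : ∀ i, Arrow (D i), ∃! β : Arrow C, ∀ i, (Φ i).mapArrow.obj β = α i := by
  constructor
  · rintro ⟨hobj, hmap⟩ α
    obtain ⟨X, hX, hX'⟩ := hobj fun i => (α i).left
    obtain ⟨Y, hY, hY'⟩ := hobj fun i => (α i).right
    choose φ hφ using fun i => exists_arrowMk_eq (α i) (hX i).symm (hY i).symm
    obtain ⟨ψ, hψ, hψ'⟩ := hmap X Y φ
    refine ⟨Arrow.mk ψ, fun i => (congrArg Arrow.mk (hψ i)).trans (hφ i), fun β hβ => ?_⟩
    obtain ⟨θ, rfl⟩ := exists_arrowMk_eq β (hX' _ fun i => congrArg Comma.left (hβ i))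
      (hY' _ fun i => congrArg Comma.right (hβ i))
    rw [hψ' θ fun i => Arrow.mk_injective _ _ ((hβ i).trans (hφ i).symm)]
  · intro h
    have obj_injective {X X' : C} (e : ∀ i, (Φ i).obj X = (Φ i).obj X') : X = X' :=
      congrArg Comma.left ((h fun i => Arrow.mk (𝟙 ((Φ i).obj X'))).unique
        (y₁ := Arrow.mk (𝟙 X)) (y₂ := Arrow.mk (𝟙 X'))
        (fun i => by simpa using congrArg (fun Y => Arrow.mk (𝟙 Y)) (e i))
        (fun i => by simp))
    refine ⟨fun Y => ?_, fun X X' φ => ?_⟩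
    · obtain ⟨β, hβ, -⟩ := h fun i => Arrow.mk (𝟙 (Y i))
      have hβ' (i) : (Φ i).obj β.left = Y i := congrArg Comma.left (hβ i)
      exact ⟨β.left, hβ', fun X hX => obj_injective fun i => (hX i).trans (hβ' i).symm⟩
    · obtain ⟨β, hβ, hβ'⟩ := h fun i => Arrow.mk (φ i)
      obtain ⟨ψ, rfl⟩ := exists_arrowMk_eq β (X := X) (Y := X')
        (obj_injective fun i => congrArg Comma.left (hβ i))
        (obj_injective fun i => congrArg Comma.right (hβ i))
      exact ⟨ψ, fun i => Arrow.mk_injective _ _ (hβ i), fun θ hθ => Arrow.mk_injective _ _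
        (hβ' (Arrow.mk θ) fun i => congrArg Arrow.mk (hθ i))⟩

end Arrow

/-- A 2-cell together with its source and target 1-cells. Equality of such packages replaces the
heterogeneous equality of 2-cells. -/
abbrev Cell {B : Type u} [Bicategory.{w₂, v} B] (a b : B) := Arrow (a ⟶ b)

namespace Cell

section

variable {B : Type u} [Bicategory.{w₂, v} B] {a b c : B}

/-- The identity 2-cell on a 1-cell. -/
def ofHom (f : a ⟶ b) : Cell a b := Arrow.mk (𝟙 f)

theorem ofHom_injective : Function.Injective (ofHom : (a ⟶ b) → Cell a b) :=
  fun _ _ h => congrArg Comma.left h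

/-- Whiskering with a 1-cell on the left. -/
def pre (f : a ⟶ b) (α : Cell b c) : Cell a c := Arrow.mk (f ◁ α.hom)

/-- Whiskering with a 1-cell on the right. -/
def post (α : Cell a b) (g : b ⟶ c) : Cell a c := Arrow.mk (α.hom ▷ g)

@[simp] theorem pre_ofHom (f : a ⟶ b) (g : b ⟶ c) : pre f (ofHom g) = ofHom (f ≫ g) :=
  congrArg Arrow.mk (whiskerLeft_id f g)

@[simp] theorem post_ofHom (f : a ⟶ b) (g : b ⟶ c) : post (ofHom f) g = ofHom (f ≫ g) :=
  congrArg Arrow.mk (id_whiskerRight f g)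

end

variable {B : Type u} [Bicategory.{w₂, v} B] [Strict B] {a b c d : B}

@[simp] theorem pre_id (α : Cell a b) : pre (𝟙 a) α = α :=
  (arrowMk_eq_of_heq (Strict.id_comp _) (Strict.id_comp _) (id_whiskerLeft_heq _)).trans α.mk_eq

@[simp] theorem post_id (α : Cell a b) : post α (𝟙 b) = α :=
  (arrowMk_eq_of_heq (Strict.comp_id _) (Strict.comp_id _) (whiskerRight_id_heq _)).trans α.mk_eq

theorem pre_pre (f : a ⟶ b) (g : b ⟶ c) (α : Cell c d) : pre f (pre g α) = pre (f ≫ g) α :=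
  (arrowMk_eq_of_heq (Strict.assoc _ _ _) (Strict.assoc _ _ _) (comp_whiskerLeft_heq _ _ _)).symm

theorem post_post (α : Cell a b) (f : b ⟶ c) (g : c ⟶ d) : post (post α f) g = post α (f ≫ g) :=
  (arrowMk_eq_of_heq (Strict.assoc _ _ _).symm (Strict.assoc _ _ _).symm
    (whiskerRight_comp_heq _ _ _)).symm

theorem post_pre (f : a ⟶ b) (α : Cell b c) (g : c ⟶ d) : post (pre f α) g = pre f (post α g) :=
  arrowMk_eq_of_heq (Strict.assoc _ _ _) (Strict.assoc _ _ _) (whisker_assoc_heq _ _ _)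

end Cell

end TwoCat

open TwoCat

section UniversalProperties

variable {B : Type u} [Bicategory.{w₂, v} B]

theorem isTwoProduct_iff {ι : Type*} {X : ι → B} {p : B} {π : ∀ i, p ⟶ X i} :
    IsTwoProduct X p π ↔ ∀ (Z : B) (α : ∀ i, Cell Z (X i)), ∃! β : Cell Z p,
      ∀ i, β.post (π i) = α i := by
  have key (Z : B) := existsUnique_arrow_iff fun i => postcomp Z (π i)
  exact ⟨fun h Z => (key Z).1 ⟨h.existsUnique_lift Z, h.existsUnique_lift₂ Z⟩,
    fun h => ⟨fun Z => ((key Z).2 (h Z)).1, fun Z => ((key Z).2 (h Z)).2⟩⟩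

theorem isTwoCoproduct_iff {ι : Type*} {X : ι → B} {c : B} {j : ∀ i, X i ⟶ c} :
    IsTwoCoproduct X c j ↔ ∀ (Z : B) (α : ∀ i, Cell (X i) Z), ∃! β : Cell c Z,
      ∀ i, β.pre (j i) = α i := by
  have key (Z : B) := existsUnique_arrow_iff fun i => precomp Z (j i)
  exact ⟨fun h Z => (key Z).1 ⟨h.existsUnique_desc Z, h.existsUnique_desc₂ Z⟩,
    fun h => ⟨fun Z => ((key Z).2 (h Z)).1, fun Z => ((key Z).2 (h Z)).2⟩⟩

namespace IsTwoProduct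

variable {ι : Type*} {X : ι → B} {p : B} {π : ∀ i, p ⟶ X i}

theorem cell_ext (h : IsTwoProduct X p π) {Z : B} {α β : Cell Z p}
    (e : ∀ i, α.post (π i) = β.post (π i)) : α = β :=
  (isTwoProduct_iff.1 h Z fun i => β.post (π i)).unique e fun _ => rfl

theorem exists_cellLift (h : IsTwoProduct X p π) {Z : B} (α : ∀ i, Cell Z (X i)) :
    ∃ β : Cell Z p, ∀ i, β.post (π i) = α i :=
  (isTwoProduct_iff.1 h Z α).exists

end IsTwoProduct

namespace IsTwoCoproduct

variable {ι : Type*} {X : ι → B} {c : B} {j : ∀ i, X i ⟶ c}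

theorem hom_ext (h : IsTwoCoproduct X c j) {Z : B} {f g : c ⟶ Z}
    (e : ∀ i, j i ≫ f = j i ≫ g) : f = g :=
  (h.existsUnique_desc Z fun i => j i ≫ g).unique e fun _ => rfl

theorem cell_ext (h : IsTwoCoproduct X c j) {Z : B} {α β : Cell c Z}
    (e : ∀ i, α.pre (j i) = β.pre (j i)) : α = β :=
  (isTwoCoproduct_iff.1 h Z fun i => β.pre (j i)).unique e fun _ => rfl

theorem exists_desc (h : IsTwoCoproduct X c j) {Z : B} (f : ∀ i, X i ⟶ Z) :
    ∃ g : c ⟶ Z, ∀ i, j i ≫ g = f i :=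
  (h.existsUnique_desc Z f).exists

theorem exists_cellDesc (h : IsTwoCoproduct X c j) {Z : B} (α : ∀ i, Cell (X i) Z) :
    ∃ β : Cell c Z, ∀ i, β.pre (j i) = α i :=
  (isTwoCoproduct_iff.1 h Z α).exists

theorem reindex (h : IsTwoCoproduct X c j) {ι' : Type*} (σ : ι' ≃ ι) :
    IsTwoCoproduct (fun i => X (σ i)) c (fun i => j (σ i)) := by
  rw [isTwoCoproduct_iff] at h ⊢
  refine fun Z α => (existsUnique_congr fun β => ?_).1
    (h Z fun i => σ.apply_symm_apply i ▸ α (σ.symm i))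
  rw [← σ.forall_congr_right]
  refine forall_congr' fun i => Eq.congr_right ?_
  generalize_proofs e
  generalize σ.symm (σ i) = k at e
  obtain rfl := σ.injective e
  rfl

variable [Strict B]

theorem of_unique [Unique ι] (h : IsIso (j default)) : IsTwoCoproduct X c j := by
  refine isTwoCoproduct_iff.2 fun Z α => ⟨(α default).pre (inv (j default)), fun i => ?_,
    fun β hβ => ?_⟩
  · obtain rfl := Unique.eq_default i
    rw [Cell.pre_pre, IsIso.hom_inv_id, Cell.pre_id]
  · rw [← hβ default, Cell.pre_pre, IsIso.inv_hom_id, Cell.pre_id]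

theorem of_iso (h : IsTwoCoproduct X c j) {X' : ι → B} {c' : B} {j' : ∀ i, X' i ⟶ c'}
    (u : ∀ i, X' i ≅ X i) (e : c' ≅ c) (w : ∀ i, j' i ≫ e.hom = (u i).hom ≫ j i) :
    IsTwoCoproduct X' c' j' := by
  refine isTwoCoproduct_iff.2 fun Z α => ?_
  obtain ⟨γ, hγ⟩ := h.exists_cellDesc fun i => (α i).pre (u i).inv
  refine ⟨γ.pre e.hom, fun i => ?_, fun β hβ => ?_⟩
  · rw [Cell.pre_pre, w, ← Cell.pre_pre, hγ, Cell.pre_pre, Iso.hom_inv_id, Cell.pre_id]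
  · have hβγ : β.pre e.inv = γ := h.cell_ext fun i => by
      have w' : j i ≫ e.inv = (u i).inv ≫ j' i := by
        rw [Iso.comp_inv_eq, Category.assoc, w, Iso.inv_hom_id_assoc]
      rw [Cell.pre_pre, w', ← Cell.pre_pre, hβ, hγ]
    rw [← hβγ, Cell.pre_pre, Iso.hom_inv_id, Cell.pre_id]

theorem sigma (h : IsTwoCoproduct X c j) {κ : ι → Type*} {Y : ∀ i, κ i → B}
    {l : ∀ i k, Y i k ⟶ X i} (hl : ∀ i, IsTwoCoproduct (Y i) (X i) (l i)) :
    IsTwoCoproduct (fun x : Σ i, κ i => Y x.1 x.2) c (fun x => l x.1 x.2 ≫ j x.1) := by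
  refine isTwoCoproduct_iff.2 fun Z α => ?_
  choose β hβ using fun i => (hl i).exists_cellDesc fun k => α ⟨i, k⟩
  obtain ⟨γ, hγ⟩ := h.exists_cellDesc β
  refine ⟨γ, fun ⟨i, k⟩ => ?_, fun γ' hγ' => h.cell_ext fun i => (hl i).cell_ext fun k => ?_⟩
  · rw [← Cell.pre_pre, hγ, hβ]
  · rw [hγ, hβ, Cell.pre_pre]
    exact hγ' ⟨i, k⟩

end IsTwoCoproduct

end UniversalProperties

section ParametrisedProduct

variable {V : Type u} [Category.{v} V] [HasFiniteProducts V] {A Z : V} {k : ℕ}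

theorem param_hom_ext {X : Fin k → V} {f g : Z ⟶ A ⨯ ∏ᶜ X} (h : f ≫ prod.fst = g ≫ prod.fst)
    (h' : ∀ i, f ≫ prod.snd ≫ Pi.π X i = g ≫ prod.snd ≫ Pi.π X i) : f = g :=
  prod.hom_ext h (Pi.hom_ext _ _ fun i => by simpa only [Category.assoc] using h' i)

theorem eq_paramLift {X : Fin k → V} (f : Z ⟶ A ⨯ ∏ᶜ X) :
    f = prod.lift (f ≫ prod.fst) (Pi.lift fun i => f ≫ prod.snd ≫ Pi.π X i) :=
  param_hom_ext (by rw [prod.lift_fst]) fun i => by rw [prod.lift_snd_assoc, Pi.lift_π]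

theorem paramLift_snd {X : Fin k → V} (p : Z ⟶ A) (f : ∀ i, Z ⟶ X i) (i : Fin k) :
    prod.lift p (Pi.lift f) ≫ prod.snd ≫ Pi.π X i = f i := by
  rw [prod.lift_snd_assoc, Pi.lift_π]

theorem comp_paramLift_comp {X : Fin k → V} {W D : V} (g : W ⟶ Z) (p : Z ⟶ A)
    (f : ∀ i, Z ⟶ X i) (m : (A ⨯ ∏ᶜ X) ⟶ D) :
    g ≫ prod.lift p (Pi.lift f) ≫ m = prod.lift (g ≫ p) (Pi.lift fun i => g ≫ f i) ≫ m := by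
  rw [← Category.assoc]
  congr 1
  exact param_hom_ext (by rw [Category.assoc, prod.lift_fst, prod.lift_fst]) fun i => by
    rw [Category.assoc, paramLift_snd, paramLift_snd]

attribute [local simp] prod.lift_fst prod.lift_snd prod.lift_fst_assoc prod.lift_snd_assoc
  prod.map_fst prod.map_snd prod.map_fst_assoc prod.map_snd_assoc Pi.lift_π Pi.lift_π_assoc
  Pi.map_π Pi.map_π_assoc

attribute [-simp] prod.comp_lift prod.lift_map

variable (A) in
/-- Splitting off the first factor of the product in `A × X₁ × ⋯ × X_k`, so that it joins the
parameter object. -/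
noncomputable def paramCons (X : Fin (k + 1) → V) :
    (A ⨯ ∏ᶜ X) ≅ ((A ⨯ X 0) ⨯ ∏ᶜ fun i : Fin k => X i.succ) where
  hom := prod.lift (prod.lift prod.fst (prod.snd ≫ Pi.π X 0))
    (Pi.lift fun i => prod.snd ≫ Pi.π X i.succ)
  inv := prod.lift (prod.fst ≫ prod.fst) (Pi.lift fun i => Fin.cases
    (motive := fun i => ((A ⨯ X 0) ⨯ ∏ᶜ fun i : Fin k => X i.succ) ⟶ X i)
    (prod.fst ≫ prod.snd) (fun i => prod.snd ≫ Pi.π _ i) i)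
  hom_inv_id := param_hom_ext (by simp) (Fin.cases (by simp) fun i => by simp)
  inv_hom_id := param_hom_ext (prod.hom_ext (by simp) (by simp)) fun i => by simp

theorem map_comp_paramCons {X Y : Fin (k + 1) → V} (F : ∀ i, X i ⟶ Y i) :
    prod.map (𝟙 A) (Limits.Pi.map F) ≫ (paramCons A Y).hom = (paramCons A X).hom ≫
      prod.map (𝟙 (A ⨯ X 0)) (Limits.Pi.map fun i : Fin k => F i.succ) ≫
        prod.map (prod.map (𝟙 A) (F 0)) (𝟙 _) := by
  refine param_hom_ext (prod.hom_ext ?_ ?_) fun i => ?_ <;> simp [paramCons]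

end ParametrisedProduct

section Products

variable {K : Type u} [Bicategory.{w₂, v} K] [Strict K] [HasFiniteTwoProducts K]

namespace TwoCat.Cell

variable {A Z : K} {k : ℕ} {X : Fin k → K}

theorem param_ext {α β : Cell Z (A ⨯ ∏ᶜ X)} (h : α.post prod.fst = β.post prod.fst)
    (h' : ∀ i, α.post (prod.snd ≫ Pi.π X i) = β.post (prod.snd ≫ Pi.π X i)) : α = β :=
  (isTwoProduct_paramProj A X).cell_ext (Fin.cases h h')

theorem exists_param (p : Cell Z A) (f : ∀ i, Cell Z (X i)) :
    ∃ α : Cell Z (A ⨯ ∏ᶜ X), α.post prod.fst = p ∧ ∀ i, α.post (prod.snd ≫ Pi.π X i) = f i := by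
  obtain ⟨α, hα⟩ := (isTwoProduct_paramProj A X).exists_cellLift (Z := Z)
    (fun i => Fin.cases (motive := fun i => Cell Z ((Fin.cons A X : Fin (k + 1) → K) i)) p f i)
  exact ⟨α, hα 0, fun i => hα i.succ⟩

/-- The 2-cell into `A × X₁ × ⋯ × X_k` with given components. -/
noncomputable def param (p : Cell Z A) (f : ∀ i, Cell Z (X i)) : Cell Z (A ⨯ ∏ᶜ X) :=
  (exists_param p f).choose

@[simp] theorem param_fst (p : Cell Z A) (f : ∀ i, Cell Z (X i)) :
    (param p f).post prod.fst = p :=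
  (exists_param p f).choose_spec.1

@[simp] theorem param_snd (p : Cell Z A) (f : ∀ i, Cell Z (X i)) (i : Fin k) :
    (param p f).post (prod.snd ≫ Pi.π X i) = f i :=
  (exists_param p f).choose_spec.2 i

theorem pre_param {W : K} (g : W ⟶ Z) (p : Cell Z A) (f : ∀ i, Cell Z (X i)) :
    (param p f).pre g = param (p.pre g) (fun i => (f i).pre g) :=
  param_ext (by rw [post_pre, param_fst, param_fst]) fun i => by
    rw [post_pre, param_snd, param_snd]

theorem param_ofHom (p : Z ⟶ A) (f : ∀ i, Z ⟶ X i) :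
    param (ofHom p) (fun i => ofHom (f i)) = ofHom (prod.lift p (Pi.lift f)) :=
  param_ext (by rw [param_fst, post_ofHom, prod.lift_fst]) fun i => by
    rw [param_snd, post_ofHom, prod.lift_snd_assoc, Pi.lift_π]

theorem post_lift {W : K} (c : Cell W Z) (p : Z ⟶ A) (f : ∀ i, Z ⟶ X i) :
    c.post (prod.lift p (Pi.lift f)) = param (c.post p) (fun i => c.post (f i)) :=
  param_ext (by rw [param_fst, post_post, prod.lift_fst]) fun i => by
    rw [param_snd, post_post, prod.lift_snd_assoc, Pi.lift_π]

theorem post_lift_comp {W D : K} (c : Cell W Z) (p : Z ⟶ A) (f : ∀ i, Z ⟶ X i)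
    (g : (A ⨯ ∏ᶜ X) ⟶ D) : c.post (prod.lift p (Pi.lift f) ≫ g) =
      (param (c.post p) (fun i => c.post (f i))).post g := by
  rw [← post_post, post_lift]

theorem post_fst_comp {D : K} (p : Cell Z A) (f : ∀ i, Cell Z (X i)) (g : A ⟶ D) :
    (param p f).post (prod.fst ≫ g) = p.post g := by
  rw [← post_post, param_fst]

theorem arrowMk_paramMap₂ {Y : Fin k → K} {F G : ∀ i, X i ⟶ Y i} (α : ∀ i, F i ⟶ G i) :
    Arrow.mk (paramMap₂ A α) =
      param (ofHom prod.fst) fun i => pre (prod.snd ≫ Pi.π X i) (Arrow.mk (α i)) := by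
  refine param_ext ?_ fun i => ?_
  · rw [param_fst]
    exact arrowMk_eq_of_heq (paramMap_fst A F) (paramMap_fst A G) (isParamMap₂ A α).fst
  · rw [param_snd]
    exact arrowMk_eq_of_heq (paramMap_snd A F i) (paramMap_snd A G i) ((isParamMap₂ A α).snd i)

end TwoCat.Cell

theorem isTwoProduct_prod (X : Fin 2 → K) :
    IsTwoProduct X (X 0 ⨯ X 1) fun | 0 => prod.fst | 1 => prod.snd := by
  obtain ⟨p, ρ, hp⟩ := HasFiniteTwoProducts.exists_isTwoProduct 2 X
  exact hp.of_isProduct fun Z f => ⟨prod.lift (f 0) (f 1),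
    Fin.forall_fin_two.2 ⟨prod.lift_fst _ _, prod.lift_snd _ _⟩,
    fun g hg => prod.hom_ext ((hg 0).trans (prod.lift_fst _ _).symm)
      ((hg 1).trans (prod.lift_snd _ _).symm)⟩

theorem isTwoProduct_terminal (X : Fin 0 → K) : IsTwoProduct X (⊤_ K) fun i => i.elim0 := by
  obtain ⟨p, ρ, hp⟩ := HasFiniteTwoProducts.exists_isTwoProduct 0 X
  exact hp.of_isProduct fun Z f => ⟨terminal.from Z, fun i => i.elim0,
    fun g _ => terminal.hom_ext _ _⟩

namespace TwoCat.Cell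

variable {A B Z : K}

theorem prod_ext {α β : Cell Z (A ⨯ B)} (h : α.post prod.fst = β.post prod.fst)
    (h' : α.post prod.snd = β.post prod.snd) : α = β :=
  (isTwoProduct_prod ![A, B]).cell_ext (Fin.forall_fin_two.2 ⟨h, h'⟩)

theorem exists_prodLift (α : Cell Z A) (β : Cell Z B) :
    ∃ γ : Cell Z (A ⨯ B), γ.post prod.fst = α ∧ γ.post prod.snd = β := by
  obtain ⟨γ, hγ⟩ := (isTwoProduct_prod ![A, B]).exists_cellLift (Z := Z) fun
    | 0 => α
    | 1 => β
  exact ⟨γ, hγ 0, hγ 1⟩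

instance subsingleton_terminal : Subsingleton (Cell Z (⊤_ K)) :=
  ⟨fun _ _ => (isTwoProduct_terminal fun i => i.elim0).cell_ext fun i => i.elim0⟩

end TwoCat.Cell

end Products

namespace InfinitelyDistributive

variable {K : Type u} [Bicategory.{w₂, v} K] [Strict K] [HasFiniteTwoProducts K]

theorem isTwoCoproduct_prod_map_id (hK : InfinitelyDistributive.{w} K) (A : K) {ι : Type w}
    {X : ι → K} {c : K} {j : ∀ i, X i ⟶ c} (h : IsTwoCoproduct X c j) :
    IsTwoCoproduct (fun i => X i ⨯ A) (c ⨯ A) (fun i => prod.map (j i) (𝟙 A)) :=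
  (hK.distrib A ι X c j h).of_iso (fun _ => prod.braiding _ _) (prod.braiding _ _)
    fun _ => Limits.braid_natural _ _

theorem isTwoCoproduct_paramMap (hK : InfinitelyDistributive.{w} K) {k : ℕ} (A : K)
    {I : Fin k → Type w} {Y : ∀ i, I i → K} {C : Fin k → K} {j : ∀ i x, Y i x ⟶ C i}
    (hj : ∀ i, IsTwoCoproduct (Y i) (C i) (j i)) :
    IsTwoCoproduct (fun x : ∀ i, I i => A ⨯ ∏ᶜ fun i => Y i (x i)) (A ⨯ ∏ᶜ C)
      (fun x => paramMap A (fun i => j i (x i))) := by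
  induction k generalizing A with
  | zero =>
    have (x : ∀ i, I i) (i : Fin 0) : IsIso (j i (x i)) := i.elim0
    exact .of_unique inferInstance
  | succ k ih =>
    have h₀ := hK.isTwoCoproduct_prod_map_id (∏ᶜ fun i : Fin k => C i.succ)
      (hK.distrib A _ _ _ _ (hj 0))
    have h₁ x := ih (A ⨯ Y 0 x) fun i : Fin k => hj i.succ
    let σ := (Fin.consEquiv I).symm.trans (Equiv.sigmaEquivProd (I 0) (∀ i : Fin k, I i.succ)).symm
    exact ((h₀.sigma h₁).reindex σ).of_iso (fun x => paramCons A _) (paramCons A C)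
      fun x => map_comp_paramCons fun i => j i (x i)

end InfinitelyDistributive

/-! ### Paths -/

section Concat

variable {E : Type*}

/-- The concatenation of finite sequences, indexed as in `finSigmaFinEquiv`. -/
def finConcat {k : ℕ} (n : Fin k → ℕ) {N : ℕ} (h : ∑ i, n i = N) (e : ∀ i, Fin (n i) → E) :
    Fin N → E :=
  fun l => e (finSigmaFinEquiv.symm (Fin.cast h.symm l)).1
    (finSigmaFinEquiv.symm (Fin.cast h.symm l)).2

@[simp] theorem finConcat_apply {k : ℕ} (n : Fin k → ℕ) (e : ∀ i, Fin (n i) → E) (i : Fin k)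
    (j : Fin (n i)) : finConcat n rfl e (finSigmaFinEquiv ⟨i, j⟩) = e i j :=
  congrArg (fun x : (i : Fin k) × Fin (n i) => e x.1 x.2)
    (finSigmaFinEquiv.symm_apply_apply ⟨i, j⟩)

theorem finConcat_eq_iff {k : ℕ} {n : Fin k → ℕ} {e : ∀ i, Fin (n i) → E}
    {f : Fin (∑ i, n i) → E} :
    finConcat n rfl e = f ↔ ∀ i j, f (finSigmaFinEquiv ⟨i, j⟩) = e i j := by
  constructor
  · rintro rfl i j; simp
  · intro h
    funext l
    obtain ⟨⟨i, j⟩, rfl⟩ := finSigmaFinEquiv.surjective l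
    rw [finConcat_apply, h]

theorem finConcat_succ {k : ℕ} (n : Fin (k + 1) → ℕ) (e : ∀ i, Fin (n i) → E) :
    finConcat n rfl e = fun l => Fin.append
      (finConcat (fun i : Fin k => n i.castSucc) rfl (fun i => e i.castSucc)) (e (Fin.last k))
      (Fin.cast (Fin.sum_univ_castSucc n) l) := by
  refine finConcat_eq_iff.2 fun i => ?_
  induction i using Fin.lastCases with
  | last =>
    intro j
    have hj : Fin.cast (Fin.sum_univ_castSucc n) (finSigmaFinEquiv ⟨Fin.last k, j⟩) =
        Fin.natAdd _ j :=
      Fin.ext (by simp only [Fin.val_cast, finSigmaFinEquiv_apply, Fin.val_natAdd]; rfl)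
    rw [hj, Fin.append_right]
  | cast i =>
    intro j
    have hj : Fin.cast (Fin.sum_univ_castSucc n) (finSigmaFinEquiv ⟨i.castSucc, j⟩) =
        Fin.castAdd _ (finSigmaFinEquiv (n := fun i : Fin k => n i.castSucc) ⟨i, j⟩) :=
      Fin.ext (by simp only [Fin.val_cast, finSigmaFinEquiv_apply, Fin.val_castAdd]; rfl)
    rw [hj, Fin.append_left, finConcat_apply]

theorem ofFn_finConcat {k : ℕ} (n : Fin k → ℕ) {N : ℕ} (h : ∑ i, n i = N)
    (e : ∀ i, Fin (n i) → E) :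
    List.ofFn (finConcat n h e) = (List.ofFn fun i => List.ofFn (e i)).flatten := by
  subst h
  induction k with
  | zero =>
    rw [List.ofFn_zero, List.flatten_nil, ← List.length_eq_zero_iff, List.length_ofFn]
    simp
  | succ k ih =>
    rw [List.ofFn_succ', List.concat_eq_append, List.flatten_append, ← ih, finConcat_succ,
      List.flatten_singleton, ← List.ofFn_fin_append]
    exact List.ofFn_congr (Fin.sum_univ_castSucc n) _

theorem finConcat_finConcat {k : ℕ} (n : Fin k → ℕ) (m : Fin (∑ i, n i) → ℕ) {N : ℕ}
    (h : ∑ l, m l = N) (h' : ∑ i, ∑ j, m (finSigmaFinEquiv ⟨i, j⟩) = N)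
    (e : ∀ l, Fin (m l) → E) :
    finConcat m h e = finConcat (fun i => ∑ j, m (finSigmaFinEquiv ⟨i, j⟩)) h'
      (fun i => finConcat (fun j => m (finSigmaFinEquiv ⟨i, j⟩)) rfl
        (fun j => e (finSigmaFinEquiv ⟨i, j⟩))) := by
  apply List.ofFn_injective
  simp only [ofFn_finConcat]
  have : (fun l => List.ofFn (e l)) = finConcat n rfl
      (fun i j => List.ofFn (e (finSigmaFinEquiv ⟨i, j⟩))) :=
    (finConcat_eq_iff.2 fun i j => rfl).symm
  rw [this, ofFn_finConcat, List.flatten_flatten, List.map_ofFn]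
  rfl

theorem finConcat_singletons {k : ℕ} (h : ∑ _i : Fin k, 1 = k) (e : Fin k → E) :
    finConcat (fun _ => 1) h (fun i _ => e i) = e := by
  apply List.ofFn_injective
  rw [ofFn_finConcat]
  have : (List.ofFn fun i : Fin k => List.ofFn fun _ : Fin 1 => e i) =
      (List.ofFn e).map fun x => [x] := by
    rw [List.map_ofFn]; congr 1
  rw [this, ← List.flatMap_def, List.flatMap_singleton']

theorem finConcat_single {k : ℕ} (h : ∑ _i : Fin 1, k = k) (e : Fin k → E) :
    finConcat (fun _ => k) h (fun _ => e) = e := by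
  apply List.ofFn_injective
  rw [ofFn_finConcat]
  simp

end Concat

section Path

variable {O : Type*}

theorem isPath_iff_nat {a b : O} {k : ℕ} {s t : Fin k → O} :
    IsPath a b s t ↔ ∃ x : ℕ → O, x 0 = b ∧ x k = a ∧ ∀ i : Fin k, s i = x (i + 1) ∧ t i = x i := by
  constructor
  · rintro ⟨x, hb, ha, hx⟩
    have hofNat (i : Fin (k + 1)) : x (Fin.ofNat (k + 1) i) = x i :=
      congrArg x (Fin.ofNat_val_eq_self i)
    exact ⟨fun i => x (Fin.ofNat (k + 1) i), (hofNat 0).trans hb, (hofNat (Fin.last k)).trans ha,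
      fun i => ⟨(hx i).1.trans (hofNat i.succ).symm, (hx i).2.trans (hofNat i.castSucc).symm⟩⟩
  · rintro ⟨x, hb, ha, hx⟩
    exact ⟨fun i => x i, hb, ha, hx⟩

namespace IsPath

theorem single (a b : O) : IsPath a b (fun _ : Fin 1 => a) (fun _ : Fin 1 => b) := by
  refine ⟨![b, a], rfl, rfl, fun i => ?_⟩
  obtain rfl : i = 0 := Subsingleton.elim _ _
  exact ⟨rfl, rfl⟩

theorem eq_of_len_zero {a b : O} {s t : Fin 0 → O} (h : IsPath a b s t) : a = b := by
  obtain ⟨x, h₀, h₁, -⟩ := h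
  exact h₁.symm.trans h₀

theorem eq_of_len_one {a b a' b' : O}
    (h : IsPath a b (fun _ : Fin 1 => a') (fun _ : Fin 1 => b')) : a = a' ∧ b = b' := by
  obtain ⟨x, rfl, rfl, hx⟩ := h
  exact ⟨(hx 0).1.symm, (hx 0).2.symm⟩

theorem nil (a : O) (s t : Fin 0 → O) : IsPath a a s t :=
  ⟨fun _ => a, rfl, rfl, fun i => i.elim0⟩

theorem append {a b c : O} {m n : ℕ} {s t : Fin m → O} {s' t' : Fin n → O}
    (h : IsPath b c s t) (h' : IsPath a b s' t') :
    IsPath a c (Fin.append s s') (Fin.append t t') := by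
  rw [isPath_iff_nat] at h h' ⊢
  obtain ⟨x, hc, hb, hx⟩ := h
  obtain ⟨y, hb', ha, hy⟩ := h'
  let z (i : ℕ) : O := if i ≤ m then x i else y (i - m)
  have hz (i : ℕ) (hi : i ≤ m) : z i = x i := if_pos hi
  have hz' (i : ℕ) : z (m + i) = y i := by
    rcases i.eq_zero_or_pos with rfl | hi
    · exact (hz m le_rfl).trans (hb.trans hb'.symm)
    · simp only [z, if_neg (show ¬ m + i ≤ m by omega), Nat.add_sub_cancel_left]
  refine ⟨z, (hz 0 (Nat.zero_le m)).trans hc, (hz' n).trans ha, fun i => ?_⟩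
  induction i using Fin.addCases with
  | left i =>
    rw [Fin.append_left, Fin.append_left, Fin.val_castAdd, hz _ i.is_lt, hz _ i.is_le']
    exact hx i
  | right i =>
    rw [Fin.append_right, Fin.append_right, Fin.val_natAdd, hz', Nat.add_assoc, hz']
    exact hy i

theorem cast {a b : O} {p q : ℕ} (e : p = q) {s t : Fin q → O} (h : IsPath a b s t) :
    IsPath a b (fun l => s (Fin.cast e l)) (fun l => t (Fin.cast e l)) := by
  subst e; exact h

theorem concat {k : ℕ} {a b : O} {S T : Fin k → O} (H : IsPath a b S T) (n : Fin k → ℕ) {N : ℕ}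
    (hN : ∑ i, n i = N) {s t : ∀ i, Fin (n i) → O} (h : ∀ i, IsPath (S i) (T i) (s i) (t i)) :
    IsPath a b (finConcat n hN s) (finConcat n hN t) := by
  subst hN
  induction k generalizing a with
  | zero =>
    obtain rfl := H.eq_of_len_zero
    exact nil _ _ _
  | succ k ih =>
    obtain ⟨x, hb, ha, hx⟩ := H
    have init : IsPath (x (Fin.last k).castSucc) b (fun i : Fin k => S i.castSucc)
        (fun i => T i.castSucc) := ⟨fun i => x i.castSucc, hb, rfl, fun i => hx i.castSucc⟩
    have last : IsPath a (x (Fin.last k).castSucc) (s (Fin.last k)) (t (Fin.last k)) := by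
      have := h (Fin.last k)
      rwa [(hx (Fin.last k)).1, (hx (Fin.last k)).2, Fin.succ_last, ha] at this
    rw [finConcat_succ, finConcat_succ]
    exact ((ih init (fun i => n i.castSucc) fun i => h i.castSucc).append last).cast
      (Fin.sum_univ_castSucc n)

theorem reflect {O' : Type*} {f : O → O'} (hf : Function.Injective f) {a b : O} {k : ℕ}
    {s t : Fin k → O} (h : IsPath (f a) (f b) (fun i => f (s i)) (fun i => f (t i))) :
    IsPath a b s t := by
  obtain ⟨x, hb, ha, hx⟩ := h
  let y : Fin (k + 1) → O := Fin.cases b s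
  have hy : ∀ i, f (y i) = x i := Fin.cases hb.symm fun i => (hx i).1
  refine ⟨y, rfl, hf ((hy _).trans ha), fun i => ⟨rfl, hf ((hx i).2.trans (hy _).symm)⟩⟩

theorem congr_of_edges {O' : Type*} (c : O → O') {a b : O} {k : ℕ} {s t : Fin k → O}
    (h : IsPath a b s t) (e : ∀ i, c (s i) = c (t i)) :
    c a = c b ∧ ∀ i, c (s i) = c b ∧ c (t i) = c b := by
  obtain ⟨x, rfl, rfl, hx⟩ := h
  have hc (i : Fin (k + 1)) : c (x i) = c (x 0) := by
    induction i using Fin.induction with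
    | zero => rfl
    | succ i ih => rw [← ih, ← (hx i).1, ← (hx i).2, e]
  exact ⟨hc _, fun i => ⟨by rw [(hx i).1, hc], by rw [(hx i).2, hc]⟩⟩

end IsPath

end Path

/-! ### Elements of hom-objects -/

namespace KGraph

/-- A generalised element, of kind `E`, of one of the hom-objects of an enriched graph. -/
structure Edge {K : Type u} (X : KGraph.{w} K) (E : K → Type*) where
  src : X.Obj
  tgt : X.Obj
  hom : E (X.hom src tgt)

namespace Edge

variable {K : Type u} {X : KGraph.{w} K} {E : K → Type*} {a b : X.Obj}

theorem mk_injective : Function.Injective (Edge.mk a b : E (X.hom a b) → X.Edge E) :=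
  fun _ _ h => by simpa only [Edge.mk.injEq, heq_eq_eq, true_and] using h

theorem exists_mk_eq (e : X.Edge E) (ha : e.src = a) (hb : e.tgt = b) :
    ∃ f : E (X.hom a b), (⟨a, b, f⟩ : X.Edge E) = e := by
  subst ha hb; exact ⟨e.hom, rfl⟩

end Edge

variable {K : Type u} [Bicategory.{w₂, v} K]

/-- The elements of hom-objects with stage of definition `Z`. -/
abbrev Elt (X : KGraph.{w} K) (Z : K) := X.Edge (fun c => Z ⟶ c)

/-- The 2-cells between elements of hom-objects with stage of definition `Z`. -/
abbrev CellElt (X : KGraph.{w} K) (Z : K) := X.Edge (fun c => Cell Z c)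

section

variable {X : KGraph.{w} K} {W Z : K}

/-- Change of stage of an element. -/
abbrev Elt.pre (g : W ⟶ Z) (e : X.Elt Z) : X.Elt W := ⟨e.src, e.tgt, g ≫ e.hom⟩

/-- Change of stage of a 2-cell between elements. -/
abbrev CellElt.pre (g : W ⟶ Z) (e : X.CellElt Z) : X.CellElt W := ⟨e.src, e.tgt, e.hom.pre g⟩

/-- The identity 2-cell on an element. -/
abbrev Elt.cell (e : X.Elt Z) : X.CellElt Z := ⟨e.src, e.tgt, Cell.ofHom e.hom⟩

theorem Elt.cell_injective : Function.Injective (Elt.cell : X.Elt Z → X.CellElt Z) := by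
  rintro ⟨a, b, f⟩ ⟨a', b', f'⟩ h
  obtain rfl : a = a' := congrArg Edge.src h
  obtain rfl : b = b' := congrArg Edge.tgt h
  exact congrArg (Edge.mk a b) (Cell.ofHom_injective (Edge.mk_injective h))

end

/-- A 2-cell of enriched graphs together with its source and target, as a family of such 2-cells
of `K`; in this form its components can be computed with. -/
structure CellHom (X Y : KGraph.{w} K) where
  obj : X.Obj → Y.Obj
  map : ∀ a b, Cell (X.hom a b) (Y.hom (obj a) (obj b))

/-- The action of a graph morphism on elements. -/
abbrev Hom.elt {X Y : KGraph.{w} K} (F : X ⟶ Y) {Z : K} (e : X.Elt Z) : Y.Elt Z :=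
  ⟨F.obj e.src, F.obj e.tgt, e.hom ≫ F.map _ _⟩

namespace CellHom

variable {X Y Y' : KGraph.{w} K}

/-- The identity 2-cell on a graph morphism. -/
abbrev ofHom (F : X ⟶ Y) : CellHom X Y := ⟨F.obj, fun a b => Cell.ofHom (F.map a b)⟩

/-- Whiskering on the left. -/
abbrev pre (F : X ⟶ Y) (φ : CellHom Y Y') : CellHom X Y' :=
  ⟨fun a => φ.obj (F.obj a), fun a b => (φ.map _ _).pre (F.map a b)⟩

/-- Whiskering on the right. -/
abbrev post (φ : CellHom X Y) (F : Y ⟶ Y') : CellHom X Y' :=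
  ⟨fun a => F.obj (φ.obj a), fun a b => (φ.map a b).post (F.map _ _)⟩

/-- The action of a 2-cell on elements. -/
abbrev elt (φ : CellHom X Y) {Z : K} (e : X.Elt Z) : Y.CellElt Z :=
  ⟨φ.obj e.src, φ.obj e.tgt, (φ.map _ _).pre e.hom⟩

/-- The family of components of a 2-cell of graphs. -/
def ofHom₂ : ∀ {F G : X ⟶ Y}, (F ⟶ G) → CellHom X Y
  | _, _, Hom₂.mk f α => ⟨f, fun a b => Arrow.mk (α a b)⟩

/-- The family of components of a 2-cell in the 2-category of graphs. -/
def ofCell (α : Cell X Y) : CellHom X Y := ofHom₂ α.hom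

/-- The 2-cell in the 2-category of graphs with the given components. -/
def toCell (φ : CellHom X Y) : Cell X Y :=
  @Arrow.mk (X ⟶ Y) _ _ _ (Hom₂.mk φ.obj fun a b => (φ.map a b).hom)

theorem toCell_ofHom₂ : ∀ {F G : X ⟶ Y} (α : F ⟶ G), (ofHom₂ α).toCell = Arrow.mk α
  | _, _, Hom₂.mk _ _ => rfl

@[simp] theorem toCell_ofCell (α : Cell X Y) : (ofCell α).toCell = α :=
  toCell_ofHom₂ α.hom

theorem ofCell_injective : Function.Injective (ofCell : Cell X Y → CellHom X Y) :=
  Function.LeftInverse.injective toCell_ofCell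

theorem ofHom₂_whiskerLeft (F : X ⟶ Y) : ∀ {G H : Y ⟶ Y'} (α : G ⟶ H),
    ofHom₂ (F ◁ α) = (ofHom₂ α).pre F
  | _, _, Hom₂.mk _ _ => rfl

theorem ofCell_pre (F : X ⟶ Y) (α : Cell Y Y') : ofCell (α.pre F) = (ofCell α).pre F :=
  ofHom₂_whiskerLeft F α.hom

theorem ofHom₂_whiskerRight : ∀ {F G : X ⟶ Y} (α : F ⟶ G) (H : Y ⟶ Y'),
    ofHom₂ (α ▷ H) = (ofHom₂ α).post H
  | _, _, Hom₂.mk _ _, _ => rfl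

theorem ofHom_elt (F : X ⟶ Y) {Z : K} (e : X.Elt Z) : (ofHom F).elt e = (Hom.elt F e).cell :=
  congrArg (Edge.mk _ _) (Cell.pre_ofHom _ _)

variable [Strict K]

theorem pre_elt (F : X ⟶ Y) (φ : CellHom Y Y') {Z : K} (e : X.Elt Z) :
    (φ.pre F).elt e = φ.elt (Hom.elt F e) :=
  congrArg (Edge.mk _ _) (Cell.pre_pre _ _ _)

theorem elt_pre (φ : CellHom X Y) {W Z : K} (g : W ⟶ Z) (e : X.Elt Z) :
    φ.elt (e.pre g) = (φ.elt e).pre g :=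
  congrArg (Edge.mk _ _) (Cell.pre_pre _ _ _).symm

theorem ext_elt {φ ψ : CellHom X Y}
    (h : ∀ a b, φ.elt ⟨a, b, 𝟙 (X.hom a b)⟩ = ψ.elt ⟨a, b, 𝟙 (X.hom a b)⟩) : φ = ψ := by
  obtain ⟨f, α⟩ := φ
  obtain ⟨g, β⟩ := ψ
  obtain rfl : f = g := funext fun a => congrArg Edge.src (h a a)
  congr 1
  funext a b
  simpa only [Cell.pre_id] using Edge.mk_injective (h a b)

end CellHom

theorem Hom.elt_comp {X Y Y' : KGraph.{w} K} [Strict K] (F : X ⟶ Y) (G : Y ⟶ Y') {Z : K}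
    (e : X.Elt Z) : Hom.elt (F ≫ G) e = Hom.elt G (Hom.elt F e) :=
  congrArg (Edge.mk _ _) (Strict.assoc _ _ _).symm

theorem Hom.elt_id {X : KGraph.{w} K} [Strict K] {Z : K} (e : X.Elt Z) :
    Hom.elt (𝟙 X) e = e :=
  congrArg (Edge.mk _ _) (Strict.comp_id _)

end KGraph

open KGraph

namespace KPCat

variable {K : Type u} [Bicategory.{w₂, v} K] [Strict K] [HasFiniteTwoProducts K] {P : Operad K}
  {X Y : KPCat.{w} P} {Z : K} {k : ℕ}

/-- Composition of elements. -/
noncomputable abbrev eltAct (X : KPCat.{w} P) (p : Z ⟶ P.obj k) (e : Fin k → X.graph.Elt Z)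
    {a b : X.graph.Obj} (h : IsPath a b (fun i => (e i).src) (fun i => (e i).tgt)) :
    X.graph.Elt Z :=
  ⟨a, b, prod.lift p (Pi.lift fun i => (e i).hom) ≫ X.act h⟩

/-- Composition of 2-cells between elements. -/
noncomputable abbrev cellAct (X : KPCat.{w} P) (p : Z ⟶ P.obj k) (e : Fin k → X.graph.CellElt Z)
    {a b : X.graph.Obj} (h : IsPath a b (fun i => (e i).src) (fun i => (e i).tgt)) :
    X.graph.CellElt Z :=
  ⟨a, b, (Cell.param (Cell.ofHom p) fun i => (e i).hom).post (X.act h)⟩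

theorem eltAct_cell (p : Z ⟶ P.obj k) (e : Fin k → X.graph.Elt Z) {a b : X.graph.Obj}
    (h : IsPath a b (fun i => (e i).src) (fun i => (e i).tgt)) :
    (X.eltAct p e h).cell = X.cellAct p (fun i => (e i).cell) h := by
  refine congrArg (Edge.mk a b) ?_
  exact (Cell.post_ofHom _ _).symm.trans (congrArg (Cell.post · (X.act h))
    (Cell.param_ofHom p fun i => (e i).hom).symm)

theorem cellAct_congr {p p' : Z ⟶ P.obj k} (hp : p = p') {e e' : Fin k → X.graph.CellElt Z}
    (he : e = e') {a b a' b' : X.graph.Obj} (ha : a = a') (hb : b = b')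
    {h : IsPath a b (fun i => (e i).src) (fun i => (e i).tgt)}
    {h' : IsPath a' b' (fun i => (e' i).src) (fun i => (e' i).tgt)} :
    X.cellAct p e h = X.cellAct p' e' h' := by
  subst hp he ha hb; rfl

theorem eltAct_congr {p p' : Z ⟶ P.obj k} (hp : p = p') {e e' : Fin k → X.graph.Elt Z}
    (he : e = e') {a b a' b' : X.graph.Obj} (ha : a = a') (hb : b = b')
    {h : IsPath a b (fun i => (e i).src) (fun i => (e i).tgt)}
    {h' : IsPath a' b' (fun i => (e' i).src) (fun i => (e' i).tgt)} :
    X.eltAct p e h = X.eltAct p' e' h' := by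
  subst hp he ha hb; rfl

theorem eltAct_pre {W : K} (g : W ⟶ Z) (p : Z ⟶ P.obj k) (e : Fin k → X.graph.Elt Z)
    {a b : X.graph.Obj} (h : IsPath a b (fun i => (e i).src) (fun i => (e i).tgt)) :
    (X.eltAct p e h).pre g = X.eltAct (g ≫ p) (fun i => (e i).pre g) h :=
  congrArg (Edge.mk a b) (comp_paramLift_comp g p (fun i => (e i).hom) (X.act h))

theorem cellAct_mul (n : Fin k → ℕ) {N : ℕ} (hN : ∑ i, n i = N) (p : Z ⟶ P.obj k)
    (q : ∀ i, Z ⟶ P.obj (n i)) (e : ∀ i, Fin (n i) → X.graph.CellElt Z)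
    {S T : Fin k → X.graph.Obj} {a b : X.graph.Obj}
    (h : ∀ i, IsPath (S i) (T i) (fun j => (e i j).src) (fun j => (e i j).tgt))
    (H : IsPath a b S T)
    (h' : IsPath a b (fun l => (finConcat n hN e l).src) (fun l => (finConcat n hN e l).tgt)) :
    X.cellAct (prod.lift p (Pi.lift q) ≫ P.mul n N hN) (finConcat n hN e) h' =
      X.cellAct p (fun i => X.cellAct (q i) (e i) (h i)) H := by
  subst hN
  generalize hE : finConcat n rfl e = E at h' ⊢
  rw [finConcat_eq_iff] at hE
  obtain rfl : e = fun i j => E (finSigmaFinEquiv ⟨i, j⟩) :=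
    funext fun i => funext fun j => (hE i j).symm
  refine congrArg (Edge.mk a b) ?_
  have key := X.act_mul n S T _ _ a b H h h'
    ((P.obj k ⨯ ∏ᶜ fun i => P.obj (n i)) ⨯ ∏ᶜ fun l => X.graph.hom (E l).src (E l).tgt)
    (prod.fst ≫ prod.fst) (fun i => prod.fst ≫ prod.snd ≫ Pi.π _ i)
    (fun l => prod.snd ≫ Pi.π _ l)
  have key' := congrArg (Cell.post (Cell.param (Cell.ofHom (prod.lift p (Pi.lift q)))
    fun l => (E l).hom)) key
  have e₁ : prod.lift p (Pi.lift q) ≫ prod.fst = p := prod.lift_fst _ _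
  have e₂ (i) : prod.lift p (Pi.lift q) ≫ prod.snd ≫ Pi.π (fun i => P.obj (n i)) i = q i :=
    paramLift_snd p q i
  simp only [Cell.post_lift_comp, Cell.param_snd, Cell.post_fst_comp, Cell.post_ofHom, e₁, e₂,
    Cell.param_ofHom] at key'
  exact key'

theorem cellAct_unit (e : X.graph.CellElt Z) {a b : X.graph.Obj}
    (h : IsPath a b (fun _ : Fin 1 => e.src) (fun _ : Fin 1 => e.tgt)) :
    X.cellAct (terminal.from Z ≫ P.unit) (fun _ : Fin 1 => e) h = e := by
  obtain ⟨a', b', f⟩ := e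
  obtain ⟨rfl, rfl⟩ := h.eq_of_len_one
  have hunit : Cell.ofHom (terminal.from Z ≫ P.unit) =
      f.post (terminal.from (X.graph.hom a b) ≫ P.unit) := by
    rw [← Cell.post_ofHom, ← Cell.post_post, Subsingleton.elim (f.post _)]
  have hact := congrArg f.post (X.act_unit a b h (X.graph.hom a b) (𝟙 _))
  rw [Cell.post_lift_comp, Cell.post_id, ← hunit] at hact
  exact congrArg (Edge.mk a b) hact

/-- A family of 2-cells, with its source and target, is a 2-cell of `(K, P)`-categories if it
commutes with composition; this subsumes `IsFunctor` for the source and target, and `IsIcon`. -/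
def IsFunctor₂ (X Y : KPCat.{w} P) (φ : CellHom X.graph Y.graph) : Prop :=
  ∀ ⦃k : ℕ⦄ ⦃s t : Fin k → X.graph.Obj⦄ ⦃a b : X.graph.Obj⦄ (h : IsPath a b s t),
    (φ.map a b).pre (X.act h) = (Cell.param (Cell.ofHom prod.fst)
      fun i => (φ.map (s i) (t i)).pre (prod.snd ≫ Pi.π _ i)).post (Y.act (h.map φ.obj))

theorem isFunctor₂_iff_elt {φ : CellHom X.graph Y.graph} : IsFunctor₂ X Y φ ↔
    ∀ ⦃Z : K⦄ ⦃k : ℕ⦄ (p : Z ⟶ P.obj k) (e : Fin k → X.graph.Elt Z) ⦃a b : X.graph.Obj⦄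
      (h : IsPath a b (fun i => (e i).src) (fun i => (e i).tgt)),
      φ.elt (X.eltAct p e h) = Y.cellAct p (fun i => φ.elt (e i)) (h.map φ.obj) := by
  constructor
  · intro hφ Z k p e a b h
    refine congrArg (Edge.mk _ _) ?_
    rw [← Cell.pre_pre, hφ h, ← Cell.post_pre, Cell.pre_param, Cell.pre_ofHom, prod.lift_fst]
    congr 2
    funext i
    rw [Cell.pre_pre, paramLift_snd]
  · intro hφ k s t a b h
    have := Edge.mk_injective (hφ (Z := P.obj k ⨯ ∏ᶜ fun i => X.graph.hom (s i) (t i)) prod.fst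
      (fun i => ⟨s i, t i, prod.snd ≫ Pi.π _ i⟩) h)
    rw [← this]
    congr 1
    refine (Strict.id_comp _).symm.trans (congrArg (· ≫ X.act h) ?_)
    exact param_hom_ext (by rw [prod.lift_fst]; exact Strict.id_comp _) fun i => by
      rw [paramLift_snd]; exact Strict.id_comp _

theorem isFunctor₂_ofHom₂_mk {f : X.graph.Obj → Y.graph.Obj}
    {F G : ∀ a b, X.graph.hom a b ⟶ Y.graph.hom (f a) (f b)} (α : ∀ a b, F a b ⟶ G a b) :
    IsFunctor₂ X Y (CellHom.ofHom₂ (Hom₂.mk f α)) ↔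
      ∀ ⦃k : ℕ⦄ ⦃s t : Fin k → X.graph.Obj⦄ ⦃a b : X.graph.Obj⦄ (h : IsPath a b s t),
        Arrow.mk (X.act h ◁ α a b) =
          Arrow.mk (paramMap₂ (P.obj k) (fun i => α (s i) (t i)) ▷ Y.act (h.map f)) := by
  refine forall_congr' fun k => forall_congr' fun s => forall_congr' fun t =>
    forall_congr' fun a => forall_congr' fun b => forall_congr' fun h => Eq.congr_right ?_
  exact congrArg (Cell.post · (Y.act (h.map f))) (Cell.arrowMk_paramMap₂ _).symm

theorem isFunctor₂_ofHom₂ {F G : X.graph ⟶ Y.graph} (hF : IsFunctor X Y F) (hG : IsFunctor X Y G)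
    (α : F ⟶ G) : IsFunctor₂ X Y (CellHom.ofHom₂ α) ↔ IsIcon X Y α := by
  obtain ⟨f, α⟩ := α
  rw [isFunctor₂_ofHom₂_mk]
  exact ⟨fun h _ _ _ _ _ hp => heq_of_arrowMk_eq (h hp),
    fun h _ _ _ _ _ hp => arrowMk_eq_of_heq (hF hp) (hG hp) (h hp)⟩

theorem IsFunctor₂.isFunctor_src {F G : X.graph ⟶ Y.graph} {α : F ⟶ G}
    (h : IsFunctor₂ X Y (CellHom.ofHom₂ α)) : IsFunctor X Y F := by
  obtain ⟨f, α⟩ := α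
  exact fun k s t a b hp => congrArg Comma.left ((isFunctor₂_ofHom₂_mk α).1 h hp)

theorem IsFunctor₂.isFunctor_tgt {F G : X.graph ⟶ Y.graph} {α : F ⟶ G}
    (h : IsFunctor₂ X Y (CellHom.ofHom₂ α)) : IsFunctor X Y G := by
  obtain ⟨f, α⟩ := α
  exact fun k s t a b hp => congrArg Comma.right ((isFunctor₂_ofHom₂_mk α).1 h hp)

/-- The graph 2-cell underlying a 2-cell of `(K, P)`-categories, as a family of components. -/
noncomputable def cellHom (α : Cell X Y) : CellHom X.graph Y.graph := CellHom.ofHom₂ α.hom.hom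

theorem isFunctor₂_cellHom (α : Cell X Y) : IsFunctor₂ X Y (cellHom α) :=
  (isFunctor₂_ofHom₂ α.left.isHom α.right.isHom α.hom.hom).2 α.hom.isHom₂

theorem cellHom_injective : Function.Injective (cellHom : Cell X Y → CellHom X.graph Y.graph) := by
  rintro @⟨⟨F, hF⟩, ⟨G, hG⟩, ⟨α, hα⟩⟩ @⟨⟨F', hF'⟩, ⟨G', hG'⟩, ⟨β, hβ⟩⟩ h
  have h : Arrow.mk α = Arrow.mk β := CellHom.ofCell_injective h
  obtain rfl : F = F' := congrArg Comma.left h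
  obtain rfl : G = G' := congrArg Comma.right h
  obtain rfl : α = β := Arrow.mk_injective _ _ h
  rfl

theorem exists_cellHom_eq {φ : CellHom X.graph Y.graph} (h : IsFunctor₂ X Y φ) :
    ∃ α : Cell X Y, cellHom α = φ := by
  have h' : IsFunctor₂ X Y (CellHom.ofHom₂ φ.toCell.hom) := h
  exact ⟨@Arrow.mk (X ⟶ Y) _ ⟨_, h'.isFunctor_src⟩ ⟨_, h'.isFunctor_tgt⟩
    ⟨φ.toCell.hom, (isFunctor₂_ofHom₂ h'.isFunctor_src h'.isFunctor_tgt _).1 h'⟩, rfl⟩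

theorem cellHom_pre {X' : KPCat.{w} P} (F : X' ⟶ X) (α : Cell X Y) :
    cellHom (α.pre F) = (cellHom α).pre F.hom :=
  CellHom.ofHom₂_whiskerLeft F.hom α.hom.hom

theorem cellHom_post {Y' : KPCat.{w} P} (α : Cell X Y) (F : Y ⟶ Y') :
    cellHom (α.post F) = (cellHom α).post F.hom :=
  CellHom.ofHom₂_whiskerRight α.hom.hom F.hom

theorem isFunctor_iff {F : X.graph ⟶ Y.graph} :
    IsFunctor X Y F ↔ IsFunctor₂ X Y (CellHom.ofHom F) :=
  ⟨fun h => (isFunctor₂_ofHom₂ h h (𝟙 F)).2 ((iconStructure P).isHom₂_id h),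
    fun h => IsFunctor₂.isFunctor_src (α := 𝟙 F) h⟩

theorem isFunctor_iff_elt {F : X.graph ⟶ Y.graph} : IsFunctor X Y F ↔
    ∀ ⦃Z : K⦄ ⦃k : ℕ⦄ (p : Z ⟶ P.obj k) (e : Fin k → X.graph.Elt Z) ⦃a b : X.graph.Obj⦄
      (h : IsPath a b (fun i => (e i).src) (fun i => (e i).tgt)),
      Hom.elt F (X.eltAct p e h) = Y.eltAct p (fun i => Hom.elt F (e i)) (h.map F.obj) := by
  rw [isFunctor_iff, isFunctor₂_iff_elt]
  refine forall_congr' fun Z => forall_congr' fun k => forall_congr' fun p =>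
    forall_congr' fun e => forall_congr' fun a => forall_congr' fun b => forall_congr' fun h => ?_
  have h₁ : (CellHom.ofHom F).elt (X.eltAct p e h) = (Hom.elt F (X.eltAct p e h)).cell :=
    CellHom.ofHom_elt F _
  have h₂ : Y.cellAct p (fun i => (CellHom.ofHom F).elt (e i)) (h.map F.obj) =
      (Y.eltAct p (fun i => Hom.elt F (e i)) (h.map F.obj)).cell := by
    rw [eltAct_cell]
    exact cellAct_congr rfl (funext fun i => CellHom.ofHom_elt F _) rfl rfl
  rw [h₁, h₂]
  exact ⟨fun h => Elt.cell_injective h, fun h => congrArg _ h⟩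

end KPCat

/-! ### The free category on a graph -/

section Generators

variable {K : Type u} [Bicategory.{w₂, v} K] [Strict K] [HasFiniteTwoProducts K]

/- By distributivity `A × C₁ × ⋯ × C_k` is the coproduct of the `A × Y₁ × ⋯ × Y_k`, and a natural
operation is determined by its value on the projections, that is, by a 1-cell out of the former. -/
theorem InfinitelyDistributive.eq_of_elements (hK : InfinitelyDistributive.{w} K) {k : ℕ} {A : K}
    {I : Fin k → Type w} {Y : ∀ i, I i → K} {C : Fin k → K} {j : ∀ i x, Y i x ⟶ C i}
    (hj : ∀ i, IsTwoCoproduct (Y i) (C i) (j i)) {D : K}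
    (L R : ∀ {Z : K}, (Z ⟶ A) → (∀ i, Z ⟶ C i) → (Z ⟶ D))
    (hL : ∀ {W Z : K} (g : W ⟶ Z) (p : Z ⟶ A) (f : ∀ i, Z ⟶ C i),
      g ≫ L p f = L (g ≫ p) (fun i => g ≫ f i))
    (hR : ∀ {W Z : K} (g : W ⟶ Z) (p : Z ⟶ A) (f : ∀ i, Z ⟶ C i),
      g ≫ R p f = R (g ≫ p) (fun i => g ≫ f i))
    (h : ∀ {Z : K} (p : Z ⟶ A) (x : ∀ i, I i) (f : ∀ i, Z ⟶ Y i (x i)),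
      L p (fun i => f i ≫ j i (x i)) = R p (fun i => f i ≫ j i (x i)))
    {Z : K} (p : Z ⟶ A) (f : ∀ i, Z ⟶ C i) : L p f = R p f := by
  have universal : L (Z := A ⨯ ∏ᶜ C) prod.fst (fun i => prod.snd ≫ Pi.π C i) =
      R (Z := A ⨯ ∏ᶜ C) prod.fst (fun i => prod.snd ≫ Pi.π C i) := by
    refine (hK.isTwoCoproduct_paramMap A hj).hom_ext fun x => ?_
    have hsnd : (fun i => paramMap A (fun i => j i (x i)) ≫ prod.snd ≫ Pi.π C i) =
        fun i => (prod.snd ≫ Pi.π (fun i => Y i (x i)) i) ≫ j i (x i) :=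
      funext fun i => paramMap_snd A _ i
    rw [hL, hR, hsnd]
    exact h _ x _
  have := congrArg (prod.lift p (Pi.lift f) ≫ ·) universal
  simpa only [hL, hR, prod.lift_fst, paramLift_snd] using this

variable {P : Operad K}

theorem act_mul_of_generators (hK : InfinitelyDistributive.{w} K) {X : KGraph.{w} K}
    {I : X.Obj → X.Obj → Type w} {Y : ∀ a b, I a b → K} {j : ∀ a b x, Y a b x ⟶ X.hom a b}
    (hj : ∀ a b, IsTwoCoproduct (Y a b) (X.hom a b) (j a b))
    (act : ∀ {k : ℕ} {s t : Fin k → X.Obj} {a b : X.Obj},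
      IsPath a b s t → ((P.obj k ⨯ ∏ᶜ fun i => X.hom (s i) (t i)) ⟶ X.hom a b))
    {k : ℕ} (n : Fin k → ℕ) (S T : Fin k → X.Obj) (s t : Fin (∑ i, n i) → X.Obj) (a b : X.Obj)
    (H : IsPath a b S T)
    (h : ∀ i, IsPath (S i) (T i) (fun j => s (finSigmaFinEquiv ⟨i, j⟩))
      (fun j => t (finSigmaFinEquiv ⟨i, j⟩)))
    (h' : IsPath a b s t)
    (key : ∀ (Z : K) (p : Z ⟶ P.obj k) (q : ∀ i, Z ⟶ P.obj (n i)) (x : ∀ l, I (s l) (t l))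
      (f : ∀ l, Z ⟶ Y _ _ (x l)),
      prod.lift (prod.lift p (Pi.lift q) ≫ P.mul n _ rfl) (Pi.lift fun l => f l ≫ j _ _ (x l)) ≫
        act h' =
      prod.lift p (Pi.lift fun i =>
        prod.lift (q i) (Pi.lift fun i' => f (finSigmaFinEquiv ⟨i, i'⟩) ≫ j _ _ (x _)) ≫
          act (h i)) ≫ act H)
    (Z : K) (p : Z ⟶ P.obj k) (q : ∀ i, Z ⟶ P.obj (n i))
    (f : ∀ l, Z ⟶ X.hom (s l) (t l)) :
    prod.lift (prod.lift p (Pi.lift q) ≫ P.mul n _ rfl) (Pi.lift f) ≫ act h' =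
      prod.lift p (Pi.lift fun i =>
        prod.lift (q i) (Pi.lift fun j => f (finSigmaFinEquiv ⟨i, j⟩)) ≫ act (h i)) ≫ act H := by
  have main := hK.eq_of_elements (A := P.obj k ⨯ ∏ᶜ fun i => P.obj (n i)) (fun l => hj (s l) (t l))
    (fun {Z} r f => prod.lift (r ≫ P.mul n _ rfl) (Pi.lift f) ≫ act h')
    (fun {Z} r f => prod.lift (r ≫ prod.fst) (Pi.lift fun i =>
        prod.lift (r ≫ prod.snd ≫ Pi.π _ i) (Pi.lift fun j => f (finSigmaFinEquiv ⟨i, j⟩)) ≫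
          act (h i)) ≫ act H)
    (fun g r f => by rw [comp_paramLift_comp, Strict.assoc])
    (fun g r f => by simp only [comp_paramLift_comp, Strict.assoc])
    (fun {Z} r x f => by
      have := key Z (r ≫ prod.fst) (fun i => r ≫ prod.snd ≫ Pi.π _ i) x f
      rwa [← eq_paramLift r] at this)
    (prod.lift p (Pi.lift q)) f
  simpa only [prod.lift_fst, paramLift_snd] using main

theorem KPCat.isFunctor₂_of_generators (hK : InfinitelyDistributive.{w} K) {X X' : KPCat.{w} P}
    {I : X.graph.Obj → X.graph.Obj → Type w} {Y : ∀ a b, I a b → K}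
    {j : ∀ a b x, Y a b x ⟶ X.graph.hom a b}
    (hj : ∀ a b, IsTwoCoproduct (Y a b) (X.graph.hom a b) (j a b))
    {φ : CellHom X.graph X'.graph}
    (key : ∀ (Z : K) (k : ℕ) (p : Z ⟶ P.obj k) (s t : Fin k → X.graph.Obj)
      (x : ∀ i, I (s i) (t i)) (f : ∀ i, Z ⟶ Y _ _ (x i)) (a b : X.graph.Obj)
      (h : IsPath a b s t),
      φ.elt (X.eltAct p (fun i => ⟨s i, t i, f i ≫ j _ _ (x i)⟩) h) =
        X'.cellAct p (fun i => φ.elt ⟨s i, t i, f i ≫ j _ _ (x i)⟩) (h.map φ.obj)) :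
    IsFunctor₂ X X' φ := by
  intro k s t a b h
  refine (hK.isTwoCoproduct_paramMap (P.obj k) fun i => hj (s i) (t i)).cell_ext fun x => ?_
  have := Edge.mk_injective (key _ k prod.fst s t x (fun i => prod.snd ≫ Pi.π _ i) a b h)
  have e : paramMap (P.obj k) (fun i => j _ _ (x i)) = prod.lift prod.fst
      (Pi.lift fun i => (prod.snd ≫ Pi.π (fun i => Y (s i) (t i) (x i)) i) ≫ j _ _ (x i)) :=
    param_hom_ext (by rw [prod.lift_fst, paramMap_fst]) fun i => by
      rw [paramLift_snd, paramMap_snd]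
  rw [Cell.pre_pre]
  refine (congrArg (fun g => (φ.map a b).pre (g ≫ X.act h)) e).trans (this.trans ?_)
  rw [← Cell.post_pre, Cell.pre_param, Cell.pre_ofHom, paramMap_fst]
  congr 2
  funext i
  rw [Cell.pre_pre, paramMap_snd]

end Generators

namespace KPCat

section FreeGraph

variable {K : Type u} [Bicategory.{w₂, v} K] [Strict K] [HasFiniteTwoProducts K]
  (hK : InfinitelyDistributive.{w} K) (P : Operad K) {X : KGraph.{w} K} {a b : X.Obj}

/-- The summand `P(k) × X(x_{k-1}, x_k) × ⋯ × X(x₀, x₁)`, indexed by a path, of a hom-object of the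
free `(K, P)`-category. -/
noncomputable abbrev freeSummand (p : PathIn a b) : K :=
  P.obj p.len ⨯ ∏ᶜ fun i => X.hom (p.src i) (p.tgt i)

/-- The projection of a summand to the `i`th edge of its path, as an element of `X`. -/
noncomputable abbrev summandEdge (p : PathIn a b) (i : Fin p.len) : X.Elt (freeSummand P p) :=
  ⟨p.src i, p.tgt i, prod.snd ≫ Pi.π _ i⟩

variable (X) in
/-- The hom-objects of the free `(K, P)`-category. -/
noncomputable def freeHom (a b : X.Obj) : K :=
  (hK.exists_isTwoCoproduct (PathIn a b) (freeSummand P)).choose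

/-- The coproduct injections of the hom-objects of the free `(K, P)`-category. -/
noncomputable def freeInj (p : PathIn a b) : freeSummand P p ⟶ freeHom hK P X a b :=
  (hK.exists_isTwoCoproduct (PathIn a b) (freeSummand P)).choose_spec.choose p

variable (X) in
theorem isTwoCoproduct_freeInj (a b : X.Obj) :
    IsTwoCoproduct (freeSummand P) (freeHom hK P X a b) (freeInj hK P) :=
  (hK.exists_isTwoCoproduct (PathIn a b) (freeSummand P)).choose_spec.choose_spec

variable (X) in
/-- The graph underlying the free `(K, P)`-category. -/
noncomputable abbrev freeGraph : KGraph.{w} K := ⟨X.Obj, freeHom hK P X⟩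

variable {P} {Z : K} {N k : ℕ}

/-- The element of the free `(K, P)`-category given by a composable family of elements. -/
noncomputable abbrev freeElt (r : Z ⟶ P.obj N) (e : Fin N → X.Elt Z)
    (h : IsPath a b (fun i => (e i).src) (fun i => (e i).tgt)) : (freeGraph hK P X).Elt Z :=
  ⟨a, b, prod.lift r (Pi.lift fun i => (e i).hom) ≫ freeInj hK P ⟨N, _, _, h⟩⟩

theorem freeElt_congr {r r' : Z ⟶ P.obj N} (hr : r = r') {e e' : Fin N → X.Elt Z} (he : e = e')
    {h : IsPath a b (fun i => (e i).src) (fun i => (e i).tgt)}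
    {h' : IsPath a b (fun i => (e' i).src) (fun i => (e' i).tgt)} :
    freeElt hK r e h = freeElt hK r' e' h' := by
  subst hr he; rfl

theorem freeElt_hom_congr {r r' : Z ⟶ P.obj N} (hr : r = r') {e e' : Fin N → X.Elt Z}
    (he : e = e') {h : IsPath a b (fun i => (e i).src) (fun i => (e i).tgt)}
    {h' : IsPath a b (fun i => (e' i).src) (fun i => (e' i).tgt)} :
    (freeElt hK r e h).hom = (freeElt hK r' e' h').hom := by
  subst hr he; rfl

theorem comp_freeElt_hom {W : K} (g : W ⟶ Z) (r : Z ⟶ P.obj N) (e : Fin N → X.Elt Z)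
    (h : IsPath a b (fun i => (e i).src) (fun i => (e i).tgt)) :
    g ≫ (freeElt hK r e h).hom = (freeElt hK (g ≫ r) (fun i => (e i).pre g) h).hom :=
  comp_paramLift_comp g r (fun i => (e i).hom) (freeInj hK P ⟨N, _, _, h⟩)

theorem comp_freeInj (p : PathIn a b) (g : Z ⟶ freeSummand P p) :
    g ≫ freeInj hK P p =
      (freeElt hK (g ≫ prod.fst) (fun i => (summandEdge P p i).pre g) p.isPath).hom :=
  congrArg (· ≫ freeInj hK P p) (eq_paramLift g)

theorem freeInj_eq (p : PathIn a b) :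
    freeInj hK P p = (freeElt hK prod.fst (summandEdge P p) p.isPath).hom := by
  simpa only [Strict.id_comp] using comp_freeInj hK p (𝟙 (freeSummand P p))

theorem cellHom_ext_freeElt {Y : KGraph.{w} K} {φ ψ : CellHom (freeGraph hK P X) Y}
    (h : ∀ {a b : X.Obj} (p : PathIn a b),
      φ.elt (freeElt hK prod.fst (summandEdge P p) p.isPath) =
        ψ.elt (freeElt hK prod.fst (summandEdge P p) p.isPath)) : φ = ψ := by
  obtain ⟨f, α⟩ := φ
  obtain ⟨g, β⟩ := ψ
  obtain rfl : f = g := funext fun a =>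
    congrArg Edge.src (h (⟨0, Fin.elim0, Fin.elim0, IsPath.nil a _ _⟩ : PathIn a a))
  congr 1
  funext a b
  refine (isTwoCoproduct_freeInj hK P X a b).cell_ext fun p => ?_
  rw [freeInj_eq]
  exact Edge.mk_injective (h p)

end FreeGraph

section FreeAct

variable {K : Type u} [Bicategory.{w₂, v} K] [Strict K] [HasFiniteTwoProducts K]
  (hK : InfinitelyDistributive.{w} K) {P : Operad K} {X : KGraph.{w} K} {Z : K} {N k : ℕ}
  {S T : Fin k → X.Obj} {a b : X.Obj}

theorem exists_freeAct (H : IsPath a b S T) :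
    ∃ m : (P.obj k ⨯ ∏ᶜ fun i => freeHom hK P X (S i) (T i)) ⟶ freeHom hK P X a b,
      ∀ x : ∀ i, PathIn (S i) (T i), paramMap (P.obj k) (fun i => freeInj hK P (x i)) ≫ m =
        (freeElt hK (prod.lift prod.fst (Pi.lift fun i => prod.snd ≫ Pi.π _ i ≫ prod.fst) ≫
            P.mul (fun i => (x i).len) _ rfl)
          (finConcat (fun i => (x i).len) rfl
            fun i j => (summandEdge P (x i) j).pre (prod.snd ≫ Pi.π _ i))
          (H.concat (fun i => (x i).len) rfl fun i => (x i).isPath)).hom :=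
  (hK.isTwoCoproduct_paramMap (P.obj k)
    fun i => isTwoCoproduct_freeInj hK P X (S i) (T i)).exists_desc _

/-- The composition maps of the free `(K, P)`-category. -/
noncomputable def freeAct (H : IsPath a b S T) :
    (P.obj k ⨯ ∏ᶜ fun i => freeHom hK P X (S i) (T i)) ⟶ freeHom hK P X a b :=
  (exists_freeAct hK H).choose

theorem freeAct_summand (H : IsPath a b S T) (x : ∀ i, PathIn (S i) (T i)) (p : Z ⟶ P.obj k)
    (f : ∀ i, Z ⟶ freeSummand P (x i)) :
    prod.lift p (Pi.lift fun i => f i ≫ freeInj hK P (x i)) ≫ freeAct hK H =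
      (freeElt hK (prod.lift p (Pi.lift fun i => f i ≫ prod.fst) ≫
          P.mul (fun i => (x i).len) _ rfl)
        (finConcat (fun i => (x i).len) rfl fun i j => (summandEdge P (x i) j).pre (f i))
        (H.concat (fun i => (x i).len) rfl fun i => (x i).isPath)).hom := by
  have factor : prod.lift p (Pi.lift fun i => f i ≫ freeInj hK P (x i)) =
      prod.lift p (Pi.lift f) ≫ paramMap (P.obj k) fun i => freeInj hK P (x i) :=
    param_hom_ext (by rw [Category.assoc, paramMap_fst, prod.lift_fst, prod.lift_fst])
      fun i => by rw [Category.assoc, paramMap_snd, paramLift_snd, Category.assoc,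
        prod.lift_snd_assoc, Pi.lift_π_assoc]
  have edge (i) (j) : prod.lift p (Pi.lift f) ≫ (prod.snd ≫ Pi.π _ i) ≫
      (summandEdge P (x i) j).hom = f i ≫ (summandEdge P (x i) j).hom := by
    rw [Category.assoc, prod.lift_snd_assoc, Pi.lift_π_assoc]
  rw [factor, Category.assoc]
  refine (congrArg _ ((exists_freeAct hK H).choose_spec x)).trans
    ((comp_freeElt_hom hK _ _ _ _).trans (freeElt_hom_congr hK ?_ (funext fun l => ?_)))
  · rw [comp_paramLift_comp, prod.lift_fst]
    congr 3
    funext i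
    rw [prod.lift_snd_assoc, Pi.lift_π_assoc]
  · exact congrArg (Edge.mk _ _) (edge _ _)

theorem freeAct_elt (n : Fin k → ℕ) (hN : ∑ i, n i = N) (p : Z ⟶ P.obj k)
    (r : ∀ i, Z ⟶ P.obj (n i)) (e : ∀ i, Fin (n i) → X.Elt Z)
    (h : ∀ i, IsPath (S i) (T i) (fun j => (e i j).src) (fun j => (e i j).tgt))
    (H : IsPath a b S T) :
    prod.lift p (Pi.lift fun i => (freeElt hK (r i) (e i) (h i)).hom) ≫ freeAct hK H =
      (freeElt hK (prod.lift p (Pi.lift r) ≫ P.mul n N hN) (finConcat n hN e)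
        (H.concat n hN h)).hom := by
  subst hN
  refine (freeAct_summand hK H (fun i => ⟨n i, _, _, h i⟩) p
    fun i => prod.lift (r i) (Pi.lift fun j => (e i j).hom)).trans
      (freeElt_hom_congr hK ?_ (congrArg (finConcat n rfl) (funext fun i => funext fun j => ?_)))
  · simp only [prod.lift_fst]
  · exact congrArg (Edge.mk _ _) (paramLift_snd _ _ j)

theorem freeAct_unit (a b : X.Obj) (h : IsPath a b (fun _ : Fin 1 => a) (fun _ : Fin 1 => b))
    (Z : K) (f : Z ⟶ freeHom hK P X a b) :
    prod.lift (terminal.from Z ≫ P.unit) (Pi.lift fun _ : Fin 1 => f) ≫ freeAct hK h = f := by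
  have universal : prod.lift (terminal.from _ ≫ P.unit)
      (Pi.lift fun _ : Fin 1 => 𝟙 (freeHom hK P X a b)) ≫ freeAct hK h = 𝟙 _ := by
    refine (isTwoCoproduct_freeInj hK P X a b).hom_ext fun p => ?_
    rw [comp_paramLift_comp, Strict.comp_id, ← Category.assoc, terminal.comp_from, freeInj_eq]
    refine (freeAct_elt hK (N := p.len) (fun _ : Fin 1 => p.len) (by simp)
      (terminal.from _ ≫ P.unit)
      (fun _ => prod.fst) (fun _ => summandEdge P p) (fun _ => p.isPath) h).trans ?_
    exact freeElt_hom_congr hK (P.unit_mul _ _ _ _) (finConcat_single _ _)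
  have := congrArg (f ≫ ·) universal
  rwa [comp_paramLift_comp, Strict.comp_id, ← Category.assoc f, terminal.comp_from] at this

theorem freeAct_mul (n : Fin k → ℕ) (S T : Fin k → X.Obj) (s t : Fin (∑ i, n i) → X.Obj)
    (a b : X.Obj) (H : IsPath a b S T)
    (h : ∀ i, IsPath (S i) (T i) (fun j => s (finSigmaFinEquiv ⟨i, j⟩))
      (fun j => t (finSigmaFinEquiv ⟨i, j⟩)))
    (h' : IsPath a b s t) (Z : K) (p : Z ⟶ P.obj k) (q : ∀ i, Z ⟶ P.obj (n i))
    (f : ∀ l, Z ⟶ freeHom hK P X (s l) (t l)) :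
    prod.lift (prod.lift p (Pi.lift q) ≫ P.mul n _ rfl) (Pi.lift f) ≫ freeAct hK h' =
      prod.lift p (Pi.lift fun i =>
        prod.lift (q i) (Pi.lift fun j => f (finSigmaFinEquiv ⟨i, j⟩)) ≫ freeAct hK (h i)) ≫
          freeAct hK H := by
  refine act_mul_of_generators hK (X := freeGraph hK P X) (I := PathIn (O := X.Obj))
    (Y := fun _ _ => freeSummand (X := X) P) (j := fun _ _ => freeInj hK P (X := X))
    (isTwoCoproduct_freeInj hK P X) (fun h => freeAct hK (P := P) (X := X) h)
    n S T s t a b H h h' (fun Z p q x f => ?_) Z p q f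
  have hN : ∑ i, ∑ j, (x (finSigmaFinEquiv ⟨i, j⟩)).len = ∑ l, (x l).len := by
    rw [← finSigmaFinEquiv.sum_comp, Fintype.sum_sigma]
  refine (freeAct_summand hK h' x _ f).trans (Eq.trans ?_
    (congrArg (fun g => prod.lift p (Pi.lift g) ≫ freeAct hK H) (funext fun i =>
      freeAct_summand hK (h i) (fun j => x (finSigmaFinEquiv ⟨i, j⟩)) (q i)
        fun j => f (finSigmaFinEquiv ⟨i, j⟩))).symm)
  refine Eq.trans ?_ (freeAct_elt hK (fun i => ∑ j, (x (finSigmaFinEquiv ⟨i, j⟩)).len) hN p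
    (fun i => prod.lift (q i) (Pi.lift fun j => f (finSigmaFinEquiv ⟨i, j⟩) ≫ prod.fst) ≫
      P.mul (fun j => (x (finSigmaFinEquiv ⟨i, j⟩)).len) _ rfl)
    (fun i => finConcat (fun j => (x (finSigmaFinEquiv ⟨i, j⟩)).len) rfl fun j l =>
      (summandEdge P (x (finSigmaFinEquiv ⟨i, j⟩)) l).pre (f (finSigmaFinEquiv ⟨i, j⟩)))
    (fun i => (h i).concat (fun j => (x (finSigmaFinEquiv ⟨i, j⟩)).len) rfl
      fun j => (x (finSigmaFinEquiv ⟨i, j⟩)).isPath) H).symm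
  exact freeElt_hom_congr hK
    (P.assoc n (fun l => (x l).len) _ rfl hN Z p q fun l => f l ≫ prod.fst)
    (finConcat_finConcat n (fun l => (x l).len) rfl hN fun l j => (summandEdge P (x l) j).pre (f l))

end FreeAct

section Free

variable {K : Type u} [Bicategory.{w₂, v} K] [Strict K] [HasFiniteTwoProducts K]
  (hK : InfinitelyDistributive.{w} K) {P : Operad K} {X : KGraph.{w} K} {Z : K} {N : ℕ}
  {a b : X.Obj}

variable (P X) in
/-- The free `(K, P)`-category on a graph. -/
noncomputable abbrev free : KPCat.{w} P where
  graph := freeGraph hK P X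
  act h := freeAct hK (P := P) (X := X) h
  act_unit := freeAct_unit hK (P := P) (X := X)
  act_mul := freeAct_mul hK (P := P) (X := X)

variable (P X) in
/-- The inclusion of a graph in the free `(K, P)`-category on it. -/
noncomputable abbrev freeUnit : X ⟶ (free hK P X).graph :=
  KGraph.Hom.mk (Y := freeGraph hK P X) (fun a => a) fun a b =>
    (freeElt hK (terminal.from _ ≫ P.unit) (fun _ : Fin 1 => ⟨a, b, 𝟙 (X.hom a b)⟩)
      (IsPath.single a b)).hom

theorem freeUnit_elt (e : X.Elt Z) : Hom.elt (freeUnit hK P X) e =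
    freeElt hK (terminal.from Z ≫ P.unit) (fun _ : Fin 1 => e) (IsPath.single _ _) := by
  refine congrArg (Edge.mk _ _) ((comp_freeElt_hom hK e.hom _ _ _).trans
    (freeElt_hom_congr hK ?_ (funext fun _ => ?_)))
  · rw [← Category.assoc, terminal.comp_from]
  · exact congrArg (Edge.mk _ _) (Strict.comp_id _)

theorem freeElt_eq_eltAct (r : Z ⟶ P.obj N) (e : Fin N → X.Elt Z)
    (h : IsPath a b (fun i => (e i).src) (fun i => (e i).tgt)) :
    freeElt hK r e h = (free hK P X).eltAct r (fun i => Hom.elt (freeUnit hK P X) (e i)) h := by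
  symm
  calc (free hK P X).eltAct r (fun i => Hom.elt (freeUnit hK P X) (e i)) h
      = (free hK P X).eltAct r (fun i => freeElt hK (terminal.from Z ≫ P.unit)
          (fun _ : Fin 1 => e i) (IsPath.single _ _)) h :=
        eltAct_congr rfl (funext fun i => freeUnit_elt hK (e i)) rfl rfl
    _ = freeElt hK (prod.lift r (Pi.lift fun _ => terminal.from Z ≫ P.unit) ≫
          P.mul (fun _ : Fin N => 1) N (by simp))
          (finConcat (fun _ => 1) (by simp) fun i _ => e i) _ :=
        congrArg (Edge.mk (X := freeGraph hK P X) (E := fun c => Z ⟶ c) a b)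
          (freeAct_elt hK (P := P) (fun _ : Fin N => 1) (by simp) r
            (fun _ => terminal.from Z ≫ P.unit) (fun i _ => e i) (fun i => IsPath.single _ _) h)
    _ = freeElt hK r e h := freeElt_congr hK (P.mul_unit _ _ _ _) (finConcat_singletons _ _)

theorem paramMap_freeUnit_act (p : PathIn a b) :
    paramMap (P.obj p.len) (fun i => (freeUnit hK P X).map (p.src i) (p.tgt i)) ≫
      (free hK P X).act (p.isPath.map (freeUnit hK P X).obj) = freeInj hK P p := by
  rw [freeInj_eq]
  refine Eq.trans ?_ (Edge.mk_injective (X := freeGraph hK P X)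
    (E := fun c => freeSummand P p ⟶ c) (a := a) (b := b)
    (freeElt_eq_eltAct hK prod.fst (summandEdge P p) p.isPath)).symm
  congr 1
  exact param_hom_ext (by rw [paramMap_fst, prod.lift_fst]) fun i => by
    rw [paramMap_snd, paramLift_snd]

variable {Y : KPCat.{w} P}

theorem IsFunctor₂.elt_freeElt {ψ : CellHom (free hK P X).graph Y.graph}
    (hψ : IsFunctor₂ (free hK P X) Y ψ) (r : Z ⟶ P.obj N) (e : Fin N → X.Elt Z)
    (h : IsPath a b (fun i => (e i).src) (fun i => (e i).tgt)) :
    ψ.elt (freeElt hK r e h) =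
      Y.cellAct r (fun i => (ψ.pre (freeUnit hK P X)).elt (e i)) (h.map ψ.obj) := by
  rw [freeElt_eq_eltAct]
  refine (isFunctor₂_iff_elt.1 hψ _ _ _).trans ?_
  exact cellAct_congr rfl (funext fun i => (CellHom.pre_elt _ _ _).symm) rfl rfl

theorem exists_freeDesc (φ : CellHom X Y.graph) :
    ∃ m : ∀ a b, Cell (freeHom hK P X a b) (Y.graph.hom (φ.obj a) (φ.obj b)),
      ∀ {Z : K} {N : ℕ} (r : Z ⟶ P.obj N) (e : Fin N → X.Elt Z) {a b : X.Obj}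
        (h : IsPath a b (fun i => (e i).src) (fun i => (e i).tgt)),
        (CellHom.mk (X := freeGraph hK P X) φ.obj m).elt (freeElt hK r e h) =
          Y.cellAct r (fun i => φ.elt (e i)) (h.map φ.obj) := by
  choose m hm using fun a b => (isTwoCoproduct_freeInj hK P X a b).exists_cellDesc
    (Z := Y.graph.hom (φ.obj a) (φ.obj b))
    fun p => (Y.cellAct prod.fst (fun i => φ.elt (summandEdge P p i)) (p.isPath.map φ.obj)).hom
  refine ⟨m, fun r e a b h => congrArg (Edge.mk (φ.obj a) (φ.obj b)) ?_⟩
  rw [← Cell.pre_pre, hm, ← Cell.post_pre, Cell.pre_param, Cell.pre_ofHom, prod.lift_fst]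
  congr 2
  funext i
  rw [Cell.pre_pre, paramLift_snd]

/-- The extension of a 2-cell of graphs along the inclusion in the free `(K, P)`-category. -/
noncomputable def freeDesc (φ : CellHom X Y.graph) : CellHom (freeGraph hK P X) Y.graph :=
  ⟨φ.obj, (exists_freeDesc hK φ).choose⟩

theorem freeDesc_freeElt (φ : CellHom X Y.graph) (r : Z ⟶ P.obj N) (e : Fin N → X.Elt Z)
    (h : IsPath a b (fun i => (e i).src) (fun i => (e i).tgt)) :
    (freeDesc hK φ).elt (freeElt hK r e h) = Y.cellAct r (fun i => φ.elt (e i)) (h.map φ.obj) :=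
  (exists_freeDesc hK φ).choose_spec r e h

theorem isFunctor₂_freeDesc (φ : CellHom X Y.graph) :
    IsFunctor₂ (free hK P X) Y (freeDesc hK φ) := by
  refine isFunctor₂_of_generators hK (X := free hK P X) (I := PathIn (O := X.Obj))
    (Y := fun _ _ => freeSummand (X := X) P) (j := fun _ _ => freeInj hK P (X := X))
    (isTwoCoproduct_freeInj hK P X) fun Z k p s t x f a b h => ?_
  have generator (i : Fin k) : (freeDesc hK φ).elt ⟨s i, t i, f i ≫ freeInj hK P (X := X) (x i)⟩ =
      Y.cellAct (f i ≫ prod.fst) (fun j => φ.elt ((summandEdge (X := X) P (x i) j).pre (f i)))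
        ((x i).isPath.map φ.obj) :=
    (congrArg (fun g => (freeDesc hK φ).elt ⟨s i, t i, g⟩)
      (comp_freeInj hK (X := X) (x i) (f i))).trans (freeDesc_freeElt hK φ _ _ _)
  refine (congrArg (fun g => (freeDesc hK φ).elt ⟨a, b, g⟩)
    (freeAct_summand hK (X := X) h x p f)).trans ((freeDesc_freeElt hK φ _ _ _).trans ?_)
  refine (cellAct_mul (fun i => (x i).len) rfl p (fun i => f i ≫ prod.fst)
    (fun i j => φ.elt ((summandEdge (X := X) P (x i) j).pre (f i)))
    (fun i => (x i).isPath.map φ.obj) (h.map φ.obj) _).trans ?_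
  exact cellAct_congr rfl (funext fun i => (generator i).symm) rfl rfl

theorem freeDesc_pre_freeUnit (φ : CellHom X Y.graph) :
    (freeDesc hK φ).pre (freeUnit hK P X) = φ := by
  refine CellHom.ext_elt fun a b => (CellHom.pre_elt _ _ _).trans ?_
  rw [freeUnit_elt]
  exact (freeDesc_freeElt hK φ _ _ _).trans (cellAct_unit _ _)

theorem existsUnique_freeExtension (φ : CellHom X Y.graph) :
    ∃! ψ : CellHom (free hK P X).graph Y.graph,
      IsFunctor₂ (free hK P X) Y ψ ∧ ψ.pre (freeUnit hK P X) = φ := by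
  refine ⟨freeDesc hK φ, ⟨isFunctor₂_freeDesc hK φ, freeDesc_pre_freeUnit hK φ⟩, ?_⟩
  rintro ψ ⟨hψ, rfl⟩
  exact cellHom_ext_freeElt hK fun p =>
    (hψ.elt_freeElt hK _ _ _).trans (freeDesc_freeElt hK _ _ _ _).symm

end Free

end KPCat

/-! ### 2-universal arrows -/

section UniversalArrows

variable {B : Type u} [Bicategory.{w₂, v} B] {C : Type u'} [Bicategory.{w₂', v'} C]

/-- The action of a 2-functor on 2-cells. -/
def TwoCat.Cell.map (F : StrictPseudofunctor B C) {a b : B} (α : Cell a b) :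
    Cell (F.obj a) (F.obj b) := Arrow.mk (F.map₂ α.hom)

theorem TwoCat.Cell.map_ofHom (F : StrictPseudofunctor B C) {a b : B} (f : a ⟶ b) :
    (ofHom f).map F = ofHom (F.map f) :=
  congrArg Arrow.mk (F.map₂_id f)

namespace TwoCat.Cell

variable [Strict B] [Strict C] (F : StrictPseudofunctor B C) {a b c : B}

theorem map_pre (f : a ⟶ b) (α : Cell b c) : (α.pre f).map F = (α.map F).pre (F.map f) :=
  arrowMk_eq_of_heq (F.map_comp _ _) (F.map_comp _ _) (F.map₂_whiskerLeft_heq _ _)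

theorem map_post (α : Cell a b) (f : b ⟶ c) : (α.post f).map F = (α.map F).post (F.map f) :=
  arrowMk_eq_of_heq (F.map_comp _ _) (F.map_comp _ _) (F.map₂_whiskerRight_heq _ _)

end TwoCat.Cell

/-- `η : X ⟶ U Y` is a 2-universal arrow from `X` to `U`. -/
def IsTwoUniversal (U : StrictPseudofunctor C B) {X : B} {Y : C} (η : X ⟶ U.obj Y) : Prop :=
  ∀ (Z : C) (α : Cell X (U.obj Z)), ∃! β : Cell Y Z, (β.map U).pre η = α

theorem IsTwoUniversal.cell_ext {U : StrictPseudofunctor C B} {X : B} {Y Z : C} {η : X ⟶ U.obj Y}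
    (h : IsTwoUniversal U η) {β β' : Cell Y Z} (e : (β.map U).pre η = (β'.map U).pre η) : β = β' :=
  (h Z _).unique e rfl

namespace IsTwoUniversal

section

variable {U : StrictPseudofunctor C B} {X : B} {Y : C} {η : X ⟶ U.obj Y} (h : IsTwoUniversal U η)
include h

theorem hom_ext {Z : C} {f g : Y ⟶ Z} (e : η ≫ U.map f = η ≫ U.map g) : f = g :=
  Cell.ofHom_injective (h.cell_ext (by
    rw [Cell.map_ofHom, Cell.map_ofHom, Cell.pre_ofHom, Cell.pre_ofHom, e]))

theorem exists_hom {Z : C} (f : X ⟶ U.obj Z) : ∃ g : Y ⟶ Z, η ≫ U.map g = f :=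
  let ⟨β, hβ, _⟩ := h Z (Cell.ofHom f)
  ⟨β.left, congrArg Comma.left hβ⟩

/-- The 1-cell induced by a universal arrow. -/
noncomputable def desc {Z : C} (f : X ⟶ U.obj Z) : Y ⟶ Z := (h.exists_hom f).choose

theorem fac {Z : C} (f : X ⟶ U.obj Z) : η ≫ U.map (h.desc f) = f := (h.exists_hom f).choose_spec

theorem exists_desc₂ {Z : C} {f g : X ⟶ U.obj Z} (α : f ⟶ g) :
    ∃ β : h.desc f ⟶ h.desc g, Cell.pre η (Cell.map U (Arrow.mk β)) = Arrow.mk α := by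
  obtain ⟨β, hβ, -⟩ := h Z (Arrow.mk α)
  obtain ⟨β, rfl⟩ := exists_arrowMk_eq β
    (h.hom_ext ((congrArg Comma.left hβ).trans (h.fac f).symm))
    (h.hom_ext ((congrArg Comma.right hβ).trans (h.fac g).symm))
  exact ⟨β, hβ⟩

/-- The 2-cell induced by a universal arrow. -/
noncomputable def desc₂ {Z : C} {f g : X ⟶ U.obj Z} (α : f ⟶ g) : h.desc f ⟶ h.desc g :=
  (h.exists_desc₂ α).choose

theorem fac₂ {Z : C} {f g : X ⟶ U.obj Z} (α : f ⟶ g) :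
    Cell.pre η (Cell.map U (Arrow.mk (h.desc₂ α))) = Arrow.mk α :=
  (h.exists_desc₂ α).choose_spec

end

variable {U : StrictPseudofunctor C B} {F : B → C} {η : ∀ X, X ⟶ U.obj (F X)}
  (h : ∀ X, IsTwoUniversal U (η X))

/-- The left adjoint determined by a family of universal arrows, on 1-cells. -/
noncomputable def adjMap {X Y : B} (f : X ⟶ Y) : F X ⟶ F Y := (h X).desc (f ≫ η Y)

/-- The left adjoint determined by a family of universal arrows, on 2-cells. -/
noncomputable def adjMap₂ {X Y : B} {f g : X ⟶ Y} (α : f ⟶ g) : adjMap h f ⟶ adjMap h g :=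
  (h X).desc₂ (α ▷ η Y)

theorem comp_adjMap {X Y : B} (f : X ⟶ Y) : η X ≫ U.map (adjMap h f) = f ≫ η Y := (h X).fac _

theorem pre_adjMap₂ {X Y : B} {f g : X ⟶ Y} (α : f ⟶ g) :
    Cell.pre (η X) (Cell.map U (Arrow.mk (adjMap₂ h α))) = Cell.post (Arrow.mk α) (η Y) :=
  (h X).fac₂ _

/-- The counit of the 2-adjunction determined by a family of universal arrows. -/
noncomputable def counit (Y : C) : F (U.obj Y) ⟶ Y := (h (U.obj Y)).desc (𝟙 _)

theorem comp_counit (Y : C) : η (U.obj Y) ≫ U.map (counit h Y) = 𝟙 _ := (h _).fac _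

theorem adjMap₂_id {X Y : B} (f : X ⟶ Y) : adjMap₂ h (𝟙 f) = 𝟙 (adjMap h f) :=
  Arrow.mk_injective _ _ ((h X).cell_ext (by
    change _ = Cell.pre (η X) (Cell.map U (Cell.ofHom _))
    rw [pre_adjMap₂, Cell.map_ofHom, Cell.pre_ofHom, comp_adjMap]
    exact Cell.post_ofHom f (η Y)))

theorem adjMap₂_comp {X Y : B} {f g k : X ⟶ Y} (α : f ⟶ g) (β : g ⟶ k) :
    adjMap₂ h (α ≫ β) = adjMap₂ h α ≫ adjMap₂ h β :=
  Arrow.mk_injective _ _ ((h X).cell_ext (by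
    rw [pre_adjMap₂]
    refine arrowMk_eq_of_heq (comp_adjMap h _).symm (comp_adjMap h _).symm ?_
    change HEq ((α ≫ β) ▷ η Y) (η X ◁ U.map₂ (adjMap₂ h α ≫ adjMap₂ h β))
    rw [comp_whiskerRight, U.map₂_comp, whiskerLeft_comp]
    exact TwoCat.comp_heq (comp_adjMap h _).symm (comp_adjMap h _).symm (comp_adjMap h _).symm
      (heq_of_arrowMk_eq (pre_adjMap₂ h α).symm) (heq_of_arrowMk_eq (pre_adjMap₂ h β).symm)))

variable [Strict B]

theorem adjMap_id (X : B) : adjMap h (𝟙 X) = 𝟙 (F X) := (h X).hom_ext (by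
  rw [comp_adjMap, U.map_id, Strict.comp_id, Strict.id_comp])

theorem adjMap_comp {X Y Z : B} (f : X ⟶ Y) (g : Y ⟶ Z) :
    adjMap h (f ≫ g) = adjMap h f ≫ adjMap h g := (h X).hom_ext (by
  rw [comp_adjMap, U.map_comp, ← Strict.assoc, comp_adjMap, Strict.assoc f (η Y), comp_adjMap,
    Strict.assoc])

theorem counit_naturality {X Y : C} (f : X ⟶ Y) :
    adjMap h (U.map f) ≫ counit h Y = counit h X ≫ f := (h _).hom_ext (by
  rw [U.map_comp, U.map_comp, ← Strict.assoc, comp_adjMap, Strict.assoc, comp_counit,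
    ← Strict.assoc, comp_counit, Strict.id_comp, Strict.comp_id])

theorem adjMap_comp_counit (X : B) :
    adjMap h (η X) ≫ counit h (F X) = 𝟙 (F X) := (h X).hom_ext (by
  rw [U.map_comp, ← Strict.assoc, comp_adjMap, Strict.assoc, comp_counit, U.map_id])

variable [Strict C]

theorem adjMap₂_whiskerLeft {X Y Z : B} (f : X ⟶ Y) {g k : Y ⟶ Z} (α : g ⟶ k) :
    Arrow.mk (adjMap₂ h (f ◁ α)) = Cell.pre (adjMap h f) (Arrow.mk (adjMap₂ h α)) :=
  (h X).cell_ext (by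
    rw [pre_adjMap₂, Cell.map_pre, Cell.pre_pre, comp_adjMap, ← Cell.pre_pre, pre_adjMap₂]
    exact Cell.post_pre _ (Arrow.mk α) _)

theorem adjMap₂_whiskerRight {X Y Z : B} {f g : X ⟶ Y} (α : f ⟶ g) (k : Y ⟶ Z) :
    Arrow.mk (adjMap₂ h (α ▷ k)) = Cell.post (Arrow.mk (adjMap₂ h α)) (adjMap h k) :=
  (h X).cell_ext (by
    rw [pre_adjMap₂, Cell.map_post, ← Cell.post_pre, pre_adjMap₂, Cell.post_post, comp_adjMap,
      ← Cell.post_post]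
    rfl)

/-- The left 2-adjoint determined by a family of universal arrows. -/
noncomputable def leftAdjoint : StrictPseudofunctor B C :=
  StrictPseudofunctor.mk''
    { obj := F
      map := adjMap h
      map₂ := adjMap₂ h
      map_id := adjMap_id h
      map_comp := adjMap_comp h
      map₂_id := adjMap₂_id h
      map₂_comp := adjMap₂_comp h
      map₂_whisker_left := fun f _ _ α => Arrow.mk_injective _ _
        ((adjMap₂_whiskerLeft h f α).trans (by simp [Cell.pre]))
      map₂_whisker_right := fun α f => Arrow.mk_injective _ _
        ((adjMap₂_whiskerRight h α f).trans (by simp [Cell.post])) }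

theorem counit_naturality₂ {X Y : C} {f g : X ⟶ Y} (α : f ⟶ g) :
    Cell.post (Arrow.mk (adjMap₂ h (U.map₂ α))) (counit h Y) =
      Cell.pre (counit h X) (Arrow.mk α) := (h _).cell_ext (by
  rw [Cell.map_post, Cell.map_pre, ← Cell.post_pre, pre_adjMap₂, Cell.post_post,
    Cell.pre_pre, comp_counit, comp_counit, Cell.post_id, Cell.pre_id]
  rfl)

/-- The 2-adjunction determined by a family of universal arrows. -/
noncomputable def adjunction : TwoAdjunction (leftAdjoint h) U where
  unit :=
    { app := η
      naturality := fun f => (comp_adjMap h f).symm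
      naturality₂ := fun α => heq_of_arrowMk_eq (pre_adjMap₂ h α).symm }
  counit :=
    { app := counit h
      naturality := counit_naturality h
      naturality₂ := fun α => heq_of_arrowMk_eq (counit_naturality₂ h α) }
  left_triangle := adjMap_comp_counit h
  right_triangle := comp_counit h

end IsTwoUniversal

/-- The adjunction of underlying 1-functors of a 2-adjunction. -/
def TwoAdjunction.toAdjunction [Strict B] [Strict C] {F : StrictPseudofunctor B C}
    {U : StrictPseudofunctor C B} (adj : TwoAdjunction F U) : F.toFunctor ⊣ U.toFunctor where
  unit := { app := adj.unit.app, naturality := fun _ _ f => adj.unit.naturality f }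
  counit := { app := adj.counit.app, naturality := fun _ _ f => adj.counit.naturality f }
  left_triangle_components := adj.left_triangle
  right_triangle_components := adj.right_triangle

end UniversalArrows

/-! ### 2-monadicity -/

namespace KGraph

variable {K : Type u} [Bicategory.{w₂, v} K] {X Y Y' Z : KGraph.{w} K} {W : K}

theorem Hom.obj_obj_of_comp_eq_id {F : X ⟶ Y} {G : Y ⟶ X} (h : F ≫ G = 𝟙 X) (a : X.Obj) :
    G.obj (F.obj a) = a :=
  congrFun (congrArg Hom.obj h) a

variable [Strict K]

theorem Hom.elt_pre (F : X ⟶ Y) {W' : K} (g : W' ⟶ W) (e : X.Elt W) :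
    Hom.elt F (e.pre g) = (Hom.elt F e).pre g :=
  congrArg (Edge.mk _ _) (Strict.assoc _ _ _)

theorem Hom.elt_elt_of_comp_eq_id {F : X ⟶ Y} {G : Y ⟶ X} (h : F ≫ G = 𝟙 X) (e : X.Elt W) :
    Hom.elt G (Hom.elt F e) = e := by
  rw [← Hom.elt_comp, h, Hom.elt_id]

theorem Hom.elt_elt_of_comm {F : X ⟶ Y} {G : Y ⟶ Z} {F' : X ⟶ Y'} {G' : Y' ⟶ Z}
    (h : F ≫ G = F' ≫ G') (e : X.Elt W) : Hom.elt G (Hom.elt F e) = Hom.elt G' (Hom.elt F' e) := by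
  rw [← Hom.elt_comp, h, Hom.elt_comp]

end KGraph

namespace KPCat

variable {K : Type u} [Bicategory.{w₂, v} K] [Strict K] [HasFiniteTwoProducts K] {P : Operad K}

theorem IsFunctor₂.of_section {X' X Y : KPCat.{w} P} {e : X'.graph ⟶ X.graph}
    (he : IsFunctor X' X e) {s : X.graph ⟶ X'.graph} (hs : s ≫ e = 𝟙 X.graph)
    {φ : CellHom X.graph Y.graph} (h : IsFunctor₂ X' Y (φ.pre e)) : IsFunctor₂ X Y φ := by
  have elt_section {Z : K} (x : X.graph.Elt Z) := Hom.elt_elt_of_comp_eq_id hs x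
  have obj_section (a : X.graph.Obj) := Hom.obj_obj_of_comp_eq_id hs a
  rw [isFunctor₂_iff_elt]
  intro Z k p x a b hx
  have act_section : Hom.elt e (X'.eltAct p (fun i => Hom.elt s (x i)) (hx.map s.obj)) =
      X.eltAct p x hx :=
    (isFunctor_iff_elt.1 he p _ (hx.map s.obj)).trans
      (eltAct_congr rfl (funext fun i => elt_section (x i)) (obj_section a) (obj_section b))
  have act_lift := isFunctor₂_iff_elt.1 h p (fun i => Hom.elt s (x i)) (hx.map s.obj)
  rw [CellHom.pre_elt, act_section] at act_lift
  exact act_lift.trans (cellAct_congr rfl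
    (funext fun i => (CellHom.pre_elt e φ _).trans (congrArg φ.elt (elt_section (x i))))
    (congrArg φ.obj (obj_section a)) (congrArg φ.obj (obj_section b)))

theorem IsFunctor.of_section {X' X Y : KPCat.{w} P} {e : X'.graph ⟶ X.graph}
    (he : IsFunctor X' X e) {s : X.graph ⟶ X'.graph} (hs : s ≫ e = 𝟙 X.graph)
    {f : X.graph ⟶ Y.graph} (h : IsFunctor X' Y (e ≫ f)) : IsFunctor X Y f := by
  rw [isFunctor_iff] at h ⊢
  refine IsFunctor₂.of_section he hs ?_
  have := CellHom.ofCell_pre e (Cell.ofHom f)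
  rw [Cell.pre_ofHom] at this
  exact this ▸ h

theorem eq_of_isFunctor_id {X Y : KPCat.{w} P} (h : X.graph = Y.graph)
    (hf : IsFunctor X Y (eqToHom h)) : X = Y := by
  obtain ⟨G, act, _, _⟩ := X
  obtain ⟨G', act', _, _⟩ := Y
  obtain rfl : G = G' := h
  congr 1
  funext k s t a b hp
  have := hf hp
  refine (Strict.comp_id _).symm.trans (this.trans ?_)
  refine Eq.trans ?_ (Strict.id_comp _)
  exact congrArg (· ≫ act' hp) (paramMap_id (P.obj k) fun i => G.hom (s i) (t i))

variable {F : StrictPseudofunctor (KGraph.{w} K) (KPCat.{w} P)}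

variable (F) in
/-- The graph morphism underlying the image of a morphism under a 2-functor. -/
abbrev mapHom {A B : KGraph.{w} K} (f : A ⟶ B) : (F.obj A).graph ⟶ (F.obj B).graph :=
  (F.map f).hom

variable (adj : TwoAdjunction F (forget P))

/-- The unit of an adjunction over graphs. -/
abbrev unitHom (A : KGraph.{w} K) : A ⟶ (F.obj A).graph := adj.unit.app A

/-- The graph morphism underlying the counit of an adjunction over graphs. -/
abbrev counitHom (X : KPCat.{w} P) : (F.obj X.graph).graph ⟶ X.graph := (adj.counit.app X).hom

theorem isFunctor_counitHom (X : KPCat.{w} P) : IsFunctor (F.obj X.graph) X (counitHom adj X) :=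
  (adj.counit.app X).isHom

theorem unitHom_counitHom (X : KPCat.{w} P) : unitHom adj X.graph ≫ counitHom adj X = 𝟙 X.graph :=
  adj.right_triangle X

theorem unitHom_naturality {A B : KGraph.{w} K} (f : A ⟶ B) :
    f ≫ unitHom adj B = unitHom adj A ≫ mapHom F f :=
  adj.unit.naturality f

theorem isFunctor_of_algebraMap {X Y : KPCat.{w} P} {f : X.graph ⟶ Y.graph}
    (h : counitHom adj X ≫ f = mapHom F f ≫ counitHom adj Y) : IsFunctor X Y f := by
  refine IsFunctor.of_section (isFunctor_counitHom adj X) (unitHom_counitHom adj X) ?_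
  rw [h]
  exact (iconStructure P).isHom_comp (X := F.obj X.graph) (Y := F.obj Y.graph) (Z := Y)
    (F.map f).isHom (isFunctor_counitHom adj Y)

theorem comparison_obj_injective : Function.Injective adj.comparison.obj := by
  intro X Y h
  have hA : X.graph = Y.graph := congrArg TwoMonad.Algebra.A h
  have ha : HEq (counitHom adj X) (counitHom adj Y) := by
    have key {A B : adj.twoMonad.Algebra} (h : A = B) : HEq A.a B.a := by rw [h]
    exact key h
  refine eq_of_isFunctor_id hA (isFunctor_of_algebraMap adj ?_)
  have key {G G' : KGraph.{w} K} (e : G = G') (a : (F.obj G).graph ⟶ G)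
      (a' : (F.obj G').graph ⟶ G') (ha : HEq a a') :
      a ≫ eqToHom e = (F.map (eqToHom e)).hom ≫ a' := by
    subst e
    obtain rfl := eq_of_heq ha
    rw [eqToHom_refl, F.map_id]
    exact (Strict.comp_id _).trans (Strict.id_comp _).symm
  exact key hA _ _ ha

theorem comparison_map_bijective (X Y : KPCat.{w} P) :
    Function.Bijective (adj.comparison.map : (X ⟶ Y) → _) := by
  refine ⟨fun f g h => StructureOver.Hom.ext ?_, fun g => ?_⟩
  · exact congrArg (StructureOver.Hom.hom (S := adj.twoMonad.algebraStructure)) h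
  · exact ⟨⟨g.hom, isFunctor_of_algebraMap adj g.isHom⟩, rfl⟩

theorem isIcon_of_algebraCell {X Y : KPCat.{w} P} {f g : X.graph ⟶ Y.graph}
    (hf : IsFunctor X Y f) (hg : IsFunctor X Y g) {α : f ⟶ g}
    (h : Cell.pre (counitHom adj X) (Arrow.mk α) =
      Cell.post (Arrow.mk (F.map₂ α).hom) (counitHom adj Y)) :
    IsIcon X Y α := by
  refine (isFunctor₂_ofHom₂ hf hg α).1 (IsFunctor₂.of_section (isFunctor_counitHom adj X)
    (unitHom_counitHom adj X) ?_)
  change IsFunctor₂ _ _ ((CellHom.ofCell (Arrow.mk α)).pre _)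
  rw [← CellHom.ofCell_pre, h]
  exact isFunctor₂_cellHom (Cell.post (Arrow.mk (F.map₂ α)) (adj.counit.app Y))

theorem comparison_map₂_bijective {X Y : KPCat.{w} P} (f g : X ⟶ Y) :
    Function.Bijective (adj.comparison.map₂ : (f ⟶ g) → _) := by
  refine ⟨fun α β h => StructureOver.Hom₂.ext ?_, fun α => ?_⟩
  · exact congrArg (StructureOver.Hom₂.hom (S := adj.twoMonad.algebraStructure)) h
  · refine ⟨⟨α.hom, isIcon_of_algebraCell adj f.isHom g.isHom ?_⟩, rfl⟩
    exact arrowMk_eq_of_heq (adj.comparison.map f).isHom (adj.comparison.map g).isHom α.isHom₂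

theorem eq_counit {X : KPCat.{w} P} {b : F.obj X.graph ⟶ X}
    (h : unitHom adj X.graph ≫ b.hom = 𝟙 X.graph) : b = adj.counit.app X := by
  have h₁ : F.map b.hom ≫ adj.counit.app X = adj.counit.app (F.obj X.graph) ≫ b :=
    adj.counit.naturality b
  have h₂ : F.map (unitHom adj X.graph) ≫ F.map b.hom = 𝟙 (F.obj X.graph) :=
    (F.map_comp _ _).symm.trans ((congrArg F.map h).trans (F.map_id _))
  have h₃ : F.map (unitHom adj X.graph) ≫ adj.counit.app (F.obj X.graph) = 𝟙 (F.obj X.graph) :=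
    adj.left_triangle X.graph
  have h₄ := congrArg (F.map (unitHom adj X.graph) ≫ ·) h₁
  refine Eq.trans ?_ (Eq.trans h₄.symm ?_)
  · refine Eq.trans ?_ (Strict.assoc _ _ _)
    exact ((congrArg (· ≫ b) h₃).trans (Strict.id_comp _)).symm
  · refine (Strict.assoc _ _ _).symm.trans ?_
    exact (congrArg (· ≫ adj.counit.app X) h₂).trans (Strict.id_comp _)

section Algebra

variable {A : KGraph.{w} K} (a : (F.obj A).graph ⟶ A)

theorem elt_eltAct_of_algebra (ha : counitHom adj (F.obj A) ≫ a = mapHom F a ≫ a) {Z : K} {k : ℕ}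
    (p : Z ⟶ P.obj k) (e : Fin k → (F.obj A).graph.Elt Z) {x y : (F.obj A).graph.Obj}
    (h : IsPath x y (fun i => (e i).src) (fun i => (e i).tgt)) :
    Hom.elt a ((F.obj A).eltAct p e h) =
      Hom.elt a ((F.obj A).eltAct p (fun i => Hom.elt (unitHom adj A) (Hom.elt a (e i)))
        ((h.map a.obj).map (unitHom adj A).obj)) := by
  let u := unitHom adj (F.obj A).graph
  have hu : u ≫ counitHom adj (F.obj A) = 𝟙 _ := unitHom_counitHom adj _
  have hua : u ≫ mapHom F a = a ≫ unitHom adj A := (unitHom_naturality adj a).symm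
  have act_counit : Hom.elt (counitHom adj (F.obj A))
      ((F.obj (F.obj A).graph).eltAct p (fun i => Hom.elt u (e i)) (h.map u.obj)) =
        (F.obj A).eltAct p e h :=
    (isFunctor_iff_elt.1 (isFunctor_counitHom adj (F.obj A)) p _ (h.map u.obj)).trans
      (eltAct_congr rfl (funext fun i => Hom.elt_elt_of_comp_eq_id hu (e i))
        (Hom.obj_obj_of_comp_eq_id hu x) (Hom.obj_obj_of_comp_eq_id hu y))
  have act_map : Hom.elt (mapHom F a)
      ((F.obj (F.obj A).graph).eltAct p (fun i => Hom.elt u (e i)) (h.map u.obj)) =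
        (F.obj A).eltAct p (fun i => Hom.elt (unitHom adj A) (Hom.elt a (e i)))
          ((h.map a.obj).map (unitHom adj A).obj) :=
    (isFunctor_iff_elt.1 (F.map a).isHom p _ (h.map u.obj)).trans
      (eltAct_congr rfl (funext fun i => Hom.elt_elt_of_comm hua (e i))
        (congrFun (congrArg Hom.obj hua) x) (congrFun (congrArg Hom.obj hua) y))
  rw [← act_counit, ← act_map]
  exact Hom.elt_elt_of_comm ha _

variable (h₁ : unitHom adj A ≫ a = 𝟙 A)
include h₁

theorem exists_algebraAct {k : ℕ} {s t : Fin k → A.Obj} {x y : A.Obj} (h : IsPath x y s t) :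
    ∃ m : (P.obj k ⨯ ∏ᶜ fun i => A.hom (s i) (t i)) ⟶ A.hom x y,
      ∀ {Z : K} (p : Z ⟶ P.obj k) (f : ∀ i, Z ⟶ A.hom (s i) (t i)),
        (⟨x, y, prod.lift p (Pi.lift f) ≫ m⟩ : A.Elt Z) =
          Hom.elt a ((F.obj A).eltAct p (fun i => Hom.elt (unitHom adj A) ⟨s i, t i, f i⟩)
            (h.map (unitHom adj A).obj)) := by
  obtain ⟨m, hm⟩ := Edge.exists_mk_eq (X := A)
    (E := fun c => (P.obj k ⨯ ∏ᶜ fun i => A.hom (s i) (t i)) ⟶ c) (a := x) (b := y)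
    (Hom.elt a ((F.obj A).eltAct prod.fst (fun i => Hom.elt (unitHom adj A)
      ⟨s i, t i, prod.snd ≫ Pi.π _ i⟩) (h.map (unitHom adj A).obj)))
    (Hom.obj_obj_of_comp_eq_id h₁ x) (Hom.obj_obj_of_comp_eq_id h₁ y)
  refine ⟨m, fun {Z} p f => ?_⟩
  refine (congrArg (Elt.pre (prod.lift p (Pi.lift f))) hm).trans ?_
  refine (Hom.elt_pre a _ _).symm.trans (congrArg (Hom.elt a) ?_)
  refine (eltAct_pre (prod.lift p (Pi.lift f)) _ _ _).trans (eltAct_congr (prod.lift_fst _ _)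
    (funext fun i => congrArg (Edge.mk _ _) ?_) rfl rfl)
  exact (Strict.assoc _ _ _).symm.trans (congrArg (· ≫ _) (paramLift_snd p f i))

/-- The composition maps of an algebra `a` for the induced 2-monad: `a` is applied to the composite,
in the free `(K, P)`-category, of the images under the unit. -/
noncomputable def algebraAct {k : ℕ} {s t : Fin k → A.Obj} {x y : A.Obj} (h : IsPath x y s t) :
    (P.obj k ⨯ ∏ᶜ fun i => A.hom (s i) (t i)) ⟶ A.hom x y :=
  (exists_algebraAct adj a h₁ h).choose

theorem algebraAct_elt {k : ℕ} {s t : Fin k → A.Obj} {x y : A.Obj} (h : IsPath x y s t) {Z : K}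
    (p : Z ⟶ P.obj k) (f : ∀ i, Z ⟶ A.hom (s i) (t i)) :
    (⟨x, y, prod.lift p (Pi.lift f) ≫ algebraAct adj a h₁ h⟩ : A.Elt Z) =
      Hom.elt a ((F.obj A).eltAct p (fun i => Hom.elt (unitHom adj A) ⟨s i, t i, f i⟩)
        (h.map (unitHom adj A).obj)) :=
  (exists_algebraAct adj a h₁ h).choose_spec p f

variable (h₂ : counitHom adj (F.obj A) ≫ a = mapHom F a ≫ a)

/-- The `(K, P)`-category of an algebra for the induced 2-monad. -/
noncomputable def ofAlgebra : KPCat.{w} P where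
  graph := A
  act h := algebraAct adj a h₁ h
  act_unit x y h Z f := by
    refine Edge.mk_injective (X := A) (E := fun c => Z ⟶ c) ?_
    refine (algebraAct_elt adj a h₁ h _ fun _ => f).trans (Eq.trans (congrArg (Hom.elt a) ?_)
      (Hom.elt_elt_of_comp_eq_id h₁ ⟨x, y, f⟩))
    exact congrArg (Edge.mk _ _) ((F.obj A).act_unit _ _ _ _ _)
  act_mul {k} n S T s t x y H h h' Z p q f := by
    let u := unitHom adj A
    refine Edge.mk_injective (X := A) (E := fun c => Z ⟶ c) ?_
    refine (algebraAct_elt adj a h₁ h' _ f).trans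
      (Eq.trans ?_ (algebraAct_elt adj a h₁ H p _).symm)
    have free_mul := congrArg (Edge.mk (X := (F.obj A).graph) (E := fun c => Z ⟶ c) _ _)
      ((F.obj A).act_mul n _ _ _ _ _ _ (H.map u.obj) (fun i => (h i).map u.obj) (h'.map u.obj)
        Z p q fun l => f l ≫ u.map _ _)
    refine (congrArg (Hom.elt a) free_mul).trans ?_
    refine (elt_eltAct_of_algebra adj a h₂ p (fun i => (F.obj A).eltAct (q i)
      (fun j => Hom.elt u ⟨_, _, f (finSigmaFinEquiv ⟨i, j⟩)⟩) ((h i).map u.obj))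
      (H.map u.obj)).trans ?_
    refine congrArg (Hom.elt a) (eltAct_congr rfl (funext fun i => congrArg (Hom.elt u)
      (algebraAct_elt adj a h₁ (h i) (q i) _).symm) ?_ ?_)
    · exact congrArg u.obj (Hom.obj_obj_of_comp_eq_id h₁ x)
    · exact congrArg u.obj (Hom.obj_obj_of_comp_eq_id h₁ y)

theorem isFunctor_ofAlgebra : IsFunctor (F.obj A) (ofAlgebra adj a h₁ h₂) a :=
  (isFunctor_iff_elt (X := F.obj A) (Y := ofAlgebra adj a h₁ h₂) (F := a)).2
    fun _ _ p e _ _ h => (elt_eltAct_of_algebra adj a h₂ p e h).trans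
      (algebraAct_elt adj a h₁ (h.map a.obj) p _).symm

end Algebra

theorem comparison_obj_surjective : Function.Surjective adj.comparison.obj := by
  rintro ⟨A, a, h₁, h₂⟩
  let X := ofAlgebra adj a h₁ h₂
  let b : F.obj X.graph ⟶ X := ⟨a, isFunctor_ofAlgebra adj a h₁ h₂⟩
  have ha : a = counitHom adj X := congrArg StructureOver.Hom.hom (eq_counit adj (b := b) h₁)
  refine ⟨X, ?_⟩
  change (⟨A, counitHom adj X, _, _⟩ : adj.twoMonad.Algebra) = _
  congr 1
  exact ha.symm

theorem isTwoIso_comparison : IsTwoIso adj.comparison where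
  bijective_obj := ⟨comparison_obj_injective adj, comparison_obj_surjective adj⟩
  bijective_map := comparison_map_bijective adj
  bijective_map₂ := comparison_map₂_bijective adj

section Free

variable (hK : InfinitelyDistributive.{w} K)
include hK

variable (P) in
theorem isTwoUniversal_freeUnit (X : KGraph.{w} K) :
    IsTwoUniversal (forget P) (Y := free hK P X) (freeUnit hK P X) := by
  intro Z α
  obtain ⟨ψ, ⟨hψ, hψα⟩, hψ_unique⟩ := existsUnique_freeExtension hK (P := P) (Y := Z)
    (CellHom.ofCell (X := X) (Y := Z.graph) α)
  obtain ⟨β, rfl⟩ := exists_cellHom_eq hψ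
  have ofCell_restrict (γ : Cell (free hK P X) Z) :
      CellHom.ofCell ((γ.map (forget P)).pre (freeUnit hK P X)) =
        (cellHom γ).pre (freeUnit hK P X) :=
    CellHom.ofCell_pre _ _
  refine ⟨β, CellHom.ofCell_injective ((ofCell_restrict β).trans hψα), fun γ hγ => ?_⟩
  exact cellHom_injective (hψ_unique _ ⟨isFunctor₂_cellHom γ,
    (ofCell_restrict γ).symm.trans (congrArg CellHom.ofCell hγ)⟩)

variable (P) in
/-- The free-forgetful 2-adjunction between graphs and `(K, P)`-categories. -/
noncomputable def freeAdjunction :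
    TwoAdjunction (IsTwoUniversal.leftAdjoint (isTwoUniversal_freeUnit P hK)) (forget P) :=
  IsTwoUniversal.adjunction (isTwoUniversal_freeUnit P hK)

variable (P) in
theorem isFreeMonad_freeAdjunction : IsFreeMonad P (freeAdjunction P hK).twoMonad.toMonad := by
  refine ⟨_, (freeAdjunction P hK).toAdjunction, rfl, ?_⟩
  rintro X η rfl
  refine ⟨Function.bijective_id, fun a b => ?_⟩
  have h := isTwoCoproduct_freeInj hK P X a b
  rw [← funext (paramMap_freeUnit_act hK (P := P) (X := X) (a := a) (b := b))] at h
  exact h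

end Free

end KPCat

/-! ### Products -/

theorem HasFiniteTwoProducts.of_binary {B : Type u} [Bicategory.{w₂, v} B] [Strict B] {e : B}
    (he : ∀ Z : B, Nonempty (Unique (Cell Z e)))
    (hp : ∀ a b : B, ∃ (p : B) (π₁ : p ⟶ a) (π₂ : p ⟶ b), ∀ (Z : B) (α : Cell Z a) (β : Cell Z b),
      ∃! γ : Cell Z p, γ.post π₁ = α ∧ γ.post π₂ = β) : HasFiniteTwoProducts B := by
  refine ⟨fun n => ?_⟩
  induction n with
  | zero =>
    refine fun X => ⟨e, fun i => i.elim0, isTwoProduct_iff.2 fun Z α => ?_⟩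
    obtain ⟨_⟩ := he Z
    exact ⟨default, fun i => i.elim0, fun β _ => Unique.eq_default β⟩
  | succ n ih =>
    intro X
    obtain ⟨q, ρ, hq⟩ := ih fun i => X i.succ
    obtain ⟨p, π₁, π₂, h⟩ := hp (X 0) q
    refine ⟨p, fun i => Fin.cases (motive := fun i => p ⟶ X i) π₁ (fun i => π₂ ≫ ρ i) i,
      isTwoProduct_iff.2 fun Z α => ?_⟩
    obtain ⟨β, hβ⟩ := hq.exists_cellLift fun i => α i.succ
    obtain ⟨γ, ⟨h₁, h₂⟩, γ_unique⟩ := h Z (α 0) β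
    refine ⟨γ, Fin.cases h₁ fun i => ?_, fun γ' h' => γ_unique γ' ⟨h' 0, hq.cell_ext fun i => ?_⟩⟩
    · rw [Cell.post_post, hβ]
      exact h' i.succ
    · change γ.post (π₂ ≫ ρ i) = _
      rw [← Cell.post_post, h₂, hβ]

section

variable {K : Type u} [Bicategory.{w₂, v} K] [Strict K] [HasFiniteTwoProducts K] {A Z : K} {k : ℕ}
  {X Y : Fin k → K}

theorem TwoCat.Cell.param_post_paramMap (p : Cell Z A) (f : ∀ i, Cell Z (X i))
    (F : ∀ i, X i ⟶ Y i) :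
    (Cell.param p f).post (paramMap A F) = Cell.param p (fun i => (f i).post (F i)) := by
  apply Cell.param_ext
  · rw [Cell.post_post, paramMap_fst, Cell.param_fst, Cell.param_fst]
  · intro i
    rw [Cell.post_post, paramMap_snd, ← Cell.post_post, Cell.param_snd, Cell.param_snd]

theorem paramLift_paramMap (p : Z ⟶ A) (f : ∀ i, Z ⟶ X i) (F : ∀ i, X i ⟶ Y i) :
    prod.lift p (Pi.lift f) ≫ paramMap A F = prod.lift p (Pi.lift fun i => f i ≫ F i) :=
  param_hom_ext (by rw [Category.assoc, paramMap_fst, prod.lift_fst, prod.lift_fst]) fun i => by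
    rw [Category.assoc, paramMap_snd, paramLift_snd, ← Category.assoc, ← Category.assoc,
      Category.assoc _ prod.snd, paramLift_snd]

end

namespace KGraph

variable {K : Type u} [Bicategory.{w₂, v} K]

theorem CellHom.map_eq_of_mk_eq_mk {X Y : KGraph.{w} K} {f : X.Obj → Y.Obj}
    {m m' : ∀ a b, Cell (X.hom a b) (Y.hom (f a) (f b))}
    (h : CellHom.mk f m = CellHom.mk f m') (a b : X.Obj) : m a b = m' a b := by
  injection h with _ h
  rw [h]

variable [Strict K] [HasFiniteTwoProducts K]

/-- The product of two graphs, formed objectwise and homwise. -/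
noncomputable abbrev prod (G H : KGraph.{w} K) : KGraph.{w} K :=
  ⟨G.Obj × H.Obj, fun x y => G.hom x.1 y.1 ⨯ H.hom x.2 y.2⟩

/-- The first projection of a product of graphs. -/
noncomputable abbrev prodFst (G H : KGraph.{w} K) : G.prod H ⟶ G :=
  Hom.mk (X := G.prod H) Prod.fst fun _ _ => prod.fst

/-- The second projection of a product of graphs. -/
noncomputable abbrev prodSnd (G H : KGraph.{w} K) : G.prod H ⟶ H :=
  Hom.mk (X := G.prod H) Prod.snd fun _ _ => prod.snd

namespace CellHom

variable {Z G H : KGraph.{w} K}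

theorem prod_ext {γ γ' : CellHom Z (G.prod H)} (h₁ : γ.post (prodFst G H) = γ'.post (prodFst G H))
    (h₂ : γ.post (prodSnd G H) = γ'.post (prodSnd G H)) : γ = γ' := by
  obtain ⟨f, m⟩ := γ
  obtain ⟨f', m'⟩ := γ'
  obtain rfl : f = f' := funext fun a => Prod.ext (congrFun (congrArg CellHom.obj h₁) a)
    (congrFun (congrArg CellHom.obj h₂) a)
  congr 1
  funext a b
  exact Cell.prod_ext (map_eq_of_mk_eq_mk h₁ a b) (map_eq_of_mk_eq_mk h₂ a b)

theorem exists_prodLift (φ : CellHom Z G) (ψ : CellHom Z H) :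
    ∃ γ : CellHom Z (G.prod H), γ.post (prodFst G H) = φ ∧ γ.post (prodSnd G H) = ψ := by
  choose m hm₁ hm₂ using fun a b => Cell.exists_prodLift (φ.map a b) (ψ.map a b)
  exact ⟨⟨fun a => (φ.obj a, ψ.obj a), m⟩,
    congrArg (CellHom.mk _) (funext fun a => funext (hm₁ a)),
    congrArg (CellHom.mk _) (funext fun a => funext (hm₂ a))⟩

end CellHom

end KGraph

namespace KPCat

variable {K : Type u} [Bicategory.{w₂, v} K] [Strict K] [HasFiniteTwoProducts K] {P : Operad K}

section Binary

variable (A B : KPCat.{w} P)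

/-- Composition in the product of two `(K, P)`-categories. -/
noncomputable abbrev prodAct {k : ℕ} {s t : Fin k → (A.graph.prod B.graph).Obj}
    {a b : (A.graph.prod B.graph).Obj} (h : IsPath a b s t) :
    (P.obj k ⨯ ∏ᶜ fun i => (A.graph.prod B.graph).hom (s i) (t i)) ⟶
      (A.graph.prod B.graph).hom a b :=
  prod.lift (paramMap (P.obj k) (fun _ => prod.fst) ≫ A.act (h.map Prod.fst))
    (paramMap (P.obj k) (fun _ => prod.snd) ≫ B.act (h.map Prod.snd))

variable {A B}

section

variable {k : ℕ} {s t : Fin k → (A.graph.prod B.graph).Obj} {a b : (A.graph.prod B.graph).Obj}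
  (h : IsPath a b s t) {Z : K} (p : Z ⟶ P.obj k)
  (f : ∀ i, Z ⟶ (A.graph.prod B.graph).hom (s i) (t i))

theorem lift_prodAct_fst : (prod.lift p (Pi.lift f) ≫ prodAct A B h) ≫ prod.fst =
    prod.lift p (Pi.lift fun i => f i ≫ prod.fst) ≫ A.act (h.map Prod.fst) := by
  rw [Category.assoc, prod.lift_fst, ← Category.assoc, paramLift_paramMap]

theorem lift_prodAct_snd : (prod.lift p (Pi.lift f) ≫ prodAct A B h) ≫ prod.snd =
    prod.lift p (Pi.lift fun i => f i ≫ prod.snd) ≫ B.act (h.map Prod.snd) := by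
  rw [Category.assoc, prod.lift_snd, ← Category.assoc, paramLift_paramMap]

end

variable (A B)

/-- The product of two `(K, P)`-categories. -/
noncomputable abbrev prodCat : KPCat.{w} P where
  graph := A.graph.prod B.graph
  act h := prodAct A B h
  act_unit a b h Z f := by
    apply prod.hom_ext
    · rw [lift_prodAct_fst]; exact A.act_unit _ _ _ _ _
    · rw [lift_prodAct_snd]; exact B.act_unit _ _ _ _ _
  act_mul n S T s t a b H h h' Z p q f := by
    apply prod.hom_ext
    · simp only [lift_prodAct_fst]
      exact A.act_mul n _ _ _ _ _ _ _ (fun i => (h i).map Prod.fst) _ _ _ _ _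
    · simp only [lift_prodAct_snd]
      exact B.act_mul n _ _ _ _ _ _ _ (fun i => (h i).map Prod.snd) _ _ _ _ _

/-- The first projection of a product of `(K, P)`-categories. -/
noncomputable def prodFst : prodCat A B ⟶ A :=
  StructureOver.Hom.mk (S := iconStructure P) (X := prodCat A B) (Y := A)
    (KGraph.prodFst A.graph B.graph) fun _ _ _ _ _ _ => prod.lift_fst _ _

/-- The second projection of a product of `(K, P)`-categories. -/
noncomputable def prodSnd : prodCat A B ⟶ B :=
  StructureOver.Hom.mk (S := iconStructure P) (X := prodCat A B) (Y := B)
    (KGraph.prodSnd A.graph B.graph) fun _ _ _ _ _ _ => prod.lift_snd _ _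

variable {A B}

theorem IsFunctor₂.of_post_fst_snd {Z : KPCat.{w} P}
    {γ : CellHom Z.graph (A.graph.prod B.graph)}
    (h₁ : IsFunctor₂ Z A (γ.post (KGraph.prodFst A.graph B.graph)))
    (h₂ : IsFunctor₂ Z B (γ.post (KGraph.prodSnd A.graph B.graph))) :
    IsFunctor₂ Z (prodCat A B) γ := by
  intro k s t a b h
  apply Cell.prod_ext
  · rw [Cell.post_pre, Cell.post_post, prod.lift_fst, ← Cell.post_post, Cell.param_post_paramMap]
    simp only [Cell.post_pre]
    exact h₁ h
  · rw [Cell.post_pre, Cell.post_post, prod.lift_snd, ← Cell.post_post, Cell.param_post_paramMap]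
    simp only [Cell.post_pre]
    exact h₂ h

theorem cell_prodCat_ext {Z : KPCat.{w} P} {γ γ' : Cell Z (prodCat A B)}
    (h₁ : γ.post (prodFst A B) = γ'.post (prodFst A B))
    (h₂ : γ.post (prodSnd A B) = γ'.post (prodSnd A B)) : γ = γ' :=
  cellHom_injective (CellHom.prod_ext
    ((cellHom_post γ (prodFst A B)).symm.trans
      ((congrArg cellHom h₁).trans (cellHom_post γ' (prodFst A B))))
    ((cellHom_post γ (prodSnd A B)).symm.trans
      ((congrArg cellHom h₂).trans (cellHom_post γ' (prodSnd A B)))))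

theorem existsUnique_cell_prodCat (Z : KPCat.{w} P) (α : Cell Z A) (β : Cell Z B) :
    ∃! γ : Cell Z (prodCat A B), γ.post (prodFst A B) = α ∧ γ.post (prodSnd A B) = β := by
  obtain ⟨φ, hα, hβ⟩ := CellHom.exists_prodLift (cellHom α) (cellHom β)
  obtain ⟨γ, rfl⟩ := exists_cellHom_eq (IsFunctor₂.of_post_fst_snd (γ := φ)
    (hα.symm ▸ isFunctor₂_cellHom α) (hβ.symm ▸ isFunctor₂_cellHom β))
  have h₁ : γ.post (prodFst A B) = α :=
    cellHom_injective ((cellHom_post γ (prodFst A B)).trans hα)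
  have h₂ : γ.post (prodSnd A B) = β :=
    cellHom_injective ((cellHom_post γ (prodSnd A B)).trans hβ)
  exact ⟨γ, ⟨h₁, h₂⟩, fun γ' h' => cell_prodCat_ext (h'.1.trans h₁.symm) (h'.2.trans h₂.symm)⟩

end Binary

variable (P) in
/-- The terminal `(K, P)`-category. -/
noncomputable abbrev terminalCat : KPCat.{w} P where
  graph := ⟨PUnit, fun _ _ => ⊤_ K⟩
  act _ := terminal.from _
  act_unit _ _ _ _ _ := terminal.hom_ext _ _
  act_mul _ _ _ _ _ _ _ _ _ _ _ _ _ _ := terminal.hom_ext _ _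

theorem unique_cell_terminalCat (Z : KPCat.{w} P) :
    Nonempty (Unique (Cell Z (terminalCat.{w} P))) := by
  have subsingleton_cellHom (φ ψ : CellHom Z.graph (terminalCat.{w} P).graph) : φ = ψ := by
    obtain ⟨f, m⟩ := φ
    obtain ⟨g, n⟩ := ψ
    obtain rfl : f = g := funext fun _ => PUnit.ext _ _
    exact congrArg _ (funext fun a => funext fun b => Subsingleton.elim (m a b) (n a b))
  obtain ⟨γ, -⟩ := exists_cellHom_eq (X := Z) (Y := terminalCat.{w} P)
    (φ := ⟨fun _ => PUnit.unit, fun _ _ => Cell.ofHom (terminal.from _)⟩)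
    fun _ _ _ _ _ _ => Subsingleton.elim (α := Cell _ (⊤_ K)) _ _
  exact ⟨⟨⟨γ⟩, fun _ => cellHom_injective (subsingleton_cellHom _ _)⟩⟩

instance : HasFiniteTwoProducts (KPCat.{w} P) :=
  HasFiniteTwoProducts.of_binary unique_cell_terminalCat fun A B =>
    ⟨prodCat A B, prodFst A B, prodSnd A B, existsUnique_cell_prodCat⟩

end KPCat

/-! ### Coproducts -/

/-- The object `z` is initial in the 2-dimensional sense: there is exactly one 2-cell, hence exactly
one 1-cell, from `z` to each object. -/
def IsTwoInitial {B : Type u} [Bicategory.{w₂, v} B] (z : B) : Prop :=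
  ∀ c : B, Nonempty (Unique (Cell z c))

namespace IsTwoInitial

variable {B : Type u} [Bicategory.{w₂, v} B]

theorem cell_eq {z c : B} (h : IsTwoInitial z) (α β : Cell z c) : α = β := by
  obtain ⟨_⟩ := h c
  exact Subsingleton.elim α β

theorem hom_eq {z c : B} (h : IsTwoInitial z) (f g : z ⟶ c) : f = g :=
  Cell.ofHom_injective (h.cell_eq _ _)

theorem nonempty_hom {z : B} (h : IsTwoInitial z) (c : B) : Nonempty (z ⟶ c) := by
  obtain ⟨_⟩ := h c
  exact ⟨(default : Cell z c).left⟩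

theorem of_isTwoCoproduct {X : PEmpty.{w + 1} → B} {z : B} {j : ∀ i, X i ⟶ z}
    (h : IsTwoCoproduct X z j) : IsTwoInitial z := fun c => by
  obtain ⟨β, -, hβ⟩ := isTwoCoproduct_iff.1 h c fun i => i.elim
  exact ⟨⟨⟨β⟩, fun γ => hβ γ fun i => i.elim⟩⟩

theorem isTwoCoproduct {X : PEmpty.{w + 1} → B} {z : B} {j : ∀ i, X i ⟶ z}
    (h : IsTwoInitial z) : IsTwoCoproduct X z j := isTwoCoproduct_iff.2 fun c α => by
  obtain ⟨_⟩ := h c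
  exact ⟨default, fun i => i.elim, fun β _ => h.cell_eq _ _⟩

variable {K : Type u} [Bicategory.{w₂, v} K] [Strict K] [HasFiniteTwoProducts K]
  (hK : InfinitelyDistributive.{w} K)
include hK

-- An object `y` over an initial `z` is a retract of `y × z`, which is initial by distributivity.
theorem of_hom {z y : K} (h : IsTwoInitial z) (f : y ⟶ z) : IsTwoInitial y := fun c => by
  have h' := of_isTwoCoproduct (hK.distrib y PEmpty PEmpty.elim z (fun i => i.elim)
    h.isTwoCoproduct)
  obtain ⟨g⟩ := h.nonempty_hom c
  have cell_eq_pre (β : Cell y c) : β = (β.pre prod.fst).pre (prod.lift (𝟙 y) f) := by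
    rw [Cell.pre_pre, prod.lift_fst, Cell.pre_id]
  refine ⟨⟨⟨Cell.ofHom (f ≫ g)⟩, fun α => ?_⟩⟩
  rw [cell_eq_pre α, h'.cell_eq (α.pre prod.fst), ← cell_eq_pre]

end IsTwoInitial

theorem InfinitelyDistributive.exists_isTwoInitial {K : Type u} [Bicategory.{w₂, v} K] [Strict K]
    (hK : InfinitelyDistributive.{w} K) : ∃ z : K, IsTwoInitial z := by
  obtain ⟨z, _, h⟩ := hK.exists_isTwoCoproduct PEmpty PEmpty.elim
  exact ⟨z, .of_isTwoCoproduct h⟩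

namespace KGraph

variable {K : Type u} [Bicategory.{w₂, v} K]

theorem Edge.ext_of_isTwoInitial {X : KGraph.{w} K} {Z : K} (hZ : IsTwoInitial Z) {e e' : X.Elt Z}
    (hs : e.src = e'.src) (ht : e.tgt = e'.tgt) : e = e' := by
  obtain ⟨a, b, f⟩ := e
  obtain ⟨a', b', f'⟩ := e'
  subst hs ht
  exact congrArg (Edge.mk a b) (hZ.hom_eq _ _)

theorem CellElt.ext_of_isTwoInitial {X : KGraph.{w} K} {Z : K} (hZ : IsTwoInitial Z)
    {e e' : X.CellElt Z} (hs : e.src = e'.src) (ht : e.tgt = e'.tgt) : e = e' := by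
  obtain ⟨a, b, f⟩ := e
  obtain ⟨a', b', f'⟩ := e'
  subst hs ht
  exact congrArg (Edge.mk a b) (hZ.cell_eq _ _)

variable [Strict K]

/-- The morphisms `j i : Y i ⟶ D` exhibit `D` as the disjoint sum of the graphs `Y i`, with initial
hom-objects between different summands. -/
structure IsDisjointSum {ι : Type*} {Y : ι → KGraph.{w} K} {D : KGraph.{w} K}
    (j : ∀ i, Y i ⟶ D) : Prop where
  bijective : Function.Bijective fun x : Σ i, (Y i).Obj => (j x.1).obj x.2
  isIso : ∀ i a b, IsIso ((j i).map a b)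
  isTwoInitial : ∀ i i' a b, i ≠ i' → IsTwoInitial (D.hom ((j i).obj a) ((j i').obj b))

theorem exists_isDisjointSum (hz : ∃ z : K, IsTwoInitial z) {ι : Type w} (Y : ι → KGraph.{w} K) :
    ∃ (D : KGraph.{w} K) (j : ∀ i, Y i ⟶ D), IsDisjointSum j := by
  classical
  obtain ⟨z, hz⟩ := hz
  let D : KGraph.{w} K := ⟨Σ i, (Y i).Obj, fun x y =>
    if h : x.1 = y.1 then (Y y.1).hom (h ▸ x.2) y.2 else z⟩
  have hD (i : ι) (a b : (Y i).Obj) : (Y i).hom a b = D.hom ⟨i, a⟩ ⟨i, b⟩ := by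
    simp [D]
  let j (i : ι) : KGraph.Hom (Y i) D := ⟨fun a => ⟨i, a⟩, fun a b => eqToHom (hD i a b)⟩
  refine ⟨D, j, ?_, ?_, ?_⟩
  · exact Function.bijective_id
  · intro i a b
    exact inferInstanceAs (IsIso (eqToHom (hD i a b)))
  · intro i i' a b h
    have : D.hom ⟨i, a⟩ ⟨i', b⟩ = z := dif_neg h
    exact this ▸ hz

namespace IsDisjointSum

variable {ι : Type*} {Y : ι → KGraph.{w} K} {D : KGraph.{w} K} {j : ∀ i, Y i ⟶ D}
  (h : IsDisjointSum j)
include h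

theorem obj_injective (i : ι) : Function.Injective (j i).obj := fun a b e => by
  simpa using h.bijective.1 (a₁ := ⟨i, a⟩) (a₂ := ⟨i, b⟩) e

theorem index_eq {i i' : ι} {a : (Y i).Obj} {b : (Y i').Obj} (e : (j i).obj a = (j i').obj b) :
    i = i' :=
  congrArg Sigma.fst (h.bijective.1 (a₁ := ⟨i, a⟩) (a₂ := ⟨i', b⟩) e)

/-- The summand containing an object. -/
noncomputable def index (u : D.Obj) : ι := (h.bijective.2 u).choose.1

theorem exists_obj_eq {u : D.Obj} {i : ι} (hu : h.index u = i) : ∃ a, (j i).obj a = u := by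
  subst hu
  exact ⟨_, (h.bijective.2 u).choose_spec⟩

theorem elt_injective (i : ι) {W : K} : Function.Injective (Hom.elt (j i) : (Y i).Elt W → _) := by
  rintro ⟨a, b, f⟩ ⟨a', b', f'⟩ e
  obtain rfl := h.obj_injective i (congrArg Edge.src e)
  obtain rfl := h.obj_injective i (congrArg Edge.tgt e)
  have e' := Edge.mk_injective (X := D) (E := fun c => W ⟶ c) e
  have := h.isIso i a b
  exact congrArg (Edge.mk a b) ((cancel_mono _).1 e')

theorem exists_elt_eq {W : K} (e : D.Elt W) {i : ι} (hs : h.index e.src = i)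
    (ht : h.index e.tgt = i) : ∃ x : (Y i).Elt W, Hom.elt (j i) x = e := by
  obtain ⟨u, v, f⟩ := e
  obtain ⟨a, rfl⟩ := h.exists_obj_eq hs
  obtain ⟨b, rfl⟩ := h.exists_obj_eq ht
  have := h.isIso i a b
  refine ⟨⟨a, b, f ≫ inv ((j i).map a b)⟩, congrArg (Edge.mk _ _) ?_⟩
  rw [Category.assoc, IsIso.inv_hom_id, Category.comp_id]

theorem index_obj (i : ι) (a : (Y i).Obj) : h.index ((j i).obj a) = i := by
  obtain ⟨b, hb⟩ := h.exists_obj_eq (u := (j i).obj a) rfl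
  exact h.index_eq hb

theorem isTwoInitial_hom {u v : D.Obj} (huv : h.index u ≠ h.index v) :
    IsTwoInitial (D.hom u v) := by
  obtain ⟨a, ha⟩ := h.exists_obj_eq (u := u) rfl
  obtain ⟨b, hb⟩ := h.exists_obj_eq (u := v) rfl
  have := h.isTwoInitial _ _ a b huv
  rwa [ha, hb] at this

section CellDesc

variable {Z : KGraph.{w} K}

theorem cellHom_ext {φ ψ : CellHom D Z} (hφψ : ∀ i, φ.pre (j i) = ψ.pre (j i)) : φ = ψ := by
  have elt_eq {W : K} (i : ι) (x : (Y i).Elt W) :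
      φ.elt (Hom.elt (j i) x) = ψ.elt (Hom.elt (j i) x) := by
    rw [← CellHom.pre_elt, ← CellHom.pre_elt, hφψ]
  have obj_eq (u : D.Obj) : φ.obj u = ψ.obj u := by
    obtain ⟨a, ha⟩ := h.exists_obj_eq (u := u) rfl
    rw [← ha]
    exact congrArg (fun χ : CellHom (Y _) Z => χ.obj a) (hφψ _)
  refine CellHom.ext_elt fun u v => ?_
  by_cases huv : h.index u = h.index v
  · obtain ⟨x, hx⟩ := h.exists_elt_eq ⟨u, v, 𝟙 _⟩ huv rfl
    rw [← hx]
    exact elt_eq _ x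
  · exact CellElt.ext_of_isTwoInitial (h.isTwoInitial_hom huv) (obj_eq u) (obj_eq v)

theorem exists_objDesc {O : Type*} (f : ∀ i, (Y i).Obj → O) :
    ∃ o : D.Obj → O, ∀ i a, o ((j i).obj a) = f i a := by
  let σ := Equiv.ofBijective _ h.bijective
  exact ⟨fun u => f (σ.symm u).1 (σ.symm u).2, fun i a =>
    congrArg (fun x : Σ i, (Y i).Obj => f x.1 x.2) (σ.symm_apply_apply ⟨i, a⟩)⟩

theorem exists_cellDesc_map (φ : ∀ i, CellHom (Y i) Z) {o : D.Obj → Z.Obj}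
    (ho : ∀ i a, o ((j i).obj a) = (φ i).obj a) (u v : D.Obj) :
    ∃ m : Cell (D.hom u v) (Z.hom (o u) (o v)),
      ∀ {W : K} (g : W ⟶ D.hom u v) (i : ι) (x : (Y i).Elt W),
        (⟨u, v, g⟩ : D.Elt W) = Hom.elt (j i) x →
        (⟨o u, o v, m.pre g⟩ : Z.CellElt W) = (φ i).elt x := by
  by_cases huv : h.index u = h.index v
  · obtain ⟨x, hx⟩ := h.exists_elt_eq ⟨u, v, 𝟙 _⟩ huv rfl
    obtain ⟨m, hm⟩ := Edge.exists_mk_eq (X := Z) (E := fun c => Cell (D.hom u v) c)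
      (a := o u) (b := o v) ((φ _).elt x)
      ((ho _ _).symm.trans (congrArg o (congrArg Edge.src hx)))
      ((ho _ _).symm.trans (congrArg o (congrArg Edge.tgt hx)))
    refine ⟨m, fun {W} g i x' hx' => ?_⟩
    obtain rfl := h.index_eq ((congrArg Edge.src hx).trans (congrArg Edge.src hx'))
    have hxg : x.pre g = x' := by
      apply h.elt_injective
      rw [Hom.elt_pre, hx, ← hx']
      exact congrArg (Edge.mk u v) (Strict.comp_id g)
    rw [← hxg, CellHom.elt_pre, ← hm]
  · obtain ⟨_⟩ := h.isTwoInitial_hom huv (Z.hom (o u) (o v))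
    refine ⟨default, fun g i x hx => absurd ?_ huv⟩
    rw [show u = _ from congrArg Edge.src hx, show v = _ from congrArg Edge.tgt hx]
    exact (h.index_obj i x.src).trans (h.index_obj i x.tgt).symm

theorem exists_cellDesc (φ : ∀ i, CellHom (Y i) Z) :
    ∃ ψ : CellHom D Z, ∀ i, ψ.pre (j i) = φ i := by
  obtain ⟨o, ho⟩ := h.exists_objDesc fun i => (φ i).obj
  choose m hm using h.exists_cellDesc_map φ ho
  exact ⟨⟨o, m⟩, fun i => CellHom.ext_elt fun a b =>
    (CellHom.pre_elt _ _ _).trans (hm _ _ _ i ⟨a, b, 𝟙 _⟩ rfl)⟩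

end CellDesc

variable [HasFiniteTwoProducts K] (hK : InfinitelyDistributive.{w} K)
include hK

theorem index_src_eq_index_tgt {W : K} (e : D.Elt W) (hW : ¬ IsTwoInitial W) :
    h.index e.src = h.index e.tgt :=
  by_contra fun hne => hW ((h.isTwoInitial_hom hne).of_hom hK e.hom)

theorem exists_path {W : K} (hW : ¬ IsTwoInitial W) {k : ℕ} {e : Fin k → D.Elt W} {a b : D.Obj}
    (H : IsPath a b (fun i => (e i).src) (fun i => (e i).tgt)) :
    ∃ (i : ι) (x : Fin k → (Y i).Elt W) (a' b' : (Y i).Obj),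
      IsPath a' b' (fun l => (x l).src) (fun l => (x l).tgt) ∧
      (e = fun l => Hom.elt (j i) (x l)) ∧ a = (j i).obj a' ∧ b = (j i).obj b' := by
  obtain ⟨hab, hst⟩ := H.congr_of_edges h.index fun l => h.index_src_eq_index_tgt hK (e l) hW
  obtain ⟨a', rfl⟩ := h.exists_obj_eq hab
  obtain ⟨b', hb⟩ := h.exists_obj_eq (u := b) rfl
  choose x hx using fun l => h.exists_elt_eq (e l) (hst l).1 (hst l).2
  obtain rfl : (fun l => Hom.elt (j _) (x l)) = e := funext hx
  generalize h.index b = i at *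
  subst hb
  exact ⟨i, x, a', b', H.reflect (h.obj_injective i), rfl, rfl, rfl⟩

theorem exists_path_of_paths {W : K} (hW : ¬ IsTwoInitial W) {k : ℕ} {n : Fin k → ℕ}
    {e : Fin (∑ i, n i) → D.Elt W} {S T : Fin k → D.Obj} {a b : D.Obj} (H : IsPath a b S T)
    (H' : ∀ i, IsPath (S i) (T i) (fun l => (e (finSigmaFinEquiv ⟨i, l⟩)).src)
      (fun l => (e (finSigmaFinEquiv ⟨i, l⟩)).tgt)) :
    ∃ (i : ι) (x : Fin (∑ i, n i) → (Y i).Elt W) (S' T' : Fin k → (Y i).Obj) (a' b' : (Y i).Obj),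
      IsPath a' b' S' T' ∧
      (∀ l, IsPath (S' l) (T' l) (fun l' => (x (finSigmaFinEquiv ⟨l, l'⟩)).src)
        (fun l' => (x (finSigmaFinEquiv ⟨l, l'⟩)).tgt)) ∧
      (e = fun l => Hom.elt (j i) (x l)) ∧ (S = fun l => (j i).obj (S' l)) ∧
      (T = fun l => (j i).obj (T' l)) ∧ a = (j i).obj a' ∧ b = (j i).obj b' := by
  have hH' (i) := (H' i).congr_of_edges h.index
    fun l => h.index_src_eq_index_tgt hK (e (finSigmaFinEquiv ⟨i, l⟩)) hW
  obtain ⟨hab, hST⟩ := H.congr_of_edges h.index fun i => (hH' i).1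
  have he (l) : h.index (e l).src = h.index b ∧ h.index (e l).tgt = h.index b := by
    obtain ⟨⟨i, l⟩, rfl⟩ := finSigmaFinEquiv.surjective l
    exact ⟨((hH' i).2 l).1.trans (hST i).2, ((hH' i).2 l).2.trans (hST i).2⟩
  obtain ⟨a', rfl⟩ := h.exists_obj_eq hab
  obtain ⟨b', hb⟩ := h.exists_obj_eq (u := b) rfl
  choose x hx using fun l => h.exists_elt_eq (e l) (he l).1 (he l).2
  choose S' hS using fun l => h.exists_obj_eq (hST l).1
  choose T' hT using fun l => h.exists_obj_eq (hST l).2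
  obtain rfl : (fun l => Hom.elt (j _) (x l)) = e := funext hx
  obtain rfl : (fun l => (j _).obj (S' l)) = S := funext hS
  obtain rfl : (fun l => (j _).obj (T' l)) = T := funext hT
  generalize h.index b = i at *
  subst hb
  exact ⟨i, x, S', T', a', b', H.reflect (h.obj_injective i),
    fun l => (H' l).reflect (h.obj_injective i), rfl, rfl, rfl, rfl, rfl⟩

end IsDisjointSum

end KGraph

namespace KPCat

variable {K : Type u} [Bicategory.{w₂, v} K] [Strict K] [HasFiniteTwoProducts K] {P : Operad K}

theorem eltAct_unit {X : KPCat.{w} P} {Z : K} (e : Fin 1 → X.graph.Elt Z) {a b : X.graph.Obj}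
    (h : IsPath a b (fun i => (e i).src) (fun i => (e i).tgt)) :
    X.eltAct (terminal.from Z ≫ P.unit) e h = e 0 := by
  obtain ⟨e, rfl⟩ : ∃ e₀, e = fun _ => e₀ :=
    ⟨e 0, funext fun i => congrArg e (Subsingleton.elim i 0)⟩
  exact Elt.cell_injective ((eltAct_cell _ _ h).trans (cellAct_unit e.cell h))

section Sum

variable (hK : InfinitelyDistributive.{w} K) {ι : Type w}
include hK

section Existence

variable {Y : ι → KPCat.{w} P} {D : KGraph.{w} K} {j : ∀ i, (Y i).graph ⟶ D}
  (hj : IsDisjointSum j)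
include hj

theorem exists_sumAct {k : ℕ} {s t : Fin k → D.Obj} {a b : D.Obj} (h : IsPath a b s t) :
    ∃ m : (P.obj k ⨯ ∏ᶜ fun l => D.hom (s l) (t l)) ⟶ D.hom a b,
      ∀ {W : K} (p : W ⟶ P.obj k) (e : ∀ l, W ⟶ D.hom (s l) (t l)) (i : ι)
        (x : Fin k → (Y i).graph.Elt W) (a' b' : (Y i).graph.Obj)
        (h' : IsPath a' b' (fun l => (x l).src) (fun l => (x l).tgt)),
        (∀ l, (⟨s l, t l, e l⟩ : D.Elt W) = Hom.elt (j i) (x l)) →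
        a = (j i).obj a' → b = (j i).obj b' →
        (⟨a, b, prod.lift p (Pi.lift e) ≫ m⟩ : D.Elt W) =
          Hom.elt (j i) ((Y i).eltAct p x h') := by
  by_cases hV : IsTwoInitial (P.obj k ⨯ ∏ᶜ fun l => D.hom (s l) (t l))
  · obtain ⟨m⟩ := hV.nonempty_hom (D.hom a b)
    exact ⟨m, fun p e i x a' b' h' _ ha hb =>
      Edge.ext_of_isTwoInitial (hV.of_hom hK (prod.lift p (Pi.lift e))) ha hb⟩
  · obtain ⟨i₀, x₀, a₀, b₀, h₀, hx₀, rfl, rfl⟩ := hj.exists_path hK hV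
      (e := fun l => ⟨s l, t l, prod.snd ≫ Pi.π _ l⟩) h
    obtain ⟨m, hm⟩ := Edge.exists_mk_eq (X := D)
      (E := fun c => (P.obj k ⨯ ∏ᶜ fun l => D.hom (s l) (t l)) ⟶ c)
      (Hom.elt (j i₀) ((Y i₀).eltAct prod.fst x₀ h₀)) rfl rfl
    refine ⟨m, fun {W} p e i x a' b' h' hx ha hb => ?_⟩
    obtain rfl := hj.index_eq ha
    obtain rfl := hj.obj_injective _ ha
    obtain rfl := hj.obj_injective _ hb
    refine (congrArg (Elt.pre (prod.lift p (Pi.lift e))) hm).trans ?_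
    refine (Hom.elt_pre _ _ _).symm.trans (congrArg _ ?_)
    refine (eltAct_pre _ _ _ _).trans
      (eltAct_congr (prod.lift_fst _ _) (funext fun l => ?_) rfl rfl)
    refine hj.elt_injective _ ((Hom.elt_pre _ _ _).trans (Eq.trans ?_ (hx l)))
    refine (congrArg (Elt.pre (prod.lift p (Pi.lift e))) (congrFun hx₀ l)).symm.trans ?_
    refine congrArg (Edge.mk _ _) ?_
    exact (prod.lift_snd_assoc _ _ _).trans (Pi.lift_π _ _)

/-- Composition in a disjoint sum of `(K, P)`-categories. -/
noncomputable def sumAct {k : ℕ} {s t : Fin k → D.Obj} {a b : D.Obj} (h : IsPath a b s t) :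
    (P.obj k ⨯ ∏ᶜ fun l => D.hom (s l) (t l)) ⟶ D.hom a b :=
  (exists_sumAct hK hj h).choose

theorem mk_sumAct {k : ℕ} {s t : Fin k → D.Obj} {a b : D.Obj} (h : IsPath a b s t) {W : K}
    (p : W ⟶ P.obj k) {e : ∀ l, W ⟶ D.hom (s l) (t l)} {i : ι} {x : Fin k → (Y i).graph.Elt W}
    {a' b' : (Y i).graph.Obj} (h' : IsPath a' b' (fun l => (x l).src) (fun l => (x l).tgt))
    (hx : ∀ l, (⟨s l, t l, e l⟩ : D.Elt W) = Hom.elt (j i) (x l)) (ha : a = (j i).obj a')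
    (hb : b = (j i).obj b') :
    (⟨a, b, prod.lift p (Pi.lift e) ≫ sumAct hK hj h⟩ : D.Elt W) =
      Hom.elt (j i) ((Y i).eltAct p x h') :=
  (exists_sumAct hK hj h).choose_spec p e i x a' b' h' hx ha hb

/-- The `(K, P)`-category structure on a disjoint sum of the graphs underlying
`(K, P)`-categories. -/
noncomputable def sumCat : KPCat.{w} P where
  graph := D
  act h := sumAct hK hj h
  act_unit a b h Z f := by
    refine Edge.mk_injective (X := D) (E := fun c => Z ⟶ c) ?_
    by_cases hZ : IsTwoInitial Z
    · exact Edge.ext_of_isTwoInitial hZ rfl rfl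
    obtain ⟨i, x, a', b', h', hx, ha, hb⟩ := hj.exists_path hK hZ
      (e := fun _ : Fin 1 => ⟨a, b, f⟩) h
    refine (mk_sumAct hK hj h _ h' (congrFun hx) ha hb).trans ?_
    exact (congrArg _ (eltAct_unit x h')).trans (congrFun hx 0).symm
  act_mul n S T s t a b H h h' Z p q f := by
    refine Edge.mk_injective (X := D) (E := fun c => Z ⟶ c) ?_
    by_cases hZ : IsTwoInitial Z
    · exact Edge.ext_of_isTwoInitial hZ rfl rfl
    obtain ⟨i, x, S', T', a', b', H₁, h₁, hx, hS, hT, ha, hb⟩ := hj.exists_path_of_paths hK hZ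
      (e := fun l => ⟨s l, t l, f l⟩) H h
    have hx' := congrFun hx
    have hs : s = fun l => (j i).obj (x l).src := funext fun l => congrArg Edge.src (hx' l)
    have ht : t = fun l => (j i).obj (x l).tgt := funext fun l => congrArg Edge.tgt (hx' l)
    have h₂ : IsPath a' b' (fun l => (x l).src) (fun l => (x l).tgt) := by
      rw [hs, ht, ha, hb] at h'
      exact h'.reflect (hj.obj_injective i)
    refine (mk_sumAct hK hj h' _ h₂ hx' ha hb).trans ?_
    refine Eq.trans (congrArg (Hom.elt (j i)) (congrArg (Edge.mk _ _)
      ((Y i).act_mul n S' T' _ _ a' b' H₁ h₁ h₂ Z p q fun l => (x l).hom))) ?_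
    refine (mk_sumAct hK hj H p (x := fun l => (Y i).eltAct (q l)
      (fun l' => x (finSigmaFinEquiv ⟨l, l'⟩)) (h₁ l)) H₁ (fun l => ?_) ha hb).symm
    exact mk_sumAct hK hj (h l) (q l) (h₁ l) (fun l' => hx' _) (congrFun hS l) (congrFun hT l)

theorem isFunctor_sumCat (i : ι) : IsFunctor (Y i) (sumCat hK hj) (j i) :=
  isFunctor_iff_elt.2 fun {_ _} p _ {_ _} h =>
    (mk_sumAct hK hj (h.map (j i).obj) p h (fun _ => rfl) rfl rfl).symm

end Existence

theorem exists_isDisjointSum (Y : ι → KPCat.{w} P) :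
    ∃ (D : KPCat.{w} P) (j : ∀ i, Y i ⟶ D), IsDisjointSum (fun i => (j i).hom) := by
  obtain ⟨D, j, hj⟩ := KGraph.exists_isDisjointSum hK.exists_isTwoInitial fun i => (Y i).graph
  exact ⟨sumCat hK hj, fun i => ⟨j i, isFunctor_sumCat hK hj i⟩, hj⟩

theorem IsFunctor₂.of_isDisjointSum {Y : ι → KPCat.{w} P} {D Z : KPCat.{w} P}
    {j : ∀ i, (Y i).graph ⟶ D.graph} (hj : IsDisjointSum j) (hjf : ∀ i, IsFunctor (Y i) D (j i))
    {φ : CellHom D.graph Z.graph} (hφ : ∀ i, IsFunctor₂ (Y i) Z (φ.pre (j i))) :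
    IsFunctor₂ D Z φ := by
  refine isFunctor₂_iff_elt.2 fun {W} k p e a b h => ?_
  by_cases hW : IsTwoInitial W
  · exact CellElt.ext_of_isTwoInitial hW rfl rfl
  obtain ⟨i, x, a', b', h', rfl, rfl, rfl⟩ := hj.exists_path hK hW h
  have act_pre := isFunctor₂_iff_elt.1 (hφ i) p x h'
  rw [CellHom.pre_elt, isFunctor_iff_elt.1 (hjf i) p x h'] at act_pre
  exact act_pre.trans (cellAct_congr rfl (funext fun l => CellHom.pre_elt _ _ (x l)) rfl rfl)

theorem isTwoCoproduct_of_isDisjointSum {Y : ι → KPCat.{w} P} {D : KPCat.{w} P} {j : ∀ i, Y i ⟶ D}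
    (hj : IsDisjointSum fun i => (j i).hom) : IsTwoCoproduct Y D j := by
  refine isTwoCoproduct_iff.2 fun Z α => ?_
  obtain ⟨φ, hφ⟩ := hj.exists_cellDesc fun i => cellHom (α i)
  obtain ⟨β, rfl⟩ := exists_cellHom_eq (IsFunctor₂.of_isDisjointSum hK hj
    (fun i => (j i).isHom) fun i => (hφ i).symm ▸ isFunctor₂_cellHom (α i))
  refine ⟨β, fun i => cellHom_injective ((cellHom_pre (j i) β).trans (hφ i)), fun β' hβ' =>
    cellHom_injective (hj.cellHom_ext fun i => ?_)⟩
  exact (cellHom_pre (j i) β').symm.trans ((congrArg cellHom (hβ' i)).trans (hφ i).symm)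

end Sum

end KPCat

theorem IsTwoCoproduct.exists_iso {B : Type u} [Bicategory.{w₂, v} B] [Strict B] {ι : Type*}
    {X : ι → B} {c c' : B} {j : ∀ i, X i ⟶ c} {j' : ∀ i, X i ⟶ c'} (h : IsTwoCoproduct X c j)
    (h' : IsTwoCoproduct X c' j') : ∃ e : c ≅ c', ∀ i, j i ≫ e.hom = j' i := by
  obtain ⟨f, hf⟩ := h.exists_desc j'
  obtain ⟨g, hg⟩ := h'.exists_desc j
  refine ⟨⟨f, g, h.hom_ext fun i => ?_, h'.hom_ext fun i => ?_⟩, hf⟩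
  · rw [← Category.assoc, hf, hg, Category.comp_id]
  · rw [← Category.assoc, hg, hf, Category.comp_id]

namespace KGraph

variable {K : Type u} [Bicategory.{w₂, v} K] [Strict K] [HasFiniteTwoProducts K]

/-- The morphism `1 × f` of graphs. -/
noncomputable abbrev prodMap (A : KGraph.{w} K) {X Y : KGraph.{w} K} (f : X ⟶ Y) :
    A.prod X ⟶ A.prod Y :=
  Hom.mk (X := A.prod X) (Y := A.prod Y) (fun a => (a.1, f.obj a.2))
    fun _ _ => prod.map (𝟙 _) (f.map _ _)

theorem IsDisjointSum.prod (hK : InfinitelyDistributive.{w} K) (A : KGraph.{w} K) {ι : Type*}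
    {Y : ι → KGraph.{w} K} {D : KGraph.{w} K} {j : ∀ i, Y i ⟶ D} (h : IsDisjointSum j) :
    IsDisjointSum fun i => prodMap A (j i) := by
  refine ⟨⟨?_, ?_⟩, ?_, ?_⟩
  · rintro ⟨i, a, y⟩ ⟨i', a', y'⟩ e
    obtain rfl : a = a' := congrArg Prod.fst e
    have e : (j i).obj y = (j i').obj y' := congrArg Prod.snd e
    obtain rfl := h.index_eq e
    obtain rfl := h.obj_injective _ e
    rfl
  · rintro ⟨a, u⟩
    obtain ⟨⟨i, y⟩, rfl⟩ := h.bijective.2 u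
    exact ⟨⟨i, a, y⟩, rfl⟩
  · intro i a b
    have := h.isIso i a.2 b.2
    exact inferInstanceAs (IsIso (prod.map (𝟙 _) ((j i).map a.2 b.2)))
  · intro i i' a b hi
    exact (h.isTwoInitial i i' a.2 b.2 hi).of_hom hK prod.snd

end KGraph

namespace KPCat

variable {K : Type u} [Bicategory.{w₂, v} K] [Strict K] [HasFiniteTwoProducts K] {P : Operad K}

theorem isFunctor_prodMap (A : KPCat.{w} P) {X Y : KPCat.{w} P} {f : X.graph ⟶ Y.graph}
    (hf : IsFunctor X Y f) :
    IsFunctor (prodCat A X) (prodCat A Y) (KGraph.prodMap A.graph f) := by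
  intro k s t a b h
  apply prod.hom_ext
  · rw [Category.assoc, prod.map_fst, Category.comp_id, prod.lift_fst, Category.assoc,
      prod.lift_fst, ← Category.assoc, paramMap_comp]
    simp only [prod.map_fst, Category.comp_id]
  · rw [Category.assoc, prod.map_snd, ← Category.assoc, prod.lift_snd, Category.assoc,
      Category.assoc, prod.lift_snd, hf, ← Category.assoc, ← Category.assoc, paramMap_comp,
      paramMap_comp]
    simp only [prod.map_snd]

/-- The functor `1 × f` of `(K, P)`-categories. -/
noncomputable def prodMap (A : KPCat.{w} P) {X Y : KPCat.{w} P} (f : X ⟶ Y) :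
    prodCat A X ⟶ prodCat A Y :=
  StructureOver.Hom.mk (S := iconStructure P) (X := prodCat A X) (Y := prodCat A Y)
    (KGraph.prodMap A.graph f.hom) (isFunctor_prodMap A f.isHom)

theorem prodMap_fst (A : KPCat.{w} P) {X Y : KPCat.{w} P} (f : X ⟶ Y) :
    prodMap A f ≫ prodFst A Y = prodFst A X :=
  StructureOver.Hom.ext (congrArg (KGraph.Hom.mk _) (funext fun _ => funext fun _ =>
    (prod.map_fst _ _).trans (Category.comp_id _)))

theorem prodMap_snd (A : KPCat.{w} P) {X Y : KPCat.{w} P} (f : X ⟶ Y) :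
    prodMap A f ≫ prodSnd A Y = prodSnd A X ≫ f :=
  StructureOver.Hom.ext (congrArg (KGraph.Hom.mk _) (funext fun _ => funext fun _ =>
    prod.map_snd _ _))

theorem prodCat_hom_ext {Z A B : KPCat.{w} P} {f g : Z ⟶ prodCat A B}
    (h₁ : f ≫ prodFst A B = g ≫ prodFst A B) (h₂ : f ≫ prodSnd A B = g ≫ prodSnd A B) : f = g :=
  Cell.ofHom_injective <| cell_prodCat_ext
    (by rw [Cell.post_ofHom, Cell.post_ofHom, h₁]) (by rw [Cell.post_ofHom, Cell.post_ofHom, h₂])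

theorem exists_prodIso (A B : KPCat.{w} P) : ∃ e : (A ⨯ B) ≅ prodCat A B,
    e.hom ≫ prodFst A B = prod.fst ∧ e.hom ≫ prodSnd A B = prod.snd := by
  obtain ⟨γ, ⟨h₁, h₂⟩, -⟩ := existsUnique_cell_prodCat (A ⨯ B) (Cell.ofHom (prod.fst : (A ⨯ B) ⟶ A))
    (Cell.ofHom (prod.snd : (A ⨯ B) ⟶ B))
  have h₁ : γ.left ≫ prodFst A B = prod.fst := congrArg Comma.left h₁
  have h₂ : γ.left ≫ prodSnd A B = prod.snd := congrArg Comma.left h₂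
  refine ⟨⟨γ.left, prod.lift (prodFst A B) (prodSnd A B), ?_, ?_⟩, h₁, h₂⟩
  · apply prod.hom_ext
    · rw [Category.assoc, prod.lift_fst, h₁, Category.id_comp]
    · rw [Category.assoc, prod.lift_snd, h₂, Category.id_comp]
  · apply prodCat_hom_ext
    · rw [Category.assoc, h₁, prod.lift_fst, Category.id_comp]
    · rw [Category.assoc, h₂, prod.lift_snd, Category.id_comp]

variable (hK : InfinitelyDistributive.{w} K)
include hK

theorem infinitelyDistributive : InfinitelyDistributive.{w} (KPCat.{w} P) where
  exists_isTwoCoproduct ι X := by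
    obtain ⟨D, j, hj⟩ := exists_isDisjointSum hK X
    exact ⟨D, j, isTwoCoproduct_of_isDisjointSum hK hj⟩
  distrib A ι X c l hl := by
    obtain ⟨D, j, hj⟩ := exists_isDisjointSum hK X
    obtain ⟨θ, hθ⟩ := hl.exists_iso (isTwoCoproduct_of_isDisjointSum hK hj)
    have hD : IsTwoCoproduct (fun i => prodCat A (X i)) (prodCat A D) fun i => prodMap A (j i) :=
      isTwoCoproduct_of_isDisjointSum hK (hj.prod hK A.graph)
    choose u hu₁ hu₂ using fun i => exists_prodIso A (X i)
    obtain ⟨e, he₁, he₂⟩ := exists_prodIso A D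
    refine hD.of_iso u (prod.mapIso (Iso.refl A) θ ≪≫ e) fun i => ?_
    apply prodCat_hom_ext
    · simp only [Iso.trans_hom, prod.mapIso_hom, Category.assoc, he₁, prod.map_fst, Iso.refl_hom,
        Category.comp_id, prodMap_fst, hu₁]
    · simp only [Iso.trans_hom, prod.mapIso_hom, Category.assoc, he₂, prod.map_snd,
        prod.map_snd_assoc, prodMap_snd, reassoc_of% hu₂, hθ]

end KPCat

theorem proposition1 {K : Type u} [Bicategory.{w₂, v} K] [Strict K] [HasFiniteTwoProducts K]
    (hK : InfinitelyDistributive.{w} K) (P : Operad K) :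
    (∃ fc : TwoMonad (KGraph.{w} K),
      IsTwoMonadicVia (KPCat.forget.{w} P) fc ∧ KPCat.IsFreeMonad P fc.toMonad) ∧
    InfinitelyDistributive.{w} (KPCat.{w} P) := by
  exact ⟨⟨(KPCat.freeAdjunction P hK).twoMonad, ⟨_, KPCat.freeAdjunction P hK, rfl,
    KPCat.isTwoIso_comparison _⟩, KPCat.isFreeMonad_freeAdjunction P hK⟩,
    KPCat.infinitelyDistributive hK⟩
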